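/- **Capacity-achieving codes over the binary-input AWGN channel have flat EXIT curves.** For $\gamma\ge 0$ let $I_2(\gamma)$ be the mutual information, in bits, between an equiprobable $X\in\{+1,-1\}$ and $\sqrt\gamma\,X+N$, where $N\sim\mathcal N(0,1)$ is independent of $X$. For a nonempty binary code $\mathbf C\subseteq\{+1,-1\}^n$, let $\vec X$ be uniform on $\mathbf C$ and let $Y_i=\sqrt\gamma\,X_i+N_i$ with i.i.d. noise $N_i\sim\mathcal N(0,1)$ independent of $\vec X$. Its rate is $\frac1n\log_2|\mathbf C|$, and its extrinsic LLRs at a priori SNR $\gamma$ are $$L_{ext}(X_i)=\log\frac{P(X_i=1\mid Y_j,\ j\ne i)}{P(X_i=-1\mid Y_j,\ j\ne i)}\in[-\infty,\infty].$$ Its extrinsic information at a priori SNR $\gamma$ is $\frac1n\sum_{i=1}^n I(X_i;L_{ext}(X_i))$, in bits. Its EXIT curve is this quantity as a function of the a priori information $a=I_2(\gamma)\in[0,1)$. Let $SNR>0$ and let $(\mathbf C_k)$ be a capacity-achieving sequence of binary codes of lengths $n_k$ and rate $R=I_2(SNR)$: the rates of the $\mathbf C_k$ tend to $R$, and for every $\gamma>SNR$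 there are decoders for which the block error probability (averaged over the codewords) over the AWGN channel with signal to noise ratio $\gamma$ tends to $0$. Then, as $k\to\infty$: 1. The bits are equiprobable: $\frac1{n_k}\sum_{i=1}^{n_k}\left|P(X_i=1)-\tfrac12\right|\to0$. 2. For $0\le\gamma<SNR$ the extrinsic LLRs are zero: $\frac1{n_k}\sum_{i=1}^{n_k}P\left(|L_{ext}(X_i)|>\varepsilon\right)\to0$ for every $\varepsilon>0$; and $\frac1{n_k}\sum_{i=1}^{n_k} I(X_i;L_{ext}(X_i))\to0$. 3. For $\gamma>SNR$ the extrinsic LLRs are infinite, with the sign of the bit: $\frac1{n_k}\sum_{i=1}^{n_k}P\left(X_iL_{ext}(X_i)\le M\right)\to0$ for every real $M$; and $\frac1{n_k}\sum_{i=1}^{n_k} I(X_i;L_{ext}(X_i))\to1$. 4. The EXIT curve is flat and matched to the channel: at each a priori information $a$ it tends to $0$ if $0\le a<I_2(SNR)$ and to $1$ if $I_2(SNR)<a<1$. The EXIT curve of each $\mathbf C_k$ is integrable on $[0,1]$, and the area under it tends to $1-R$. -/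

import Mathlib

open MeasureTheory ProbabilityTheory Filter Topology
open scoped ENNReal

noncomputable section

/-- Mutual information `I(X;Y)`, in bits: the Kullback-Leibler divergence of the joint law from the
product of the marginal laws, divided by `log 2`. (It is used with `X` binary, where the divergence
is finite.) -/
def mutualInfoBits {Ω α β : Type*} [MeasurableSpace Ω] [MeasurableSpace α] [MeasurableSpace β]
    (μ : Measure Ω) (X : Ω → α) (Y : Ω → β) : ℝ :=
  (InformationTheory.klDiv (μ.map (fun ω => (X ω, Y ω))) ((μ.map X).prod (μ.map Y))).toReal
    / Real.log 2

/-- The channel symbol of a bit: `true ↦ +1`, `false ↦ -1`. -/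
def bpsk (b : Bool) : ℝ := if b then 1 else -1

/-- `I₂(γ)`: the mutual information between an equiprobable `X ∈ {+1,-1}` and
`Y = √γ X + N`, with `N ∼ N(0,1)` independent of `X`. -/
def biAwgnInfo (γ : ℝ) : ℝ :=
  mutualInfoBits ((uniformOn (Set.univ : Set Bool)).prod (gaussianReal 0 1))
    (fun ω => ω.1) (fun ω => Real.sqrt γ * bpsk ω.1 + ω.2)

/-- The a priori SNR at which the a priori information `I₂` reaches the level `a`
(the inverse of the increasing function `I₂` on `[0,∞)`). -/
def snrOfInfo (a : ℝ) : ℝ := sInf {γ : ℝ | 0 ≤ γ ∧ a ≤ biAwgnInfo γ}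

namespace BinaryCode

variable {n : ℕ}

/-- Joint law of the transmitted codeword (uniform on the code) and of the independent
standard Gaussian noise. -/
def law (C : Finset (Fin n → Bool)) : Measure ((Fin n → Bool) × (Fin n → ℝ)) :=
  (uniformOn (C : Set (Fin n → Bool))).prod (Measure.pi fun _ => gaussianReal 0 1)

/-- The `i`-th transmitted bit. -/
def bit (i : Fin n) (ω : (Fin n → Bool) × (Fin n → ℝ)) : Bool := ω.1 i

/-- The `i`-th received value `Yᵢ = √γ Xᵢ + Nᵢ`. -/
def received (γ : ℝ) (i : Fin n) (ω : (Fin n → Bool) × (Fin n → ℝ)) : ℝ :=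
  Real.sqrt γ * bpsk (bit i ω) + ω.2 i

/-- The rate, in bits per channel use. -/
def rate (C : Finset (Fin n → Bool)) : ℝ := Real.logb 2 (C.card : ℝ) / n

/-- Average (over the codewords) block error probability of the decoder `dec` at SNR `γ`. -/
def errorProb (C : Finset (Fin n → Bool)) (γ : ℝ) (dec : (Fin n → ℝ) → (Fin n → Bool)) : ℝ :=
  (law C).real {ω | dec (fun i => received γ i ω) ≠ ω.1}

/-- The σ-algebra generated by all received values except the `i`-th one. -/
@[reducible] def othersSigma (γ : ℝ) (i : Fin n) : MeasurableSpace ((Fin n → Bool) × (Fin n → ℝ)) :=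
  MeasurableSpace.comap (fun ω (j : {j : Fin n // j ≠ i}) => received γ j.1 ω) inferInstance

/-- `P(Xᵢ = b | Yⱼ, j ≠ i)` at SNR `γ`. -/
def extrinsicProb (C : Finset (Fin n → Bool)) (γ : ℝ) (i : Fin n) (b : Bool) :
    (Fin n → Bool) × (Fin n → ℝ) → ℝ :=
  (law C)⟦{ω | bit i ω = b}|othersSigma γ i⟧

/-- The extrinsic log-likelihood ratio
`log (P(Xᵢ = +1 | Yⱼ, j ≠ i) / P(Xᵢ = -1 | Yⱼ, j ≠ i))`, with values in `[-∞,∞]`. -/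
def extrinsicLLR (C : Finset (Fin n → Bool)) (γ : ℝ) (i : Fin n)
    (ω : (Fin n → Bool) × (Fin n → ℝ)) : EReal :=
  ENNReal.log (ENNReal.ofReal (extrinsicProb C γ i true ω) /
    ENNReal.ofReal (extrinsicProb C γ i false ω))

/-- Extrinsic information at a priori SNR `γ`: the average over the bits of `I(Xᵢ; L_ext(Xᵢ))`. -/
def extrinsicInfo (C : Finset (Fin n → Bool)) (γ : ℝ) : ℝ :=
  (∑ i : Fin n, mutualInfoBits (law C) (bit i) (extrinsicLLR C γ i)) / n

/-- The EXIT curve: extrinsic information as a function of the a priori information `a`. -/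
def exitCurve (C : Finset (Fin n → Bool)) (a : ℝ) : ℝ := extrinsicInfo C (snrOfInfo a)

/-- A sequence of binary codes is capacity achieving at `SNR` if its rates tend to `I₂(SNR)` and
it can be decoded with vanishing block error probability at every signal to noise ratio `γ > SNR`
(which is the case when it can be so decoded at `SNR` itself). -/
def CapacityAchieving (SNR : ℝ) (n : ℕ → ℕ) (C : (k : ℕ) → Finset (Fin (n k) → Bool)) : Prop :=
  Tendsto (fun k => rate (C k)) atTop (𝓝 (biAwgnInfo SNR)) ∧
  ∀ γ : ℝ, SNR < γ → ∃ dec : (k : ℕ) → (Fin (n k) → ℝ) → (Fin (n k) → Bool),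
    (∀ k, Measurable (dec k)) ∧
    Tendsto (fun k => errorProb (C k) γ (dec k)) atTop (𝓝 0)

end BinaryCode

end

open scoped BigOperators

/-!
Let `E i` be the conditional mean of the `i`-th symbol given the other received values. Everything
follows from the average of `E[(E i) ^ 2]` over the positions: it tends to `0` below the
threshold, where the extrinsic LLRs therefore vanish, and to `1` above it, where they are
infinite.

Above the threshold: if `|E i|` is not close to `1`, the other outputs leave the `i`-th bit open,
and the `i`-th output alone cannot settle it because its two densities overlap, so every decoder
errs.

Below the threshold: decode at an SNR `γ'` slightly above it, and obtain the outputs at `γ` by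
adding noise to those at `γ'`. Let `h i` be half the difference between the conditional means of
an equiprobable symbol given its output at `γ'` and given its output at `γ`. For an equiprobable
symbol and a fixed output at `γ`, the mean of `h i` is `0`. As `E i` ignores the `i`-th output,
multiplying the product of the equiprobable output laws by `∏ i, (1 + t * E i * h i)` therefore
gives a probability law. Given the symbol, the mean of `h i` is a positive multiple of the symbol;
hence the expected log-likelihood of the output of a random codeword gains a term linear in `t`
and proportional to `∑ i, E[(E i) ^ 2]`, and loses at most `t ^ 2 * ∑ i, E[(E i) ^ 2]`. Gibbs'
inequality for the tilted law and Fano's inequality for the decoder then bound the rate by the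
capacity at `γ'` minus a positive multiple of the average of `E[(E i) ^ 2]`, which must vanish in
the limit because the rate tends to the capacity at the threshold.

The area under the EXIT curve follows by dominated convergence.
-/

theorem integral_comp_of_measurePreserving {α β E : Type*} [MeasurableSpace α] [MeasurableSpace β]
    [NormedAddCommGroup E] [NormedSpace ℝ E] {μ : Measure α} {ν : Measure β} {f : α → β}
    (hf : MeasurePreserving f μ ν) {g : β → E} (hg : AEStronglyMeasurable g ν) :
    ∫ x, g (f x) ∂μ = ∫ y, g y ∂ν := by
  rw [← hf.map_eq, integral_map hf.measurable.aemeasurable (hf.map_eq ▸ hg)]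

section ProductMeasure

variable {ι : Type*} [Fintype ι] {X : ι → Type*} [∀ i, MeasurableSpace (X i)]

theorem measurePreserving_update_pi [DecidableEq ι] (ν : ∀ i, Measure (X i))
    [∀ i, IsProbabilityMeasure (ν i)] (i : ι) :
    MeasurePreserving (fun p : (∀ j, X j) × X i ↦ Function.update p.1 i p.2)
      ((Measure.pi ν).prod (ν i)) (Measure.pi ν) := by
  refine ⟨measurable_update', (Measure.pi_eq fun s hs ↦ ?_).symm⟩
  have preimage_eq : (fun p : (∀ j, X j) × X i ↦ Function.update p.1 i p.2) ⁻¹' Set.univ.pi s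
      = Set.univ.pi (Function.update s i Set.univ) ×ˢ s i := by
    ext p
    simp only [Set.mem_preimage, Set.mem_pi, Set.mem_univ, true_imp_iff, Set.mem_prod]
    rw [Function.forall_update_iff p.1 (p := fun j t ↦ t ∈ s j),
      Function.forall_update_iff s (p := fun j t ↦ p.1 j ∈ t)]
    simp [and_comm]
  rw [Measure.map_apply measurable_update' (MeasurableSet.univ_pi hs), preimage_eq,
    Measure.prod_prod, Measure.pi_pi, ← Finset.prod_erase_mul _ _ (Finset.mem_univ i),
    ← Finset.prod_erase_mul Finset.univ (fun j ↦ ν j (s j)) (Finset.mem_univ i),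
    Function.update_self, measure_univ, mul_one]
  congr 1
  refine Finset.prod_congr rfl fun j hj ↦ ?_
  rw [Function.update_of_ne (Finset.ne_of_mem_erase hj)]

theorem integral_pi_eq_integral_update [DecidableEq ι] (ν : ∀ i, Measure (X i))
    [∀ i, IsProbabilityMeasure (ν i)] (i : ι) {E : Type*} [NormedAddCommGroup E] [NormedSpace ℝ E]
    {F : (∀ j, X j) → E} (hF : Integrable F (Measure.pi ν)) :
    ∫ u, F u ∂Measure.pi ν = ∫ u, ∫ v, F (Function.update u i v) ∂ν i ∂Measure.pi ν := by
  have hp := measurePreserving_update_pi ν i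
  rw [← integral_prod (f := fun p : (∀ j, X j) × X i ↦ F (Function.update p.1 i p.2))
    (hp.integrable_comp_of_integrable hF)]
  exact (integral_comp_of_measurePreserving hp hF.aestronglyMeasurable).symm

theorem integral_pi_mul_eval [DecidableEq ι] (ν : ∀ i, Measure (X i))
    [∀ i, IsProbabilityMeasure (ν i)] (i : ι) {f : (∀ j, X j) → ℝ} {g : X i → ℝ}
    (hf : ∀ u v, f (Function.update u i v) = f u)
    (hfg : Integrable (fun u ↦ f u * g (u i)) (Measure.pi ν)) :
    ∫ u, f u * g (u i) ∂Measure.pi ν = (∫ u, f u ∂Measure.pi ν) * ∫ v, g v ∂ν i := by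
  rw [integral_pi_eq_integral_update ν i hfg]
  simp only [hf, Function.update_self, integral_const_mul, integral_mul_const]

theorem lintegral_pi_prod_eq_prod_lintegral (ν : ∀ i, Measure (X i))
    [∀ i, IsProbabilityMeasure (ν i)] {f : ∀ i, X i → ℝ≥0∞} (hf : ∀ i, Measurable (f i)) :
    ∫⁻ u, ∏ i, f i (u i) ∂Measure.pi ν = ∏ i, ∫⁻ v, f i v ∂ν i := by
  rw [lintegral_prod_eq_prod_lintegral_of_indepFun _ _
    (iIndepFun_pi fun i ↦ (hf i).aemeasurable) fun i ↦ (hf i).comp (measurable_pi_apply i)]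
  exact Finset.prod_congr rfl fun i _ ↦
    (measurePreserving_eval ν i).lintegral_comp (hf i)

theorem pi_withDensity (ν : ∀ i, Measure (X i)) [∀ i, IsProbabilityMeasure (ν i)]
    {f : ∀ i, X i → ℝ≥0∞} (hf : ∀ i, Measurable (f i))
    [∀ i, SigmaFinite ((ν i).withDensity (f i))] :
    Measure.pi (fun i ↦ (ν i).withDensity (f i))
      = (Measure.pi ν).withDensity fun u ↦ ∏ i, f i (u i) := by
  refine Measure.pi_eq fun s hs ↦ ?_
  have indicator_prod : ∀ u : ∀ i, X i,
      (Set.univ.pi s).indicator (fun u ↦ ∏ i, f i (u i)) u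
        = ∏ i, (s i).indicator (f i) (u i) := fun u ↦ by
    classical
    simp only [Set.indicator_apply, Finset.prod_ite_zero, Set.mem_univ_pi, Finset.mem_univ,
      true_imp_iff]
  rw [withDensity_apply _ (MeasurableSet.univ_pi hs),
    ← lintegral_indicator (MeasurableSet.univ_pi hs)]
  simp only [indicator_prod]
  rw [lintegral_pi_prod_eq_prod_lintegral ν fun i ↦ (hf i).indicator (hs i)]
  exact Finset.prod_congr rfl fun i _ ↦ by
    rw [lintegral_indicator (hs i), withDensity_apply _ (hs i)]

end ProductMeasure

section TestFunctions

variable {Ω : Type*} [MeasurableSpace Ω]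

theorem integrable_of_abs_le {μ : Measure Ω} [IsFiniteMeasure μ] {f : Ω → ℝ} (hf : Measurable f)
    {K : ℝ} (hK : ∀ ω, |f ω| ≤ K) : Integrable f μ :=
  .of_bound hf.aestronglyMeasurable K (ae_of_all _ hK)

theorem integral_finsetExpect {α : Type*} {μ : Measure Ω} (s : Finset α) {f : α → Ω → ℝ}
    (hf : ∀ a, Integrable (f a) μ) : ∫ ω, 𝔼 a ∈ s, f a ω ∂μ = 𝔼 a ∈ s, ∫ ω, f a ω ∂μ := by
  simp only [Finset.expect_eq_sum_div_card, integral_div, integral_finsetSum _ fun a _ ↦ hf a]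

theorem integrable_finsetExpect {α : Type*} {μ : Measure Ω} (s : Finset α) {f : α → Ω → ℝ}
    (hf : ∀ a, Integrable (f a) μ) : Integrable (fun ω ↦ 𝔼 a ∈ s, f a ω) μ := by
  simpa only [Finset.expect_eq_sum_div_card]
    using (integrable_finsetSum _ fun a _ ↦ hf a).div_const _

theorem integral_withDensity_ofReal {μ : Measure Ω} {r : Ω → ℝ} (hr : Measurable r)
    (hr0 : ∀ ω, 0 ≤ r ω) (f : Ω → ℝ) :
    ∫ ω, f ω ∂μ.withDensity (fun ω ↦ ENNReal.ofReal (r ω)) = ∫ ω, r ω * f ω ∂μ := by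
  rw [integral_withDensity_eq_integral_toReal_smul hr.ennreal_ofReal
    (ae_of_all _ fun _ ↦ ENNReal.ofReal_lt_top)]
  simp [ENNReal.toReal_ofReal (hr0 _)]

theorem integrable_withDensity_ofReal {μ : Measure Ω} {r : Ω → ℝ} (hr : Measurable r)
    (hr0 : ∀ ω, 0 ≤ r ω) {f : Ω → ℝ} :
    Integrable f (μ.withDensity fun ω ↦ ENNReal.ofReal (r ω))
      ↔ Integrable (fun ω ↦ r ω * f ω) μ := by
  rw [integrable_withDensity_iff hr.ennreal_ofReal (ae_of_all _ fun _ ↦ ENNReal.ofReal_lt_top)]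
  simp [ENNReal.toReal_ofReal (hr0 _), mul_comm]

/- The Donsker–Varadhan variational inequality for `KL(P ‖ Q) = ∫ log r ∂P`, in the form obtained
by integrating `log t ≤ t - 1` at `t = exp g / r`. -/
theorem integral_le_integral_log_density_add {P Q : Measure Ω} [IsProbabilityMeasure P]
    {r : Ω → ℝ} (hr : Measurable r) (hr0 : ∀ ω, 0 < r ω)
    (hP : P = Q.withDensity fun ω ↦ ENNReal.ofReal (r ω))
    (hlog : Integrable (fun ω ↦ Real.log (r ω)) P) {g : Ω → ℝ} (hg : Integrable g P)
    (hexp : Integrable (fun ω ↦ Real.exp (g ω)) Q) :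
    ∫ ω, g ω ∂P ≤ ∫ ω, Real.log (r ω) ∂P + ∫ ω, Real.exp (g ω) ∂Q - 1 := by
  have cancel : ∀ ω, r ω * (Real.exp (g ω) / r ω) = Real.exp (g ω) := fun ω ↦
    mul_div_cancel₀ _ (hr0 ω).ne'
  have ratio_integrable : Integrable (fun ω ↦ Real.exp (g ω) / r ω) P := by
    rw [hP, integrable_withDensity_ofReal hr fun ω ↦ (hr0 ω).le]
    simpa only [cancel] using hexp
  have ratio_integral : ∫ ω, Real.exp (g ω) / r ω ∂P = ∫ ω, Real.exp (g ω) ∂Q := by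
    rw [hP, integral_withDensity_ofReal hr fun ω ↦ (hr0 ω).le]
    simp only [cancel]
  have pointwise : ∀ ω, g ω - Real.log (r ω) ≤ Real.exp (g ω) / r ω - 1 := fun ω ↦ by
    have := Real.log_le_sub_one_of_pos (div_pos (Real.exp_pos (g ω)) (hr0 ω))
    rwa [Real.log_div (Real.exp_pos _).ne' (hr0 ω).ne', Real.log_exp] at this
  have := integral_mono (hg.sub hlog) (ratio_integrable.sub (integrable_const 1)) pointwise
  simp only [Pi.sub_apply] at this
  rw [integral_sub hg hlog, integral_sub ratio_integrable (integrable_const 1), ratio_integral,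
    integral_const, probReal_univ, one_smul] at this
  linarith

end TestFunctions

section Fano

theorem le_binEntropy_of_forall_le {p c : ℝ} (hp : p ∈ Set.Icc 0 1)
    (h : ∀ q ∈ Set.Ioo (0 : ℝ) 1, c ≤ -(p * Real.log q) - (1 - p) * Real.log (1 - q)) :
    c ≤ Real.binEntropy p := by
  have mul_log_tendsto (a : ℝ) : Tendsto (fun q ↦ a * Real.log q) (𝓝 a) (𝓝 (a * Real.log a)) := by
    rcases eq_or_ne a 0 with rfl | ha
    · simpa only [zero_mul] using tendsto_const_nhds
    · exact (Real.continuousAt_log ha).tendsto.const_mul a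
  have reflected_tendsto : Tendsto (fun q ↦ (1 - p) * Real.log (1 - q)) (𝓝 p)
      (𝓝 ((1 - p) * Real.log (1 - p))) :=
    (mul_log_tendsto (1 - p)).comp ((continuous_const.sub continuous_id).tendsto p)
  have crossEntropy_tendsto := ((mul_log_tendsto p).neg.sub reflected_tendsto).mono_left
    (nhdsWithin_le_nhds (s := Set.Ioo 0 1))
  have : (𝓝[Set.Ioo 0 1] p).NeBot :=
    mem_closure_iff_nhdsWithin_neBot.1 (by rwa [closure_Ioo zero_ne_one])
  have entropy_eq : Real.binEntropy p = -(p * Real.log p) - (1 - p) * Real.log (1 - p) := by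
    rw [Real.binEntropy, Real.log_inv, Real.log_inv]; ring
  rw [entropy_eq]
  exact ge_of_tendsto crossEntropy_tendsto (eventually_mem_nhdsWithin.mono h)

variable {Ω α : Type*}

open Classical in
/-- The log-likelihood, relative to the uniform law on `C`, of the soft decision that gives weight
`1 - q` to the decoded word and spreads the rest evenly over `C`. -/
noncomputable def logSoftDecision (C : Finset α) (dec : Ω → α) (q : ℝ) (x : α) (ω : Ω) : ℝ :=
  if dec ω = x then Real.log (1 - q) + Real.log C.card else Real.log q

variable {C : Finset α} {q : ℝ}

theorem expect_exp_logSoftDecision_le_one (hC : C.Nonempty) (hq : q ∈ Set.Ioo 0 1) (dec : Ω → α)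
    (ω : Ω) : 𝔼 x ∈ C, Real.exp (logSoftDecision C dec q x ω) ≤ 1 := by
  classical
  have card_ge : (1 : ℝ) ≤ C.card := by exact_mod_cast hC.card_pos
  have card_pos : (0 : ℝ) < C.card := one_pos.trans_le card_ge
  have weight_le : ∀ x, Real.exp (logSoftDecision C dec q x ω)
      ≤ (if dec ω = x then (1 - q) * C.card else 0 : ℝ) + q := fun x ↦ by
    by_cases hx : dec ω = x
    · simp [logSoftDecision, hx, Real.exp_add, Real.exp_log (sub_pos.2 hq.2),
        Real.exp_log card_pos, hq.1.le]
    · simp [logSoftDecision, hx, Real.exp_log hq.1]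
  rw [Finset.expect_eq_sum_div_card, div_le_one card_pos]
  calc ∑ x ∈ C, Real.exp (logSoftDecision C dec q x ω)
      ≤ ∑ x ∈ C, ((if dec ω = x then (1 - q) * C.card else 0 : ℝ) + q) :=
        Finset.sum_le_sum fun x _ ↦ weight_le x
    _ = (if dec ω ∈ C then (1 - q) * C.card else 0 : ℝ) + C.card * q := by
        rw [Finset.sum_add_distrib, Finset.sum_ite_eq, Finset.sum_const, nsmul_eq_mul]
    _ ≤ C.card := by split_ifs <;> nlinarith [hq.2]

theorem abs_logSoftDecision_le (C : Finset α) (dec : Ω → α) (q : ℝ) (x : α) (ω : Ω) :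
    |logSoftDecision C dec q x ω| ≤ |Real.log (1 - q) + Real.log C.card| + |Real.log q| := by
  rw [logSoftDecision]
  split_ifs
  · exact le_add_of_nonneg_right (abs_nonneg _)
  · exact le_add_of_nonneg_left (abs_nonneg _)

variable [MeasurableSpace Ω] [MeasurableSpace α] [MeasurableSingletonClass α] {dec : Ω → α}

theorem measurable_logSoftDecision (hdec : Measurable dec) (x : α) :
    Measurable (logSoftDecision C dec q x) :=
  Measurable.ite (hdec (measurableSet_singleton x)) measurable_const measurable_const

theorem integral_logSoftDecision (hdec : Measurable dec) (P : Measure Ω) [IsProbabilityMeasure P]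
    (x : α) : ∫ ω, logSoftDecision C dec q x ω ∂P
      = (1 - P.real {ω | dec ω ≠ x}) * (Real.log (1 - q) + Real.log C.card)
        + P.real {ω | dec ω ≠ x} * Real.log q := by
  have hS : MeasurableSet {ω | dec ω ≠ x} := hdec (measurableSet_singleton x).compl
  have soft_eq : logSoftDecision C dec q x = fun ω ↦ (Real.log (1 - q) + Real.log C.card)
      + {ω | dec ω ≠ x}.indicator
          (fun _ ↦ Real.log q - (Real.log (1 - q) + Real.log C.card)) ω := by
    funext ω
    by_cases hx : dec ω = x <;> simp [logSoftDecision, hx]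
  rw [soft_eq, integral_add (integrable_const _) ((integrable_const _).indicator hS),
    integral_indicator_const _ hS, integral_const, probReal_univ, one_smul, smul_eq_mul]
  ring

theorem integrable_exp_add_logSoftDecision (hdec : Measurable dec) {Q : Measure Ω} {g : Ω → ℝ}
    (hexp : Integrable (fun ω ↦ Real.exp (g ω)) Q) (x : α) :
    Integrable (fun ω ↦ Real.exp (g ω + logSoftDecision C dec q x ω)) Q := by
  simp only [Real.exp_add]
  refine hexp.mul_bdd (c := Real.exp (|Real.log (1 - q) + Real.log C.card| + |Real.log q|))
    (measurable_logSoftDecision hdec x).exp.aestronglyMeasurable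
    (ae_of_all _ fun ω ↦ ?_)
  rw [Real.norm_eq_abs, Real.abs_exp]
  exact Real.exp_le_exp.2 ((le_abs_self _).trans (abs_logSoftDecision_le C dec q x ω))

theorem expect_integral_exp_add_logSoftDecision_le (hC : C.Nonempty) (hq : q ∈ Set.Ioo 0 1)
    (hdec : Measurable dec) {Q : Measure Ω} {g : Ω → ℝ}
    (hexp : Integrable (fun ω ↦ Real.exp (g ω)) Q) :
    𝔼 x ∈ C, ∫ ω, Real.exp (g ω + logSoftDecision C dec q x ω) ∂Q ≤ ∫ ω, Real.exp (g ω) ∂Q := by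
  have hint := integrable_exp_add_logSoftDecision (C := C) (q := q) hdec hexp
  rw [← integral_finsetExpect _ hint]
  refine integral_mono (integrable_finsetExpect _ hint) hexp fun ω ↦ ?_
  simp only [Real.exp_add, ← Finset.mul_expect]
  exact mul_le_of_le_one_right (Real.exp_pos _).le (expect_exp_logSoftDecision_le_one hC hq dec ω)

/- Fano's inequality, sharpened by a test function `g`: apply the Donsker–Varadhan inequality for
each codeword to `g` plus the log-likelihood of the soft decision whose doubt `q` tends to the
error probability. -/
theorem expect_integral_add_log_card_le (hC : C.Nonempty) (hdec : Measurable dec) {Q : Measure Ω}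
    {P : α → Measure Ω} [∀ x, IsProbabilityMeasure (P x)] {R : α → Ω → ℝ}
    (hR : ∀ x, Measurable (R x)) (hR0 : ∀ x ω, 0 < R x ω)
    (hP : ∀ x, P x = Q.withDensity fun ω ↦ ENNReal.ofReal (R x ω))
    (hlog : ∀ x, Integrable (fun ω ↦ Real.log (R x ω)) (P x)) {g : Ω → ℝ}
    (hg : ∀ x, Integrable g (P x)) (hexp : Integrable (fun ω ↦ Real.exp (g ω)) Q)
    (hexp1 : ∫ ω, Real.exp (g ω) ∂Q ≤ 1) {err : ℝ}
    (herr : 𝔼 x ∈ C, (P x).real {ω | dec ω ≠ x} = err) :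
    𝔼 x ∈ C, ∫ ω, g ω ∂P x + Real.log C.card
      ≤ 𝔼 x ∈ C, ∫ ω, Real.log (R x ω) ∂P x + Real.binEntropy err + err * Real.log C.card := by
  have err_mem : err ∈ Set.Icc 0 1 := herr ▸
    ⟨Finset.expect_nonneg fun _ _ ↦ measureReal_nonneg,
      Finset.expect_le hC fun _ _ ↦ measureReal_le_one⟩
  suffices 𝔼 x ∈ C, ∫ ω, g ω ∂P x + Real.log C.card
      - 𝔼 x ∈ C, ∫ ω, Real.log (R x ω) ∂P x - err * Real.log C.card ≤ Real.binEntropy err by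
    linarith
  refine le_binEntropy_of_forall_le err_mem fun q hq ↦ ?_
  have soft_integrable : ∀ x, Integrable (logSoftDecision C dec q x) (P x) := fun x ↦
    integrable_of_abs_le (measurable_logSoftDecision hdec x) (abs_logSoftDecision_le C dec q x)
  have per_word : ∀ x, ∫ ω, g ω ∂P x
        + ((1 - (P x).real {ω | dec ω ≠ x}) * (Real.log (1 - q) + Real.log C.card)
          + (P x).real {ω | dec ω ≠ x} * Real.log q)
      ≤ ∫ ω, Real.log (R x ω) ∂P x
        + ∫ ω, Real.exp (g ω + logSoftDecision C dec q x ω) ∂Q - 1 := fun x ↦ by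
    rw [← integral_logSoftDecision hdec (P x) x, ← integral_add (hg x) (soft_integrable x)]
    exact integral_le_integral_log_density_add (hR x) (hR0 x) (hP x) (hlog x)
      ((hg x).add (soft_integrable x)) (integrable_exp_add_logSoftDecision hdec hexp x)
  have average := Finset.expect_le_expect fun x (_ : x ∈ C) ↦ per_word x
  simp only [Finset.expect_add_distrib, Finset.expect_sub_distrib, Finset.expect_const hC,
    sub_mul, one_mul, ← Finset.expect_mul, herr] at average
  linarith [expect_integral_exp_add_logSoftDecision_le hC hq hdec hexp]

end Fano

/-- A memoryless channel with equivalent output laws for its two inputs, given by their densities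
with respect to their equal mixture `mix`. -/
structure BinaryInputChannel (U : Type*) [MeasurableSpace U] where
  law : Bool → Measure U
  mix : Measure U
  density : Bool → U → ℝ
  isProbabilityMeasure_law : ∀ b, IsProbabilityMeasure (law b)
  isProbabilityMeasure_mix : IsProbabilityMeasure mix
  measurable_density : ∀ b, Measurable (density b)
  density_pos : ∀ b u, 0 < density b u
  density_true_add_density_false : ∀ u, density true u + density false u = 2
  law_eq : ∀ b, law b = mix.withDensity fun u ↦ ENNReal.ofReal (density b u)

attribute [instance] BinaryInputChannel.isProbabilityMeasure_law
  BinaryInputChannel.isProbabilityMeasure_mix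

namespace BinaryInputChannel

variable {U : Type*} [MeasurableSpace U] (W : BinaryInputChannel U)

/-- The conditional mean of an equiprobable channel symbol `±1` given the channel output. -/
noncomputable def posteriorMean (u : U) : ℝ := W.density true u - 1

theorem density_eq (b : Bool) (u : U) : W.density b u = 1 + bpsk b * W.posteriorMean u := by
  have := W.density_true_add_density_false u
  cases b <;> simp only [bpsk, posteriorMean, if_true, Bool.false_eq_true, if_false] <;> linarith

theorem measurable_posteriorMean : Measurable W.posteriorMean :=
  (W.measurable_density true).sub_const 1

theorem density_le_two (b : Bool) (u : U) : W.density b u ≤ 2 := by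
  have := W.density_true_add_density_false u
  cases b <;> linarith [W.density_pos true u, W.density_pos false u]

theorem abs_posteriorMean_le_one (u : U) : |W.posteriorMean u| ≤ 1 := by
  rw [posteriorMean, abs_le]
  constructor <;> linarith [W.density_pos true u, W.density_le_two true u]

theorem integral_law (b : Bool) (f : U → ℝ) :
    ∫ u, f u ∂W.law b = ∫ u, W.density b u * f u ∂W.mix := by
  rw [W.law_eq, integral_withDensity_ofReal (W.measurable_density b) fun u ↦ (W.density_pos b u).le]

theorem integral_density (b : Bool) : ∫ u, W.density b u ∂W.mix = 1 := by
  simpa using (W.integral_law b fun _ ↦ 1).symm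

theorem integral_law_eq (b : Bool) {f : U → ℝ} (hf : Integrable f W.mix) :
    ∫ u, f u ∂W.law b = ∫ u, f u ∂W.mix + bpsk b * ∫ u, W.posteriorMean u * f u ∂W.mix := by
  have mean_mul_integrable : Integrable (fun u ↦ W.posteriorMean u * f u) W.mix :=
    hf.bdd_mul W.measurable_posteriorMean.aestronglyMeasurable
      (ae_of_all _ W.abs_posteriorMean_le_one)
  simp only [integral_law, density_eq, add_mul, one_mul, mul_assoc]
  rw [integral_add hf (mean_mul_integrable.const_mul _), integral_const_mul]

theorem integral_law_true_add_integral_law_false {f : U → ℝ} (hf : Integrable f W.mix) :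
    ∫ u, f u ∂W.law true + ∫ u, f u ∂W.law false = 2 * ∫ u, f u ∂W.mix := by
  rw [W.integral_law_eq true hf, W.integral_law_eq false hf]
  simp only [bpsk, if_true, Bool.false_eq_true, if_false]
  ring

theorem integral_law_true_sub_integral_law_false {f : U → ℝ} (hf : Integrable f W.mix) :
    ∫ u, f u ∂W.law true - ∫ u, f u ∂W.law false
      = 2 * ∫ u, W.posteriorMean u * f u ∂W.mix := by
  rw [W.integral_law_eq true hf, W.integral_law_eq false hf]
  simp only [bpsk, if_true, Bool.false_eq_true, if_false]
  ring

/-- The mutual information, in nats, of an equiprobable channel symbol and the channel output. -/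
noncomputable def symmetricInfo : ℝ :=
  Real.log 2 - ∫ u, Real.binEntropy (W.density true u / 2) ∂W.mix

theorem abs_mul_log_le_two {x : ℝ} (h0 : 0 < x) (h2 : x ≤ 2) : |x * Real.log x| ≤ 2 := by
  have lower := mul_le_mul_of_nonneg_left (Real.one_sub_inv_le_log_of_pos h0) h0.le
  have upper := mul_le_mul_of_nonneg_left (Real.log_le_sub_one_of_pos h0) h0.le
  rw [mul_sub, mul_one, mul_inv_cancel₀ h0.ne'] at lower
  rw [abs_le]
  constructor <;> nlinarith

theorem integrable_density_mul_log_density (b : Bool) :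
    Integrable (fun u ↦ W.density b u * Real.log (W.density b u)) W.mix :=
  integrable_of_abs_le ((W.measurable_density b).mul (W.measurable_density b).log)
    fun u ↦ abs_mul_log_le_two (W.density_pos b u) (W.density_le_two b u)

theorem integrable_log_density (b : Bool) :
    Integrable (fun u ↦ Real.log (W.density b u)) (W.law b) := by
  rw [W.law_eq, integrable_withDensity_ofReal (W.measurable_density b)
    fun u ↦ (W.density_pos b u).le]
  exact W.integrable_density_mul_log_density b

theorem density_mul_log_density_add (u : U) :
    W.density true u * Real.log (W.density true u)
        + W.density false u * Real.log (W.density false u)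
      = 2 * (Real.log 2 - Real.binEntropy (W.density true u / 2)) := by
  have complement : 1 - W.density true u / 2 = W.density false u / 2 := by
    linarith [W.density_true_add_density_false u]
  rw [Real.binEntropy, complement, Real.log_inv, Real.log_inv,
    Real.log_div (W.density_pos true u).ne' two_ne_zero,
    Real.log_div (W.density_pos false u).ne' two_ne_zero]
  linear_combination Real.log 2 * W.density_true_add_density_false u

theorem integrable_binEntropy_density :
    Integrable (fun u ↦ Real.binEntropy (W.density true u / 2)) W.mix :=
  integrable_of_abs_le (Real.binEntropy_continuous.measurable.comp
    ((W.measurable_density true).div_const 2)) fun u ↦ by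
    rw [abs_of_nonneg (Real.binEntropy_nonneg (by linarith [W.density_pos true u])
      (by linarith [W.density_le_two true u]))]
    exact Real.binEntropy_le_log_two

theorem integral_log_density_true_add_integral_log_density_false :
    ∫ u, Real.log (W.density true u) ∂W.law true + ∫ u, Real.log (W.density false u) ∂W.law false
      = 2 * W.symmetricInfo := by
  rw [W.integral_law, W.integral_law, ← integral_add (W.integrable_density_mul_log_density true)
    (W.integrable_density_mul_log_density false)]
  simp only [density_mul_log_density_add]
  rw [integral_const_mul, integral_sub (integrable_const _) W.integrable_binEntropy_density,
    symmetricInfo, integral_const, probReal_univ, one_smul]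

/-- The channel with the further output `ν`, independent of the input and of the first output. -/
noncomputable def withNoise {Z : Type*} [MeasurableSpace Z] (ν : Measure Z)
    [IsProbabilityMeasure ν] : BinaryInputChannel (U × Z) where
  law b := (W.law b).prod ν
  mix := W.mix.prod ν
  density b u := W.density b u.1
  isProbabilityMeasure_law _ := inferInstance
  isProbabilityMeasure_mix := inferInstance
  measurable_density b := (W.measurable_density b).comp measurable_fst
  density_pos b u := W.density_pos b u.1
  density_true_add_density_false u := W.density_true_add_density_false u.1
  law_eq b := by
    rw [W.law_eq, prod_withDensity_left (W.measurable_density b).ennreal_ofReal]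

section Words

variable {ι : Type*} [Fintype ι]

/-- The law of the outputs of independent uses of the channel with input `x`. -/
noncomputable def wordLaw (x : ι → Bool) : Measure (ι → U) := Measure.pi fun i ↦ W.law (x i)

instance (x : ι → Bool) : IsProbabilityMeasure (W.wordLaw x) := by
  unfold wordLaw
  infer_instance

/-- The density of `W.wordLaw x` with respect to the product of the measures `W.mix`. -/
noncomputable def wordDensity (x : ι → Bool) (u : ι → U) : ℝ := ∏ i, W.density (x i) (u i)

theorem measurable_wordDensity (x : ι → Bool) : Measurable (W.wordDensity x) :=
  Finset.measurable_prod _ fun i _ ↦ (W.measurable_density (x i)).comp (measurable_pi_apply i)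

theorem wordDensity_pos (x : ι → Bool) (u : ι → U) : 0 < W.wordDensity x u :=
  Finset.prod_pos fun i _ ↦ W.density_pos (x i) (u i)

theorem wordLaw_eq_withDensity (x : ι → Bool) :
    W.wordLaw x = (Measure.pi fun _ ↦ W.mix).withDensity
      fun u ↦ ENNReal.ofReal (W.wordDensity x u) := by
  have (i : ι) :
      IsProbabilityMeasure (W.mix.withDensity fun u ↦ ENNReal.ofReal (W.density (x i) u)) :=
    W.law_eq (x i) ▸ W.isProbabilityMeasure_law (x i)
  simp only [wordLaw, law_eq, wordDensity]
  rw [pi_withDensity _ fun i ↦ (W.measurable_density (x i)).ennreal_ofReal]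
  simp only [ENNReal.ofReal_prod_of_nonneg fun i _ ↦ (W.density_pos (x i) _).le]

theorem integral_wordLaw (x : ι → Bool) (f : (ι → U) → ℝ) :
    ∫ u, f u ∂W.wordLaw x = ∫ u, W.wordDensity x u * f u ∂Measure.pi fun _ ↦ W.mix := by
  rw [wordLaw_eq_withDensity, integral_withDensity_ofReal (W.measurable_wordDensity x)
    fun u ↦ (W.wordDensity_pos x u).le]

theorem integrable_wordLaw {x : ι → Bool} {f : (ι → U) → ℝ} :
    Integrable f (W.wordLaw x)
      ↔ Integrable (fun u ↦ W.wordDensity x u * f u) (Measure.pi fun _ ↦ W.mix) := by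
  rw [wordLaw_eq_withDensity, integrable_withDensity_ofReal (W.measurable_wordDensity x)
    fun u ↦ (W.wordDensity_pos x u).le]

theorem log_wordDensity (x : ι → Bool) (u : ι → U) :
    Real.log (W.wordDensity x u) = ∑ i, Real.log (W.density (x i) (u i)) :=
  Real.log_prod fun i _ ↦ (W.density_pos (x i) (u i)).ne'

variable {W} in
theorem integrable_wordLaw_eval {x : ι → Bool} {i : ι} {f : U → ℝ}
    (hf : Integrable f (W.law (x i))) : Integrable (fun u : ι → U ↦ f (u i)) (W.wordLaw x) :=
  (measurePreserving_eval (fun i ↦ W.law (x i)) i).integrable_comp_of_integrable hf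

variable {W} in
theorem integral_wordLaw_eval {x : ι → Bool} {i : ι} {f : U → ℝ}
    (hf : Integrable f (W.law (x i))) :
    ∫ u, f (u i) ∂W.wordLaw x = ∫ v, f v ∂W.law (x i) :=
  integral_comp_eval (μ := fun i ↦ W.law (x i)) hf.aestronglyMeasurable

theorem integrable_log_wordDensity (x : ι → Bool) :
    Integrable (fun u ↦ Real.log (W.wordDensity x u)) (W.wordLaw x) := by
  simp only [log_wordDensity]
  exact integrable_finsetSum _ fun i _ ↦ integrable_wordLaw_eval (W.integrable_log_density (x i))

variable {W} in
theorem integral_log_wordDensity {J : ℝ} (hJ : ∀ b, ∫ u, Real.log (W.density b u) ∂W.law b = J)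
    (x : ι → Bool) :
    ∫ u, Real.log (W.wordDensity x u) ∂W.wordLaw x = Fintype.card ι * J := by
  simp only [log_wordDensity]
  rw [integral_finsetSum _ fun i _ ↦ integrable_wordLaw_eval (W.integrable_log_density (x i))]
  simp only [fun i ↦ integral_wordLaw_eval (W.integrable_log_density (x i)), hJ, Finset.sum_const,
    Finset.card_univ, nsmul_eq_mul]

end Words

end BinaryInputChannel

theorem abs_bpsk (b : Bool) : |bpsk b| = 1 := by
  cases b <;> norm_num [bpsk]

namespace BinaryInputChannel

section Extrinsic

variable {U : Type*} [MeasurableSpace U] (W : BinaryInputChannel U) {ι : Type*} [Fintype ι]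
  [DecidableEq ι] (C : Finset (ι → Bool)) (i : ι)

/-- The density of the outputs other than the `i`-th one, for the input `x`. -/
noncomputable def extrinsicDensity (x : ι → Bool) (u : ι → U) : ℝ :=
  ∏ j ∈ Finset.univ.erase i, W.density (x j) (u j)

/-- The conditional mean of the `i`-th symbol of a uniform codeword, given the outputs other than
the `i`-th one. -/
noncomputable def extrinsicMean (u : ι → U) : ℝ :=
  (∑ x ∈ C, bpsk (x i) * W.extrinsicDensity i x u) / ∑ x ∈ C, W.extrinsicDensity i x u

theorem extrinsicDensity_pos (x : ι → Bool) (u : ι → U) : 0 < W.extrinsicDensity i x u :=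
  Finset.prod_pos fun j _ ↦ W.density_pos (x j) (u j)

theorem extrinsicDensity_le (x : ι → Bool) (u : ι → U) :
    W.extrinsicDensity i x u ≤ 2 ^ (Finset.univ.erase i).card :=
  (Finset.prod_le_prod (fun j _ ↦ (W.density_pos (x j) (u j)).le)
    fun j _ ↦ W.density_le_two (x j) (u j)).trans_eq (Finset.prod_const 2)

theorem abs_extrinsicDensity_le (x : ι → Bool) (u : ι → U) :
    |W.extrinsicDensity i x u| ≤ 2 ^ (Finset.univ.erase i).card :=
  (abs_of_pos (W.extrinsicDensity_pos i x u)).trans_le (W.extrinsicDensity_le i x u)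

theorem measurable_extrinsicDensity (x : ι → Bool) : Measurable (W.extrinsicDensity i x) :=
  Finset.measurable_prod _ fun j _ ↦ (W.measurable_density (x j)).comp (measurable_pi_apply j)

theorem extrinsicDensity_update (x : ι → Bool) (u : ι → U) (v : U) :
    W.extrinsicDensity i x (Function.update u i v) = W.extrinsicDensity i x u :=
  Finset.prod_congr rfl fun j hj ↦ by rw [Function.update_of_ne (Finset.ne_of_mem_erase hj)]

theorem extrinsicDensity_mul_density (x : ι → Bool) (u : ι → U) :
    W.extrinsicDensity i x u * W.density (x i) (u i) = W.wordDensity x u :=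
  Finset.prod_erase_mul _ _ (Finset.mem_univ i)

theorem measurable_extrinsicMean : Measurable (W.extrinsicMean C i) :=
  (Finset.measurable_sum _ fun x _ ↦ (W.measurable_extrinsicDensity i x).const_mul _).div
    (Finset.measurable_sum _ fun x _ ↦ W.measurable_extrinsicDensity i x)

theorem extrinsicMean_update (u : ι → U) (v : U) :
    W.extrinsicMean C i (Function.update u i v) = W.extrinsicMean C i u := by
  simp only [extrinsicMean, extrinsicDensity_update]

theorem sum_extrinsicDensity_nonneg (u : ι → U) : 0 ≤ ∑ x ∈ C, W.extrinsicDensity i x u :=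
  Finset.sum_nonneg fun x _ ↦ (W.extrinsicDensity_pos i x u).le

theorem abs_extrinsicMean_le_one (u : ι → U) : |W.extrinsicMean C i u| ≤ 1 := by
  rw [extrinsicMean, abs_div, abs_of_nonneg (W.sum_extrinsicDensity_nonneg C i u)]
  refine div_le_one_of_le₀ ((Finset.abs_sum_le_sum_abs _ _).trans_eq ?_)
    (W.sum_extrinsicDensity_nonneg C i u)
  exact Finset.sum_congr rfl fun x _ ↦ by
    rw [abs_mul, abs_bpsk, one_mul, abs_of_pos (W.extrinsicDensity_pos i x u)]

theorem extrinsicMean_sq_le_one (u : ι → U) : W.extrinsicMean C i u ^ 2 ≤ 1 :=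
  (sq_le_one_iff_abs_le_one _).2 (W.abs_extrinsicMean_le_one C i u)

theorem extrinsicMean_mul_expect_extrinsicDensity (u : ι → U) :
    W.extrinsicMean C i u * 𝔼 x ∈ C, W.extrinsicDensity i x u
      = 𝔼 x ∈ C, bpsk (x i) * W.extrinsicDensity i x u := by
  rcases C.eq_empty_or_nonempty with rfl | hC
  · simp
  · rw [Finset.expect_eq_sum_div_card, Finset.expect_eq_sum_div_card, extrinsicMean,
      ← mul_div_assoc, div_mul_cancel₀ _
        (Finset.sum_pos (fun x _ ↦ W.extrinsicDensity_pos i x u) hC).ne']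

theorem integrable_extrinsicMean_sq (μ : Measure (ι → U)) [IsFiniteMeasure μ] :
    Integrable (fun u ↦ W.extrinsicMean C i u ^ 2) μ :=
  integrable_of_abs_le (K := 1) ((W.measurable_extrinsicMean C i).pow_const 2) fun u ↦
    (abs_of_nonneg (sq_nonneg _)).trans_le (W.extrinsicMean_sq_le_one C i u)

variable {i} {f : (ι → U) → ℝ} {K : ℝ}

theorem integrable_extrinsicDensity_mul (hf : Measurable f) (hK : ∀ u, |f u| ≤ K)
    (x : ι → Bool) :
    Integrable (fun u ↦ W.extrinsicDensity i x u * f u) (Measure.pi fun _ ↦ W.mix) :=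
  (integrable_of_abs_le hf hK).bdd_mul (W.measurable_extrinsicDensity i x).aestronglyMeasurable
    (ae_of_all _ (W.abs_extrinsicDensity_le i x))

theorem integral_wordLaw_eq_integral_extrinsicDensity_mul (hf : Measurable f)
    (hK : ∀ u, |f u| ≤ K) (hfi : ∀ u v, f (Function.update u i v) = f u) (x : ι → Bool) :
    ∫ u, f u ∂W.wordLaw x
      = ∫ u, W.extrinsicDensity i x u * f u ∂Measure.pi fun _ ↦ W.mix := by
  have density_bound : ∀ v, ‖W.density (x i) v‖ ≤ 2 := fun v ↦ by
    rw [Real.norm_of_nonneg (W.density_pos _ v).le]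
    exact W.density_le_two _ v
  have density_measurable : Measurable fun u : ι → U ↦ W.density (x i) (u i) :=
    (W.measurable_density (x i)).comp (measurable_pi_apply i)
  have split : ∀ u, W.wordDensity x u * f u
      = W.extrinsicDensity i x u * f u * W.density (x i) (u i) := fun u ↦ by
    rw [← W.extrinsicDensity_mul_density i x u]
    ring
  simp only [integral_wordLaw, split]
  rw [integral_pi_mul_eval (fun _ ↦ W.mix) i (fun u v ↦ by rw [extrinsicDensity_update, hfi])
    ((W.integrable_extrinsicDensity_mul hf hK x).mul_bdd density_measurable.aestronglyMeasurable
      (ae_of_all _ fun u ↦ density_bound (u i))), W.integral_density, mul_one]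

theorem expect_integral_wordLaw (hf : Measurable f) (hK : ∀ u, |f u| ≤ K)
    (hfi : ∀ u v, f (Function.update u i v) = f u) :
    𝔼 x ∈ C, ∫ u, f u ∂W.wordLaw x
      = ∫ u, f u * 𝔼 x ∈ C, W.extrinsicDensity i x u ∂Measure.pi fun _ ↦ W.mix := by
  simp only [W.integral_wordLaw_eq_integral_extrinsicDensity_mul hf hK hfi]
  rw [← integral_finsetExpect _ fun x ↦ W.integrable_extrinsicDensity_mul hf hK x]
  simp only [Finset.mul_expect, mul_comm]

theorem integrable_mul_expect_extrinsicDensity_mul_eval (hf : Measurable f)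
    (hK : ∀ u, |f u| ≤ K) {g : U → ℝ} (hg : Measurable g) {L : ℝ} (hL : ∀ v, |g v| ≤ L) :
    Integrable (fun u ↦ f u * (𝔼 x ∈ C, W.extrinsicDensity i x u) * g (u i))
      (Measure.pi fun _ ↦ W.mix) := by
  refine Integrable.mul_bdd (c := L) ?_ (hg.comp (measurable_pi_apply i)).aestronglyMeasurable
    (ae_of_all _ fun u ↦ hL (u i))
  simp only [Finset.mul_expect]
  exact integrable_finsetExpect _ fun x ↦ by
    simpa only [mul_comm] using W.integrable_extrinsicDensity_mul hf hK x

theorem expect_integral_wordLaw_mul_integral_mix (hf : Measurable f) (hK : ∀ u, |f u| ≤ K)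
    (hfi : ∀ u v, f (Function.update u i v) = f u) {g : U → ℝ} (hg : Measurable g) {L : ℝ}
    (hL : ∀ v, |g v| ≤ L) :
    (𝔼 x ∈ C, ∫ u, f u ∂W.wordLaw x) * ∫ v, g v ∂W.mix
      = ∫ u, f u * (𝔼 x ∈ C, W.extrinsicDensity i x u) * g (u i) ∂Measure.pi fun _ ↦ W.mix := by
  rw [W.expect_integral_wordLaw C hf hK hfi, integral_pi_mul_eval (fun _ ↦ W.mix) i
    (fun u v ↦ by simp only [hfi, extrinsicDensity_update])
    (W.integrable_mul_expect_extrinsicDensity_mul_eval C hf hK hg hL)]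

theorem expect_bpsk_mul_integral_wordLaw (hf : Measurable f) (hK : ∀ u, |f u| ≤ K)
    (hfi : ∀ u v, f (Function.update u i v) = f u) :
    𝔼 x ∈ C, bpsk (x i) * ∫ u, f u ∂W.wordLaw x
      = 𝔼 x ∈ C, ∫ u, W.extrinsicMean C i u * f u ∂W.wordLaw x := by
  have mean_mul_bound : ∀ u, |W.extrinsicMean C i u * f u| ≤ K := fun u ↦ by
    rw [abs_mul]
    exact (mul_le_of_le_one_left (abs_nonneg _) (W.abs_extrinsicMean_le_one C i u)).trans (hK u)
  rw [W.expect_integral_wordLaw C (f := fun u ↦ W.extrinsicMean C i u * f u)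
    ((W.measurable_extrinsicMean C i).mul hf) mean_mul_bound
    fun u v ↦ by rw [extrinsicMean_update, hfi]]
  simp only [W.integral_wordLaw_eq_integral_extrinsicDensity_mul hf hK hfi, ← integral_const_mul]
  rw [← integral_finsetExpect _ fun x ↦ (W.integrable_extrinsicDensity_mul hf hK x).const_mul _]
  congr 1 with u
  rw [mul_right_comm, extrinsicMean_mul_expect_extrinsicDensity, Finset.expect_mul]
  simp only [mul_assoc]

theorem expect_bpsk_mul_integral_extrinsicMean (i : ι) :
    𝔼 x ∈ C, bpsk (x i) * ∫ u, W.extrinsicMean C i u ∂W.wordLaw x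
      = 𝔼 x ∈ C, ∫ u, W.extrinsicMean C i u ^ 2 ∂W.wordLaw x := by
  simpa only [sq] using W.expect_bpsk_mul_integral_wordLaw C (W.measurable_extrinsicMean C i)
    (W.abs_extrinsicMean_le_one C i) (W.extrinsicMean_update C i)

end Extrinsic

section Overlap

variable {U : Type*} [MeasurableSpace U] (W : BinaryInputChannel U)

/-- The common mass of the two output laws: twice the error probability of the best decision on a
single use of the channel. -/
noncomputable def overlap : ℝ := ∫ u, min (W.density true u) (W.density false u) ∂W.mix

theorem min_density_pos (u : U) : 0 < min (W.density true u) (W.density false u) :=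
  lt_min (W.density_pos true u) (W.density_pos false u)

theorem min_density_le (b : Bool) (u : U) :
    min (W.density true u) (W.density false u) ≤ W.density b u := by
  cases b
  exacts [min_le_right _ _, min_le_left _ _]

theorem measurable_min_density :
    Measurable fun u ↦ min (W.density true u) (W.density false u) :=
  (W.measurable_density true).min (W.measurable_density false)

theorem abs_min_density_le_two (u : U) : |min (W.density true u) (W.density false u)| ≤ 2 :=
  (abs_of_pos (W.min_density_pos u)).trans_le
    ((W.min_density_le true u).trans (W.density_le_two true u))

theorem overlap_pos : 0 < W.overlap := by
  have support_eq : Function.support (fun u ↦ min (W.density true u) (W.density false u))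
      = Set.univ := Set.eq_univ_of_forall fun u ↦ (W.min_density_pos u).ne'
  rw [overlap, integral_pos_iff_support_of_nonneg (fun u ↦ (W.min_density_pos u).le)
    (integrable_of_abs_le W.measurable_min_density W.abs_min_density_le_two), support_eq,
    measure_univ]
  exact one_pos

variable {ι : Type*} [Fintype ι] [DecidableEq ι] (C : Finset (ι → Bool)) (i : ι)

/- A wrong decision `b` on bit `i` has extrinsic likelihood `(1 - bpsk b * E) / 2`, where `E` is the
extrinsic mean, and `1 - |E| ≥ (1 - E ^ 2) / 2`. -/
theorem one_sub_extrinsicMean_sq_mul_le (b : Bool) (u : ι → U) :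
    (1 - W.extrinsicMean C i u ^ 2) / 4 * 𝔼 x ∈ C, W.extrinsicDensity i x u
      ≤ 𝔼 x ∈ C, if x i = b then 0 else W.extrinsicDensity i x u := by
  have wrong_eq : ∀ x : ι → Bool, (if x i = b then 0 else W.extrinsicDensity i x u)
      = (W.extrinsicDensity i x u - bpsk b * (bpsk (x i) * W.extrinsicDensity i x u)) / 2 :=
    fun x ↦ by cases x i <;> cases b <;> simp [bpsk]
  have average_nonneg : 0 ≤ 𝔼 x ∈ C, W.extrinsicDensity i x u :=
    Finset.expect_nonneg fun x _ ↦ (W.extrinsicDensity_pos i x u).le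
  have mean_bounds := abs_le.1 (W.abs_extrinsicMean_le_one C i u)
  have : (1 - W.extrinsicMean C i u ^ 2) / 4 ≤ (1 - bpsk b * W.extrinsicMean C i u) / 2 := by
    cases b <;> simp only [bpsk, if_true, Bool.false_eq_true, if_false] <;>
      nlinarith [mean_bounds.1, mean_bounds.2]
  simp only [wrong_eq, ← Finset.expect_div, Finset.expect_sub_distrib, ← Finset.mul_expect,
    ← W.extrinsicMean_mul_expect_extrinsicDensity C i u]
  linarith [mul_le_mul_of_nonneg_right this average_nonneg]

theorem min_density_mul_le_expect_indicator (dec : (ι → U) → (ι → Bool)) (u : ι → U) :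
    (1 - W.extrinsicMean C i u ^ 2) / 4 * (𝔼 x ∈ C, W.extrinsicDensity i x u)
        * min (W.density true (u i)) (W.density false (u i))
      ≤ 𝔼 x ∈ C, W.wordDensity x u * {u | dec u ≠ x}.indicator 1 u := by
  refine (mul_le_mul_of_nonneg_right (W.one_sub_extrinsicMean_sq_mul_le C i (dec u i) u)
    (W.min_density_pos (u i)).le).trans ?_
  rw [Finset.expect_mul]
  refine Finset.expect_le_expect fun x _ ↦ ?_
  rw [← W.extrinsicDensity_mul_density i x u]
  split_ifs with hxi
  · rw [zero_mul]
    exact mul_nonneg (mul_pos (W.extrinsicDensity_pos i x u) (W.density_pos _ _)).le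
      (Set.indicator_nonneg (fun _ _ ↦ zero_le_one) u)
  · have decoded_ne : u ∈ {u | dec u ≠ x} := fun h ↦ hxi (h ▸ rfl)
    rw [Set.indicator_of_mem decoded_ne, Pi.one_apply, mul_one]
    exact mul_le_mul_of_nonneg_left (W.min_density_le _ _) (W.extrinsicDensity_pos i x u).le

theorem overlap_mul_one_sub_expect_extrinsicMean_sq_le {C : Finset (ι → Bool)} (hC : C.Nonempty)
    (i : ι) {dec : (ι → U) → (ι → Bool)} (hdec : Measurable dec) :
    W.overlap / 4 * (1 - 𝔼 x ∈ C, ∫ u, W.extrinsicMean C i u ^ 2 ∂W.wordLaw x)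
      ≤ 𝔼 x ∈ C, (W.wordLaw x).real {u | dec u ≠ x} := by
  have indicator_integrable : ∀ x, Integrable
      (fun u ↦ W.wordDensity x u * {u | dec u ≠ x}.indicator 1 u) (Measure.pi fun _ ↦ W.mix) :=
    fun x ↦ W.integrable_wordLaw.1
      ((integrable_const 1).indicator (hdec (measurableSet_singleton x).compl))
  have uncertainty_measurable : Measurable fun u ↦ (1 - W.extrinsicMean C i u ^ 2) / 4 :=
    (((W.measurable_extrinsicMean C i).pow_const 2).const_sub 1).div_const 4
  have uncertainty_bound : ∀ u, |(1 - W.extrinsicMean C i u ^ 2) / 4| ≤ 1 := fun u ↦ by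
    rw [abs_le]
    constructor <;> linarith [sq_nonneg (W.extrinsicMean C i u), W.extrinsicMean_sq_le_one C i u]
  calc W.overlap / 4 * (1 - 𝔼 x ∈ C, ∫ u, W.extrinsicMean C i u ^ 2 ∂W.wordLaw x)
      = (𝔼 x ∈ C, ∫ u, (1 - W.extrinsicMean C i u ^ 2) / 4 ∂W.wordLaw x) * W.overlap := by
        simp only [integral_div, integral_sub (integrable_const (1 : ℝ))
          (W.integrable_extrinsicMean_sq C i _), integral_const, probReal_univ, one_smul,
          ← Finset.expect_div, Finset.expect_sub_distrib, Finset.expect_const hC]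
        ring
    _ = ∫ u, (1 - W.extrinsicMean C i u ^ 2) / 4 * (𝔼 x ∈ C, W.extrinsicDensity i x u)
          * min (W.density true (u i)) (W.density false (u i)) ∂Measure.pi fun _ ↦ W.mix :=
        W.expect_integral_wordLaw_mul_integral_mix C uncertainty_measurable uncertainty_bound
          (fun u v ↦ by rw [extrinsicMean_update]) W.measurable_min_density
          W.abs_min_density_le_two
    _ ≤ ∫ u, 𝔼 x ∈ C, W.wordDensity x u * {u | dec u ≠ x}.indicator 1 u
          ∂Measure.pi fun _ ↦ W.mix :=
        integral_mono (W.integrable_mul_expect_extrinsicDensity_mul_eval C uncertainty_measurable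
          uncertainty_bound W.measurable_min_density W.abs_min_density_le_two)
          (integrable_finsetExpect _ indicator_integrable) fun u ↦
            W.min_density_mul_le_expect_indicator C i dec u
    _ = 𝔼 x ∈ C, (W.wordLaw x).real {u | dec u ≠ x} := by
        rw [integral_finsetExpect _ indicator_integrable]
        simp only [← integral_wordLaw]
        exact Finset.expect_congr rfl fun x _ ↦
          integral_indicator_one (hdec (measurableSet_singleton x).compl)

end Overlap

end BinaryInputChannel

namespace BinaryInputChannel

variable {U U' : Type*} [MeasurableSpace U] [MeasurableSpace U']

/-- The map `π` turns the outputs of the channel `W` into outputs of the channel `V`. -/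
structure IsDegradation (W : BinaryInputChannel U) (V : BinaryInputChannel U') (π : U → U') :
    Prop where
  measurable : Measurable π
  map_law : ∀ b, (W.law b).map π = V.law b

/-- The power `E[E[X | u] ^ 2]` of the posterior mean of an equiprobable channel symbol. -/
noncomputable def power (W : BinaryInputChannel U) : ℝ := ∫ u, W.posteriorMean u ^ 2 ∂W.mix

theorem power_nonneg (W : BinaryInputChannel U) : 0 ≤ W.power :=
  integral_nonneg fun _ ↦ sq_nonneg _

theorem power_le_one (W : BinaryInputChannel U) : W.power ≤ 1 := by
  refine (integral_mono_of_nonneg (ae_of_all _ fun u ↦ sq_nonneg _) (integrable_const (1 : ℝ))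
    (ae_of_all _ fun u ↦ (sq_le_one_iff_abs_le_one _).2 (W.abs_posteriorMean_le_one u))).trans_eq ?_
  simp

/-- Half the difference of the posterior means of an equiprobable channel symbol given the output
of `W` and given the degraded output of `V`. -/
noncomputable def meanGap (W : BinaryInputChannel U) (V : BinaryInputChannel U') (π : U → U')
    (u : U) : ℝ :=
  (W.posteriorMean u - V.posteriorMean (π u)) / 2

theorem abs_meanGap_le_one (W : BinaryInputChannel U) (V : BinaryInputChannel U') (π : U → U')
    (u : U) : |W.meanGap V π u| ≤ 1 := by
  have hW := abs_le.1 (W.abs_posteriorMean_le_one u)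
  have hV := abs_le.1 (V.abs_posteriorMean_le_one (π u))
  rw [meanGap, abs_le]
  constructor <;> linarith [hW.1, hW.2, hV.1, hV.2]

theorem measurable_meanGap (W : BinaryInputChannel U) (V : BinaryInputChannel U') {π : U → U'}
    (hπ : Measurable π) : Measurable (W.meanGap V π) :=
  (W.measurable_posteriorMean.sub (V.measurable_posteriorMean.comp hπ)).div_const 2

section Tilt

variable (W : BinaryInputChannel U) (V : BinaryInputChannel U') (π : U → U') {ι : Type*}

/-- The tilt `∏ i ∈ s, (1 + t * E i y * h (u i))` of the product of the mixtures, where `h` is the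
posterior mean gap; for `y` the degraded outputs and `|t|` small it is a probability density. -/
noncomputable def tilt (E : ι → (ι → U') → ℝ) (t : ℝ) (s : Finset ι) (y : ι → U') (u : ι → U) :
    ℝ :=
  ∏ i ∈ s, (1 + t * E i y * W.meanGap V π (u i))

variable {E : ι → (ι → U') → ℝ} (t : ℝ) (s : Finset ι)

theorem abs_tilt_le (hE1 : ∀ i y, |E i y| ≤ 1) (y : ι → U') (u : ι → U) :
    |W.tilt V π E t s y u| ≤ (1 + |t|) ^ s.card := by
  rw [tilt, Finset.abs_prod, ← Finset.prod_const]
  refine Finset.prod_le_prod (fun i _ ↦ abs_nonneg _) fun i _ ↦ (abs_add_le _ _).trans ?_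
  rw [abs_one, abs_mul, abs_mul]
  refine add_le_add_right (mul_le_of_le_one_right ?_ (W.abs_meanGap_le_one V π _) |>.trans ?_) 1
  exacts [by positivity, mul_le_of_le_one_right (abs_nonneg t) (hE1 i y)]

theorem tilt_update [DecidableEq ι] {k : ι} (hk : k ∉ s) (y : ι → U') (u : ι → U) (v : U) :
    W.tilt V π E t s y (Function.update u k v) = W.tilt V π E t s y u :=
  Finset.prod_congr rfl fun i hi ↦ by
    rw [Function.update_of_ne (ne_of_mem_of_not_mem hi hk)]

theorem tilt_insert [DecidableEq ι] {k : ι} (hk : k ∉ s) (y : ι → U') (u : ι → U) :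
    W.tilt V π E t (insert k s) y u
      = W.tilt V π E t s y u + t * E k y * W.tilt V π E t s y u * W.meanGap V π (u k) := by
  rw [tilt, Finset.prod_insert hk, tilt]
  ring

variable {π} (hE : ∀ i, Measurable (E i))
include hE

theorem measurable_tilt_left (u : ι → U) : Measurable fun y ↦ W.tilt V π E t s y u :=
  Finset.measurable_prod _ fun i _ ↦ (((hE i).const_mul t).mul_const _).const_add 1

theorem measurable_tilt_comp (hπ : Measurable π) :
    Measurable fun u ↦ W.tilt V π E t s (fun j ↦ π (u j)) u := by
  have degraded_measurable : Measurable fun (u : ι → U) j ↦ π (u j) :=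
    measurable_pi_lambda _ fun j ↦ hπ.comp (measurable_pi_apply j)
  exact Finset.measurable_prod _ fun i _ ↦ ((((hE i).comp degraded_measurable).const_mul t).mul
    ((W.measurable_meanGap V hπ).comp (measurable_pi_apply i))).const_add 1

end Tilt

namespace IsDegradation

variable {W : BinaryInputChannel U} {V : BinaryInputChannel U'} {π : U → U'}
  (hπ : W.IsDegradation V π)
include hπ

section OneUse

theorem integrable_meanGap (μ : Measure U) [IsFiniteMeasure μ] :
    Integrable (W.meanGap V π) μ :=
  integrable_of_abs_le (W.measurable_meanGap V hπ.measurable) (W.abs_meanGap_le_one V π)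

theorem measurePreserving_law (b : Bool) : MeasurePreserving π (W.law b) (V.law b) :=
  ⟨hπ.measurable, hπ.map_law b⟩

theorem integral_law_comp {f : U' → ℝ} (hf : Measurable f) (b : Bool) :
    ∫ u, f (π u) ∂W.law b = ∫ v, f v ∂V.law b :=
  integral_comp_of_measurePreserving (hπ.measurePreserving_law b) hf.aestronglyMeasurable

variable {f : U' → ℝ} (hf : Measurable f) {K : ℝ} (hK : ∀ v, |f v| ≤ K)
include hf hK

theorem integrable_comp (μ : Measure U) [IsFiniteMeasure μ] : Integrable (fun u ↦ f (π u)) μ :=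
  integrable_of_abs_le (hf.comp hπ.measurable) fun u ↦ hK (π u)

theorem integral_mix_comp : ∫ u, f (π u) ∂W.mix = ∫ v, f v ∂V.mix := by
  have hW := W.integral_law_true_add_integral_law_false (hπ.integrable_comp hf hK W.mix)
  simp only [hπ.integral_law_comp hf] at hW
  linarith [V.integral_law_true_add_integral_law_false (integrable_of_abs_le hf hK)]

theorem integral_posteriorMean_mul_comp :
    ∫ u, W.posteriorMean u * f (π u) ∂W.mix = ∫ v, V.posteriorMean v * f v ∂V.mix := by
  have hW := W.integral_law_true_sub_integral_law_false (hπ.integrable_comp hf hK W.mix)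
  simp only [hπ.integral_law_comp hf] at hW
  linarith [V.integral_law_true_sub_integral_law_false (integrable_of_abs_le hf hK)]

/- The gap is a martingale difference: refining the degraded output changes the posterior mean of
an equiprobable symbol by an amount of conditional mean zero. -/
theorem integral_meanGap_mul_comp : ∫ u, W.meanGap V π u * f (π u) ∂W.mix = 0 := by
  have degraded_measurable : Measurable fun v ↦ V.posteriorMean v * f v :=
    V.measurable_posteriorMean.mul hf
  have degraded_bound : ∀ v, |V.posteriorMean v * f v| ≤ K := fun v ↦ by
    rw [abs_mul]
    exact (mul_le_of_le_one_left (abs_nonneg _) (V.abs_posteriorMean_le_one v)).trans (hK v)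
  have original_integrable : Integrable (fun u ↦ W.posteriorMean u * f (π u)) W.mix :=
    (hπ.integrable_comp hf hK W.mix).bdd_mul W.measurable_posteriorMean.aestronglyMeasurable
      (ae_of_all _ W.abs_posteriorMean_le_one)
  simp only [meanGap, div_mul_eq_mul_div, sub_mul]
  rw [integral_div, integral_sub original_integrable
    (hπ.integrable_comp degraded_measurable degraded_bound W.mix),
    hπ.integral_posteriorMean_mul_comp hf hK,
    hπ.integral_mix_comp degraded_measurable degraded_bound, sub_self, zero_div]

omit hf hK

theorem integral_posteriorMean_mul_meanGap :
    ∫ u, W.posteriorMean u * W.meanGap V π u ∂W.mix = 2 * ∫ u, W.meanGap V π u ^ 2 ∂W.mix := by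
  have gap_mul_integrable : Integrable (fun u ↦ W.meanGap V π u * V.posteriorMean (π u)) W.mix :=
    (hπ.integrable_meanGap W.mix).mul_bdd
      (V.measurable_posteriorMean.comp hπ.measurable).aestronglyMeasurable
      (ae_of_all _ fun u ↦ V.abs_posteriorMean_le_one (π u))
  have split : ∀ u, W.posteriorMean u * W.meanGap V π u
      = 2 * (W.meanGap V π u * W.meanGap V π u) + W.meanGap V π u * V.posteriorMean (π u) :=
    fun u ↦ by rw [meanGap]; ring
  have sq_integrable : Integrable (fun u ↦ W.meanGap V π u * W.meanGap V π u) W.mix :=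
    (hπ.integrable_meanGap W.mix).mul_bdd
      (W.measurable_meanGap V hπ.measurable).aestronglyMeasurable
      (ae_of_all _ (W.abs_meanGap_le_one V π))
  simp only [split, sq]
  rw [integral_add (sq_integrable.const_mul 2) gap_mul_integrable,
    hπ.integral_meanGap_mul_comp V.measurable_posteriorMean V.abs_posteriorMean_le_one,
    integral_const_mul, add_zero]

theorem power_sub_power : W.power - V.power = 4 * ∫ u, W.meanGap V π u ^ 2 ∂W.mix := by
  have gap_integrable : Integrable (fun u ↦ W.posteriorMean u * W.meanGap V π u) W.mix :=
    (hπ.integrable_meanGap W.mix).bdd_mul W.measurable_posteriorMean.aestronglyMeasurable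
      (ae_of_all _ W.abs_posteriorMean_le_one)
  have degraded_integrable : Integrable (fun u ↦ W.posteriorMean u * V.posteriorMean (π u)) W.mix :=
    (hπ.integrable_comp V.measurable_posteriorMean V.abs_posteriorMean_le_one W.mix).bdd_mul
      W.measurable_posteriorMean.aestronglyMeasurable (ae_of_all _ W.abs_posteriorMean_le_one)
  have split : ∀ u, W.posteriorMean u ^ 2
      = 2 * (W.posteriorMean u * W.meanGap V π u) + W.posteriorMean u * V.posteriorMean (π u) :=
    fun u ↦ by rw [meanGap]; ring
  rw [power, power]
  simp only [split]
  rw [integral_add (gap_integrable.const_mul 2) degraded_integrable, integral_const_mul,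
    hπ.integral_posteriorMean_mul_meanGap,
    hπ.integral_posteriorMean_mul_comp V.measurable_posteriorMean V.abs_posteriorMean_le_one]
  simp only [← sq]
  ring

theorem integral_law_meanGap (b : Bool) :
    ∫ u, W.meanGap V π u ∂W.law b = bpsk b * ((W.power - V.power) / 2) := by
  have integral_mix : ∫ u, W.meanGap V π u ∂W.mix = 0 := by
    simpa using hπ.integral_meanGap_mul_comp (f := fun _ ↦ 1) measurable_const (K := 1) (by simp)
  rw [W.integral_law_eq b (hπ.integrable_meanGap W.mix), integral_mix,
    hπ.integral_posteriorMean_mul_meanGap, hπ.power_sub_power]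
  ring

theorem symmetricInfo_le : V.symmetricInfo ≤ W.symmetricInfo := by
  have density_bound : ∀ b v, |V.density b v| ≤ 2 := fun b v ↦
    (abs_of_pos (V.density_pos b v)).trans_le (V.density_le_two b v)
  have density_integrable (b : Bool) :=
    hπ.integrable_comp (V.measurable_density b) (density_bound b) W.mix
  have exp_log (b : Bool) (u : U) : Real.exp (Real.log (V.density b (π u))) = V.density b (π u) :=
    Real.exp_log (V.density_pos b (π u))
  have log_integrable (b : Bool) : Integrable (fun u ↦ Real.log (V.density b (π u))) (W.law b) :=
    (hπ.measurePreserving_law b).integrable_comp_of_integrable (V.integrable_log_density b)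
  have compare (b : Bool) : ∫ v, Real.log (V.density b v) ∂V.law b
      ≤ ∫ u, Real.log (W.density b u) ∂W.law b + ∫ u, V.density b (π u) ∂W.mix - 1 := by
    rw [← hπ.integral_law_comp (V.measurable_density b).log]
    simpa only [exp_log] using integral_le_integral_log_density_add (W.measurable_density b)
      (W.density_pos b) (W.law_eq b) (W.integrable_log_density b) (log_integrable b)
      (by simpa only [exp_log] using density_integrable b)
  have mass : ∫ u, V.density true (π u) ∂W.mix + ∫ u, V.density false (π u) ∂W.mix = 2 := by
    rw [← integral_add (density_integrable true) (density_integrable false)]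
    simp [V.density_true_add_density_false]
  linarith [compare true, compare false,
    W.integral_log_density_true_add_integral_log_density_false,
    V.integral_log_density_true_add_integral_log_density_false]

end OneUse

section Tilt

variable {ι : Type*} [Fintype ι]

theorem measurePreserving_wordLaw (x : ι → Bool) :
    MeasurePreserving (fun u i ↦ π (u i)) (W.wordLaw x) (V.wordLaw x) :=
  measurePreserving_pi _ _ fun i ↦ hπ.measurePreserving_law (x i)

theorem integral_mul_meanGap_eval_eq_zero [DecidableEq ι] (k : ι) {F : (ι → U) → ℝ}
    (hF : Measurable F) {K : ℝ} (hK : ∀ u, |F u| ≤ K) {Φ : (ι → U) → U' → ℝ}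
    (hΦ : ∀ u, Measurable (Φ u)) (hΦK : ∀ u v, |Φ u v| ≤ K)
    (hFΦ : ∀ u v, F (Function.update u k v) = Φ u (π v)) :
    ∫ u, F u * W.meanGap V π (u k) ∂Measure.pi (fun _ ↦ W.mix) = 0 := by
  have integrable : Integrable (fun u ↦ F u * W.meanGap V π (u k)) (Measure.pi fun _ ↦ W.mix) :=
    (integrable_of_abs_le hF hK).mul_bdd
      ((W.measurable_meanGap V hπ.measurable).comp (measurable_pi_apply k)).aestronglyMeasurable
      (ae_of_all _ fun u ↦ W.abs_meanGap_le_one V π (u k))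
  rw [integral_pi_eq_integral_update _ k integrable]
  simp only [hFΦ, Function.update_self, mul_comm (Φ _ _),
    hπ.integral_meanGap_mul_comp (hΦ _) (hΦK _), integral_zero]

variable {E : ι → (ι → U') → ℝ} (hE : ∀ i, Measurable (E i)) (hE1 : ∀ i y, |E i y| ≤ 1) (t : ℝ)
include hE hE1

theorem integral_tilt_mul_meanGap_eq_zero {s : Finset ι} {k : ι} (hk : k ∉ s) :
    ∫ u, t * E k (fun j ↦ π (u j)) * W.tilt V π E t s (fun j ↦ π (u j)) u
      * W.meanGap V π (u k) ∂Measure.pi (fun _ ↦ W.mix) = 0 := by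
  classical
  have weight_bound : ∀ y u, |t * E k y * W.tilt V π E t s y u| ≤ |t| * (1 + |t|) ^ s.card :=
    fun y u ↦ by
      rw [abs_mul, abs_mul]
      exact mul_le_mul (mul_le_of_le_one_right (abs_nonneg t) (hE1 k y))
        (W.abs_tilt_le V π t s hE1 y u) (abs_nonneg _) (abs_nonneg t)
  have weight_measurable : ∀ u, Measurable fun y ↦ t * E k y * W.tilt V π E t s y u := fun u ↦
    ((hE k).const_mul t).mul (W.measurable_tilt_left V t s hE u)
  have degraded_measurable : Measurable fun (u : ι → U) j ↦ π (u j) :=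
    measurable_pi_lambda _ fun j ↦ hπ.measurable.comp (measurable_pi_apply j)
  exact hπ.integral_mul_meanGap_eval_eq_zero k
    (F := fun u ↦ t * E k (fun j ↦ π (u j)) * W.tilt V π E t s (fun j ↦ π (u j)) u)
    (Φ := fun u v ↦ t * E k (Function.update (fun j ↦ π (u j)) k v)
      * W.tilt V π E t s (Function.update (fun j ↦ π (u j)) k v) u)
    ((((hE k).comp degraded_measurable).const_mul t).mul
      (W.measurable_tilt_comp V t s hE hπ.measurable))
    (fun u ↦ weight_bound _ u) (fun u ↦ (weight_measurable u).comp (measurable_update _))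
    (fun u v ↦ weight_bound _ u) fun u v ↦ by
      simp only [W.tilt_update V π t s hk, Function.apply_update (fun _ ↦ π) u k v]

theorem integral_tilt (s : Finset ι) :
    ∫ u, W.tilt V π E t s (fun j ↦ π (u j)) u ∂Measure.pi (fun _ ↦ W.mix) = 1 := by
  classical
  have tilt_integrable : ∀ s,
      Integrable (fun u ↦ W.tilt V π E t s (fun j ↦ π (u j)) u) (Measure.pi fun _ ↦ W.mix) :=
    fun s ↦ integrable_of_abs_le (W.measurable_tilt_comp V t s hE hπ.measurable)
      fun u ↦ W.abs_tilt_le V π t s hE1 _ u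
  induction s using Finset.induction_on with
  | empty => simp [tilt]
  | insert k s hk ih =>
    have increment_integrable := (tilt_integrable (insert k s)).sub (tilt_integrable s)
    simp only [W.tilt_insert V π t s hk, Pi.sub_def, add_sub_cancel_left] at increment_integrable
    simp only [W.tilt_insert V π t s hk]
    rw [integral_add (tilt_integrable s) increment_integrable, ih,
      hπ.integral_tilt_mul_meanGap_eq_zero hE hE1 t hk, add_zero]

end Tilt

end IsDegradation

end BinaryInputChannel

theorem sub_sq_le_log_one_add {x : ℝ} (hx : |x| ≤ 1 / 4) : x - x ^ 2 ≤ Real.log (1 + x) := by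
  have taylor := (abs_le.1 (Real.abs_log_sub_add_sum_range_le (x := -x)
    (by rw [abs_neg]; linarith) 2)).1
  simp only [Finset.sum_range_succ, Finset.sum_range_zero, abs_neg, sub_neg_eq_add] at taylor
  norm_num at taylor
  have remainder_le : |x| ^ 3 / (1 - |x|) ≤ x ^ 2 / 2 := by
    rw [div_le_iff₀ (by linarith), ← sq_abs x]
    nlinarith [mul_nonneg (sq_nonneg |x|) (abs_nonneg x),
      mul_nonneg (sq_nonneg |x|) (sub_nonneg.2 hx)]
  linarith

namespace BinaryInputChannel

variable {U U' : Type*} [MeasurableSpace U] [MeasurableSpace U']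

section TiltExponent

variable (W : BinaryInputChannel U) (V : BinaryInputChannel U') (π : U → U') {ι : Type*}
  [Fintype ι]

/-- A quadratic lower bound of the logarithm of `W.tilt V π E t Finset.univ`. -/
noncomputable def tiltExponent (E : ι → (ι → U') → ℝ) (t : ℝ) (y : ι → U') (u : ι → U) : ℝ :=
  ∑ i, (t * E i y * W.meanGap V π (u i) - (t * E i y) ^ 2)

variable {E : ι → (ι → U') → ℝ} {t : ℝ}

theorem exp_tiltExponent_le_tilt (hE1 : ∀ i y, |E i y| ≤ 1) (ht : |t| ≤ 1 / 4) (y : ι → U')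
    (u : ι → U) :
    Real.exp (W.tiltExponent V π E t y u) ≤ W.tilt V π E t Finset.univ y u := by
  rw [tiltExponent, Real.exp_sum, tilt]
  refine Finset.prod_le_prod (fun i _ ↦ (Real.exp_pos _).le) fun i _ ↦ ?_
  set c := t * E i y
  set h := W.meanGap V π (u i)
  have hh : |h| ≤ 1 := W.abs_meanGap_le_one V π (u i)
  have hc : |c| ≤ 1 / 4 := by
    rw [abs_mul]
    exact (mul_le_of_le_one_right (abs_nonneg t) (hE1 i y)).trans ht
  have hch : |c * h| ≤ 1 / 4 := by
    rw [abs_mul]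
    exact (mul_le_of_le_one_right (abs_nonneg c) hh).trans hc
  have square_le : (c * h) ^ 2 ≤ c ^ 2 := by
    rw [mul_pow]
    exact mul_le_of_le_one_right (sq_nonneg c) ((sq_le_one_iff_abs_le_one h).2 hh)
  rw [← Real.le_log_iff_exp_le (by linarith [(abs_le.1 hch).1])]
  linarith [sub_sq_le_log_one_add hch]

variable {π} in
theorem measurable_tiltExponent_comp (hE : ∀ i, Measurable (E i)) (hπ : Measurable π) :
    Measurable fun u ↦ W.tiltExponent V π E t (fun j ↦ π (u j)) u := by
  have degraded_measurable : Measurable fun (u : ι → U) j ↦ π (u j) :=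
    measurable_pi_lambda _ fun j ↦ hπ.comp (measurable_pi_apply j)
  have weight_measurable : ∀ i, Measurable fun u : ι → U ↦ t * E i fun j ↦ π (u j) :=
    fun i ↦ ((hE i).comp degraded_measurable).const_mul t
  exact Finset.measurable_sum _ fun i _ ↦ ((weight_measurable i).mul
    ((W.measurable_meanGap V hπ).comp (measurable_pi_apply i))).sub
    ((weight_measurable i).pow_const 2)

end TiltExponent

namespace IsDegradation

variable {W : BinaryInputChannel U} {V : BinaryInputChannel U'} {π : U → U'}
  (hπ : W.IsDegradation V π) {ι : Type*} [Fintype ι]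
include hπ

section Tilt

variable {E : ι → (ι → U') → ℝ} (hE : ∀ i, Measurable (E i)) (hE1 : ∀ i y, |E i y| ≤ 1) {t : ℝ}
  (ht : |t| ≤ 1 / 4)
include hE hE1 ht

theorem integrable_exp_tiltExponent :
    Integrable (fun u ↦ Real.exp (W.tiltExponent V π E t (fun j ↦ π (u j)) u))
      (Measure.pi fun _ ↦ W.mix) :=
  integrable_of_abs_le (W.measurable_tiltExponent_comp V hE hπ.measurable).exp fun u ↦ by
    rw [Real.abs_exp]
    exact (W.exp_tiltExponent_le_tilt V π hE1 ht _ u).trans <|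
      (le_abs_self _).trans (W.abs_tilt_le V π t Finset.univ hE1 _ u)

theorem integral_exp_tiltExponent_le_one :
    ∫ u, Real.exp (W.tiltExponent V π E t (fun j ↦ π (u j)) u) ∂Measure.pi (fun _ ↦ W.mix)
      ≤ 1 :=
  (integral_mono (hπ.integrable_exp_tiltExponent hE hE1 ht)
    (integrable_of_abs_le (W.measurable_tilt_comp V t Finset.univ hE hπ.measurable)
      fun u ↦ W.abs_tilt_le V π t Finset.univ hE1 _ u)
    fun u ↦ W.exp_tiltExponent_le_tilt V π hE1 ht _ u).trans_eq
    (hπ.integral_tilt hE hE1 t Finset.univ)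

end Tilt

theorem integrable_mul_meanGap_eval {F : (ι → U') → ℝ} (hF : Measurable F)
    (hF1 : ∀ y, |F y| ≤ 1) (i : ι) (x : ι → Bool) :
    Integrable (fun u ↦ F (fun j ↦ π (u j)) * W.meanGap V π (u i)) (W.wordLaw x) :=
  (integrable_of_abs_le (hF.comp (hπ.measurePreserving_wordLaw x).measurable)
    fun _ ↦ hF1 _).mul_bdd
    ((W.measurable_meanGap V hπ.measurable).comp (measurable_pi_apply i)).aestronglyMeasurable
    (ae_of_all _ fun u ↦ W.abs_meanGap_le_one V π (u i))

variable [DecidableEq ι]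

theorem integral_mul_meanGap_eval {F : (ι → U') → ℝ} (hF : Measurable F)
    (hF1 : ∀ y, |F y| ≤ 1) {i : ι} (hFi : ∀ y v, F (Function.update y i v) = F y)
    (x : ι → Bool) :
    ∫ u, F (fun j ↦ π (u j)) * W.meanGap V π (u i) ∂W.wordLaw x
      = (W.power - V.power) / 2 * (bpsk (x i) * ∫ y, F y ∂V.wordLaw x) := by
  rw [wordLaw, integral_pi_mul_eval _ i
    (fun u v ↦ by simp only [Function.apply_update (fun _ ↦ π) u i v, hFi])
    (hπ.integrable_mul_meanGap_eval hF hF1 i x), hπ.integral_law_meanGap, ← wordLaw,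
    integral_comp_of_measurePreserving (hπ.measurePreserving_wordLaw x) hF.aestronglyMeasurable]
  ring

variable (C : Finset (ι → Bool)) (t : ℝ)

theorem integrable_tiltExponent_extrinsicMean (x : ι → Bool) :
    Integrable (fun u ↦ W.tiltExponent V π (V.extrinsicMean C) t (fun j ↦ π (u j)) u)
      (W.wordLaw x) := by
  simp only [tiltExponent, mul_pow, mul_assoc]
  exact integrable_finsetSum _ fun i _ ↦ ((hπ.integrable_mul_meanGap_eval
    (V.measurable_extrinsicMean C i) (V.abs_extrinsicMean_le_one C i) i x).const_mul t).sub
    (((hπ.measurePreserving_wordLaw x).integrable_comp_of_integrable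
      (V.integrable_extrinsicMean_sq C i _)).const_mul (t ^ 2))

theorem integral_tiltExponent_extrinsicMean (x : ι → Bool) :
    ∫ u, W.tiltExponent V π (V.extrinsicMean C) t (fun j ↦ π (u j)) u ∂W.wordLaw x
      = ∑ i, (t * ((W.power - V.power) / 2 *
          (bpsk (x i) * ∫ y, V.extrinsicMean C i y ∂V.wordLaw x))
          - t ^ 2 * ∫ y, V.extrinsicMean C i y ^ 2 ∂V.wordLaw x) := by
  have degraded := hπ.measurePreserving_wordLaw x
  have gap_integrable (i : ι) := (hπ.integrable_mul_meanGap_eval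
    (V.measurable_extrinsicMean C i) (V.abs_extrinsicMean_le_one C i) i x).const_mul t
  have sq_integrable (i : ι) : Integrable
      (fun u ↦ t ^ 2 * V.extrinsicMean C i (fun j ↦ π (u j)) ^ 2) (W.wordLaw x) :=
    (degraded.integrable_comp_of_integrable (V.integrable_extrinsicMean_sq C i _)).const_mul _
  simp only [tiltExponent, mul_pow, mul_assoc]
  refine (integral_finsetSum _ fun i _ ↦ (gap_integrable i).sub (sq_integrable i)).trans
    (Finset.sum_congr rfl fun i _ ↦ ?_)
  rw [Pi.sub_def, integral_sub (gap_integrable i) (sq_integrable i), integral_const_mul,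
    integral_const_mul, hπ.integral_mul_meanGap_eval (V.measurable_extrinsicMean C i)
      (V.abs_extrinsicMean_le_one C i) (V.extrinsicMean_update C i),
    integral_comp_of_measurePreserving (g := fun y ↦ V.extrinsicMean C i y ^ 2) degraded
      ((V.measurable_extrinsicMean C i).pow_const 2).aestronglyMeasurable]

/- Conditioning `X i` on the other degraded outputs turns `E[X i * E i]` into `E[E i ^ 2]`, so the
linear gain and the quadratic loss of the tilt are both multiples of `E[E i ^ 2]`. -/
theorem expect_integral_tiltExponent_extrinsicMean :
    𝔼 x ∈ C, ∫ u, W.tiltExponent V π (V.extrinsicMean C) t (fun j ↦ π (u j)) u ∂W.wordLaw x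
      = (t * ((W.power - V.power) / 2) - t ^ 2)
        * ∑ i, 𝔼 x ∈ C, ∫ y, V.extrinsicMean C i y ^ 2 ∂V.wordLaw x := by
  simp only [hπ.integral_tiltExponent_extrinsicMean, Finset.expect_sum_comm,
    Finset.expect_sub_distrib, ← Finset.mul_expect, expect_bpsk_mul_integral_extrinsicMean]
  rw [Finset.mul_sum]
  exact Finset.sum_congr rfl fun i _ ↦ by ring

/- Fano's inequality against the output density tilted by `t = (W.power - V.power) / 4`, which
balances linear gain and quadratic loss. -/
theorem sum_expect_extrinsicMean_sq_add_log_card_le {C : Finset (ι → Bool)} (hC : C.Nonempty)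
    {dec : (ι → U) → (ι → Bool)} (hdec : Measurable dec)
    {J : ℝ} (hJ : ∀ b, ∫ u, Real.log (W.density b u) ∂W.law b = J) {err : ℝ}
    (herr : 𝔼 x ∈ C, (W.wordLaw x).real {u | dec u ≠ x} = err) :
    ((W.power - V.power) / 4) ^ 2
          * ∑ i, 𝔼 x ∈ C, ∫ y, V.extrinsicMean C i y ^ 2 ∂V.wordLaw x + Real.log C.card
      ≤ Fintype.card ι * J + Real.binEntropy err + err * Real.log C.card := by
  set t := (W.power - V.power) / 4 with ht_def
  have ht : |t| ≤ 1 / 4 := by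
    rw [ht_def, abs_le]
    constructor <;> linarith [W.power_nonneg, W.power_le_one, V.power_nonneg, V.power_le_one]
  have fano := expect_integral_add_log_card_le hC hdec (P := W.wordLaw) W.measurable_wordDensity
    W.wordDensity_pos W.wordLaw_eq_withDensity W.integrable_log_wordDensity
    (hπ.integrable_tiltExponent_extrinsicMean C t)
    (hπ.integrable_exp_tiltExponent (V.measurable_extrinsicMean C)
      (V.abs_extrinsicMean_le_one C) ht)
    (hπ.integral_exp_tiltExponent_le_one (V.measurable_extrinsicMean C)
      (V.abs_extrinsicMean_le_one C) ht) herr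
  have balance : t * ((W.power - V.power) / 2) - t ^ 2 = t ^ 2 := by ring
  rwa [hπ.expect_integral_tiltExponent_extrinsicMean, balance,
    Finset.expect_congr rfl fun x _ ↦ integral_log_wordDensity hJ x,
    Finset.expect_const hC] at fano

end IsDegradation

section WithNoise

variable (W : BinaryInputChannel U) {Z : Type*} [MeasurableSpace Z] (ν : Measure Z)
  [IsProbabilityMeasure ν]

theorem isDegradation_withNoise_fst : (W.withNoise ν).IsDegradation W Prod.fst where
  measurable := measurable_fst
  map_law _ := measurePreserving_fst.map_eq

theorem power_withNoise : (W.withNoise ν).power = W.power :=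
  integral_comp_of_measurePreserving measurePreserving_fst
    (W.measurable_posteriorMean.pow_const 2).aestronglyMeasurable

theorem symmetricInfo_withNoise : (W.withNoise ν).symmetricInfo = W.symmetricInfo :=
  congrArg _ <| integral_comp_of_measurePreserving measurePreserving_fst
    W.integrable_binEntropy_density.aestronglyMeasurable

variable {W ν} {V : BinaryInputChannel U'} {π : U × Z → U'} {ι : Type*} [Fintype ι] [DecidableEq ι]

theorem sum_expect_extrinsicMean_sq_add_log_card_le (hπ : (W.withNoise ν).IsDegradation V π)
    {C : Finset (ι → Bool)} (hC : C.Nonempty) {dec : (ι → U) → (ι → Bool)} (hdec : Measurable dec)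
    {J : ℝ} (hJ : ∀ b, ∫ u, Real.log (W.density b u) ∂W.law b = J) {err : ℝ}
    (herr : 𝔼 x ∈ C, (W.wordLaw x).real {u | dec u ≠ x} = err) :
    ((W.power - V.power) / 4) ^ 2
          * ∑ i, 𝔼 x ∈ C, ∫ y, V.extrinsicMean C i y ^ 2 ∂V.wordLaw x + Real.log C.card
      ≤ Fintype.card ι * J + Real.binEntropy err + err * Real.log C.card := by
  have first (x : ι → Bool) := (W.isDegradation_withNoise_fst ν).measurePreserving_wordLaw x
  have error_eq (x : ι → Bool) : ((W.withNoise ν).wordLaw x).real {u | dec (fun j ↦ (u j).1) ≠ x}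
      = (W.wordLaw x).real {u | dec u ≠ x} :=
    (first x).measureReal_preimage
      (hdec (measurableSet_singleton x).compl).nullMeasurableSet
  have converse := hπ.sum_expect_extrinsicMean_sq_add_log_card_le hC
    (hdec.comp (first fun _ ↦ true).measurable) (J := J) (fun b ↦
      (integral_comp_of_measurePreserving measurePreserving_fst
        (W.integrable_log_density b).aestronglyMeasurable).trans (hJ b))
    ((Finset.expect_congr rfl fun x _ ↦ error_eq x).trans herr)
  simpa only [power_withNoise] using converse

end WithNoise

end BinaryInputChannel

namespace BinaryInputChannel

theorem symmetricInfo_le_log_two {U : Type*} [MeasurableSpace U] (W : BinaryInputChannel U) :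
    W.symmetricInfo ≤ Real.log 2 :=
  sub_le_self _ <| integral_nonneg fun u ↦
    Real.binEntropy_nonneg (by linarith [W.density_pos true u])
      (by linarith [W.density_le_two true u])

theorem symmetricInfo_pos {U : Type*} [MeasurableSpace U] {W : BinaryInputChannel U}
    (hW : 0 < W.power) : 0 < W.symmetricInfo := by
  have deficit_nonneg : ∀ u, 0 ≤ Real.log 2 - Real.binEntropy (W.density true u / 2) :=
    fun u ↦ sub_nonneg.2 Real.binEntropy_le_log_two
  have deficit_integrable :
      Integrable (fun u ↦ Real.log 2 - Real.binEntropy (W.density true u / 2)) W.mix :=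
    (integrable_const _).sub W.integrable_binEntropy_density
  have symmetricInfo_eq : W.symmetricInfo
      = ∫ u, (Real.log 2 - Real.binEntropy (W.density true u / 2)) ∂W.mix := by
    rw [integral_sub (integrable_const _) W.integrable_binEntropy_density, integral_const,
      probReal_univ, one_smul, symmetricInfo]
  rw [symmetricInfo_eq]
  refine (integral_nonneg deficit_nonneg).lt_of_ne fun info_eq_zero ↦ hW.ne' ?_
  have deficit_zero := (integral_eq_zero_iff_of_nonneg deficit_nonneg deficit_integrable).1
    info_eq_zero.symm
  refine integral_eq_zero_of_ae ?_
  filter_upwards [deficit_zero] with u hu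
  have half := Real.binEntropy_eq_log_two.1 (sub_eq_zero.1 hu).symm
  have : W.posteriorMean u = 0 := by rw [posteriorMean]; linarith
  simp [this]

end BinaryInputChannel

section Gaussian

/-- The equiprobable mixture of the output laws `N(s, 1)` and `N(-s, 1)` of the Gaussian channel. -/
noncomputable def gaussianMixture (s : ℝ) : Measure ℝ :=
  volume.withDensity fun y ↦
    ENNReal.ofReal ((gaussianPDFReal s 1 y + gaussianPDFReal (-s) 1 y) / 2)

/-- The density of the output law `N(s * bpsk b, 1)` of the Gaussian channel with respect to
`gaussianMixture s`. -/
noncomputable def gaussianDensity (s : ℝ) (b : Bool) (y : ℝ) : ℝ :=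
  2 * Real.sigmoid (2 * s * bpsk b * y)

theorem gaussianDensity_false (s y : ℝ) :
    gaussianDensity s false y = 2 - gaussianDensity s true y := by
  simp only [gaussianDensity, bpsk, if_true, Bool.false_eq_true, if_false, mul_neg, mul_one,
    neg_mul, Real.sigmoid_neg]
  ring

theorem gaussianDensity_neg (s : ℝ) (b : Bool) (y : ℝ) :
    gaussianDensity s (!b) (-y) = gaussianDensity s b y := by
  cases b <;> simp [gaussianDensity, bpsk]

theorem continuous_gaussianDensity (b : Bool) :
    Continuous fun p : ℝ × ℝ ↦ gaussianDensity p.1 b p.2 :=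
  (continuous_sigmoid.comp (by fun_prop)).const_mul 2

theorem measurable_gaussianDensity (s : ℝ) (b : Bool) : Measurable (gaussianDensity s b) :=
  ((continuous_gaussianDensity b).comp (Continuous.prodMk_right s)).measurable

instance isProbabilityMeasure_gaussianMixture (s : ℝ) :
    IsProbabilityMeasure (gaussianMixture s) := by
  have mixture_integrable : Integrable fun y ↦
      (gaussianPDFReal s 1 y + gaussianPDFReal (-s) 1 y) / 2 :=
    ((integrable_gaussianPDFReal s 1).add (integrable_gaussianPDFReal (-s) 1)).div_const 2
  refine isProbabilityMeasure_iff.2 ?_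
  rw [gaussianMixture, withDensity_apply _ MeasurableSet.univ, Measure.restrict_univ,
    ← ofReal_integral_eq_lintegral_ofReal mixture_integrable (ae_of_all _ fun y ↦ div_nonneg
      (add_nonneg (gaussianPDFReal_nonneg s 1 y) (gaussianPDFReal_nonneg (-s) 1 y)) two_pos.le),
    integral_div, integral_add (integrable_gaussianPDFReal _ _) (integrable_gaussianPDFReal _ _),
    integral_gaussianPDFReal_eq_one _ one_ne_zero, integral_gaussianPDFReal_eq_one _ one_ne_zero]
  norm_num

theorem gaussianPDFReal_eq_mul_exp (s y : ℝ) :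
    gaussianPDFReal s 1 y = gaussianPDFReal (-s) 1 y * Real.exp (2 * s * y) := by
  simp only [gaussianPDFReal, mul_assoc, ← Real.exp_add]
  congr 3
  push_cast
  ring

theorem mixture_mul_gaussianDensity (s : ℝ) (b : Bool) (y : ℝ) :
    (gaussianPDFReal s 1 y + gaussianPDFReal (-s) 1 y) / 2 * gaussianDensity s b y
      = gaussianPDFReal (s * bpsk b) 1 y := by
  have := Real.exp_pos (2 * s * y)
  cases b <;> simp only [bpsk, gaussianDensity, Real.sigmoid_def, if_true, Bool.false_eq_true,
    if_false, mul_neg, mul_one, neg_mul, neg_neg, gaussianPDFReal_eq_mul_exp s y, Real.exp_neg] <;>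
  field_simp
  ring

theorem gaussianReal_eq_gaussianMixture_withDensity (s : ℝ) (b : Bool) :
    gaussianReal (s * bpsk b) 1
      = (gaussianMixture s).withDensity fun y ↦ ENNReal.ofReal (gaussianDensity s b y) := by
  rw [gaussianReal_of_var_ne_zero _ one_ne_zero, gaussianMixture, ← withDensity_mul _
    (by fun_prop) (measurable_gaussianDensity s b).ennreal_ofReal]
  congr 1
  ext y
  rw [Pi.mul_apply, ← ENNReal.ofReal_mul (div_nonneg (add_nonneg (gaussianPDFReal_nonneg s 1 y)
    (gaussianPDFReal_nonneg (-s) 1 y)) two_pos.le), mixture_mul_gaussianDensity, gaussianPDF]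

/-- The channel `x ↦ s * x + N`, with inputs `±1` and standard Gaussian noise `N`. -/
noncomputable def gaussianChannel (s : ℝ) : BinaryInputChannel ℝ where
  law b := gaussianReal (s * bpsk b) 1
  mix := gaussianMixture s
  density := gaussianDensity s
  isProbabilityMeasure_law _ := inferInstance
  isProbabilityMeasure_mix := inferInstance
  measurable_density := measurable_gaussianDensity s
  density_pos _ _ := mul_pos two_pos (Real.sigmoid_pos _)
  density_true_add_density_false y := by rw [gaussianDensity_false]; ring
  law_eq := gaussianReal_eq_gaussianMixture_withDensity s

namespace gaussianChannel

theorem measurePreserving_signal_add (s : ℝ) (b : Bool) :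
    MeasurePreserving (fun z ↦ s * bpsk b + z) (gaussianReal 0 1) ((gaussianChannel s).law b) :=
  ⟨by fun_prop, by rw [gaussianReal_map_const_add, zero_add]; rfl⟩

theorem measurePreserving_neg (s : ℝ) (b : Bool) :
    MeasurePreserving (fun y ↦ -y) ((gaussianChannel s).law b) ((gaussianChannel s).law !b) :=
  ⟨measurable_neg, by
    change (gaussianReal _ _).map _ = gaussianReal _ _
    rw [gaussianReal_map_neg]
    cases b <;> simp [bpsk]⟩

theorem integral_log_density (s : ℝ) (b : Bool) :
    ∫ y, Real.log ((gaussianChannel s).density b y) ∂(gaussianChannel s).law b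
      = (gaussianChannel s).symmetricInfo := by
  have symmetry (b : Bool) : ∫ y, Real.log ((gaussianChannel s).density b y)
        ∂(gaussianChannel s).law b
      = ∫ y, Real.log ((gaussianChannel s).density (!b) y) ∂(gaussianChannel s).law !b := by
    rw [← integral_comp_of_measurePreserving (measurePreserving_neg s b)
      ((gaussianChannel s).measurable_density _).log.aestronglyMeasurable]
    exact integral_congr_ae (ae_of_all _ fun y ↦ congrArg Real.log (gaussianDensity_neg s b y).symm)
  have total := (gaussianChannel s).integral_log_density_true_add_integral_log_density_false
  cases b <;> linarith [symmetry true, Bool.not_true ▸ symmetry true]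

theorem binEntropy_density_neg (s y : ℝ) :
    Real.binEntropy (gaussianDensity s true (-y) / 2)
      = Real.binEntropy (gaussianDensity s true y / 2) := by
  rw [← Real.binEntropy_one_sub, ← gaussianDensity_neg s true y, Bool.not_true,
    gaussianDensity_false]
  congr 1
  ring

theorem symmetricInfo_eq (s : ℝ) : (gaussianChannel s).symmetricInfo = Real.log 2
    - ∫ z, Real.binEntropy (gaussianDensity s true (s + z) / 2) ∂gaussianReal 0 1 := by
  have entropy_measurable : Measurable fun y ↦ Real.binEntropy (gaussianDensity s true y / 2) :=
    Real.binEntropy_continuous.measurable.comp ((measurable_gaussianDensity s true).div_const 2)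
  have total := (gaussianChannel s).integral_law_true_add_integral_law_false
    (gaussianChannel s).integrable_binEntropy_density
  have noise := integral_comp_of_measurePreserving (measurePreserving_signal_add s true)
    entropy_measurable.aestronglyMeasurable
  have symmetry := integral_comp_of_measurePreserving (measurePreserving_neg s true)
    entropy_measurable.aestronglyMeasurable
  simp only [binEntropy_density_neg, Bool.not_true] at symmetry
  simp only [bpsk, if_true, mul_one] at noise
  rw [noise, BinaryInputChannel.symmetricInfo]
  change ∫ y, Real.binEntropy (gaussianDensity s true y / 2) ∂_
    + ∫ y, Real.binEntropy (gaussianDensity s true y / 2) ∂_ = _ at total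
  rw [symmetry] at total
  linarith

end gaussianChannel

end Gaussian

section GaussianDegradation

/-- The rescaled output of the Gaussian channel of amplitude `s₃`, with enough standard Gaussian
noise `u.2` added to turn it into an output of the Gaussian channel of amplitude `s₁`. -/
noncomputable def degrade (s₁ s₃ : ℝ) (u : ℝ × ℝ) : ℝ :=
  s₁ / s₃ * u.1 + √(1 - (s₁ / s₃) ^ 2) * u.2

theorem measurable_degrade (s₁ s₃ : ℝ) : Measurable (degrade s₁ s₃) := by
  unfold degrade
  fun_prop

theorem gaussianReal_prod_map_const_mul_add {m₁ m₂ : ℝ} {v₁ v₂ : NNReal} (a b : ℝ) :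
    ((gaussianReal m₁ v₁).prod (gaussianReal m₂ v₂)).map (fun u ↦ a * u.1 + b * u.2)
      = gaussianReal (a * m₁ + b * m₂)
          (.mk (a ^ 2) (sq_nonneg a) * v₁ + .mk (b ^ 2) (sq_nonneg b) * v₂) := by
  have first : ((gaussianReal m₁ v₁).prod (gaussianReal m₂ v₂)).map (fun u ↦ a * u.1)
      = gaussianReal (a * m₁) (.mk (a ^ 2) (sq_nonneg a) * v₁) :=
    (Measure.map_map (measurable_const_mul a) measurable_fst).symm.trans <|
      (congrArg (Measure.map (a * ·)) measurePreserving_fst.map_eq).trans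
        (gaussianReal_map_const_mul a)
  have second : ((gaussianReal m₁ v₁).prod (gaussianReal m₂ v₂)).map (fun u ↦ b * u.2)
      = gaussianReal (b * m₂) (.mk (b ^ 2) (sq_nonneg b) * v₂) :=
    (Measure.map_map (measurable_const_mul b) measurable_snd).symm.trans <|
      (congrArg (Measure.map (b * ·)) measurePreserving_snd.map_eq).trans
        (gaussianReal_map_const_mul b)
  exact gaussianReal_add_gaussianReal_of_indepFun
    (indepFun_prod (X := fun y ↦ a * y) (Y := fun y ↦ b * y) (by fun_prop) (by fun_prop))
    first second

theorem meanGap_degrade_ne_zero {s₁ s₃ y z : ℝ}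
    (h : (s₃ - s₁ ^ 2 / s₃) * y ≠ s₁ * √(1 - (s₁ / s₃) ^ 2) * z) :
    ((gaussianChannel s₃).withNoise (gaussianReal 0 1)).meanGap (gaussianChannel s₁)
      (degrade s₁ s₃) (y, z) ≠ 0 := by
  refine fun gap_eq_zero ↦ h ?_
  have density_eq :
      gaussianDensity s₃ true y = gaussianDensity s₁ true (degrade s₁ s₃ (y, z)) :=
    sub_left_injective <| sub_eq_zero.1 <| (div_eq_zero_iff.1 gap_eq_zero).resolve_right two_ne_zero
  have := Real.sigmoid_injective (mul_left_cancel₀ two_ne_zero density_eq)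
  simp only [bpsk, if_true, degrade] at this
  linear_combination this / 2

variable {s₁ s₃ : ℝ} (h₁ : 0 ≤ s₁) (h₁₃ : s₁ < s₃)
include h₁ h₁₃

theorem isDegradation_degrade :
    ((gaussianChannel s₃).withNoise (gaussianReal 0 1)).IsDegradation (gaussianChannel s₁)
      (degrade s₁ s₃) where
  measurable := measurable_degrade s₁ s₃
  map_law b := by
    have h₃ : 0 < s₃ := h₁.trans_lt h₁₃
    have ratio_sq_le : (s₁ / s₃) ^ 2 ≤ 1 :=
      pow_le_one₀ (div_nonneg h₁ h₃.le) ((div_le_one h₃).2 h₁₃.le)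
    refine (gaussianReal_prod_map_const_mul_add _ _).trans ?_
    change _ = gaussianReal (s₁ * bpsk b) 1
    congr 1
    · field_simp
      ring
    · ext
      simp [Real.sq_sqrt (sub_nonneg.2 ratio_sq_le)]

theorem symmetricInfo_gaussianChannel_le :
    (gaussianChannel s₁).symmetricInfo ≤ (gaussianChannel s₃).symmetricInfo := by
  have := (isDegradation_degrade h₁ h₁₃).symmetricInfo_le
  rwa [BinaryInputChannel.symmetricInfo_withNoise] at this

theorem power_gaussianChannel_lt :
    (gaussianChannel s₁).power < (gaussianChannel s₃).power := by
  have h₃ : 0 < s₃ := h₁.trans_lt h₁₃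
  have degraded := isDegradation_degrade h₁ h₁₃
  set W := (gaussianChannel s₃).withNoise (gaussianReal 0 1)
  have difference := degraded.power_sub_power
  rw [BinaryInputChannel.power_withNoise] at difference
  by_contra! power_le
  have gap_eq_zero : ∀ᵐ u ∂(gaussianMixture s₃).prod (gaussianReal 0 1),
      W.meanGap (gaussianChannel s₁) (degrade s₁ s₃) u ^ 2 = 0 := by
    have integrable : Integrable (fun u ↦ W.meanGap (gaussianChannel s₁) (degrade s₁ s₃) u ^ 2)
        W.mix := by
      simp only [sq]
      exact (degraded.integrable_meanGap _).bdd_mul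
        (W.measurable_meanGap _ degraded.measurable).aestronglyMeasurable
        (ae_of_all _ (W.abs_meanGap_le_one _ _))
    refine (integral_eq_zero_iff_of_nonneg (fun u ↦ sq_nonneg (W.meanGap _ _ u)) integrable).1 ?_
    have : 0 ≤ ∫ u, W.meanGap (gaussianChannel s₁) (degrade s₁ s₃) u ^ 2 ∂W.mix :=
      integral_nonneg fun u ↦ sq_nonneg _
    linarith
  have line_null : ∀ᵐ u ∂(gaussianMixture s₃).prod (gaussianReal 0 1),
      (s₃ - s₁ ^ 2 / s₃) * u.1 ≠ s₁ * √(1 - (s₁ / s₃) ^ 2) * u.2 := by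
    have slope_pos : 0 < s₃ - s₁ ^ 2 / s₃ := by
      rw [sub_pos, div_lt_iff₀ h₃]
      nlinarith
    have measurableSet_ne : MeasurableSet {u : ℝ × ℝ |
        (s₃ - s₁ ^ 2 / s₃) * u.1 ≠ s₁ * √(1 - (s₁ / s₃) ^ 2) * u.2} :=
      (measurableSet_eq_fun (by fun_prop) (by fun_prop)).compl
    refine (Measure.ae_prod_iff_ae_ae measurableSet_ne).2
      ((Measure.ae_ae_comm measurableSet_ne).2 (ae_of_all _ fun z ↦ ?_))
    filter_upwards [(withDensity_absolutelyContinuous _ _).ae_le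
      (Measure.ae_ne volume (s₁ * √(1 - (s₁ / s₃) ^ 2) * z / (s₃ - s₁ ^ 2 / s₃)))] with y hy
    exact fun on_line ↦ hy ((eq_div_iff slope_pos.ne').2 (by rw [mul_comm, on_line]))
  obtain ⟨u, gap_u, line_u⟩ := (gap_eq_zero.and line_null).exists
  exact meanGap_degrade_ne_zero line_u (pow_eq_zero_iff two_ne_zero |>.1 gap_u)

end GaussianDegradation

section GaussianContinuity

theorem binEntropy_gaussianDensity_le (s y : ℝ) :
    ‖Real.binEntropy (gaussianDensity s true y / 2)‖ ≤ Real.log 2 := by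
  have density_pos : 0 < gaussianDensity s true y := (gaussianChannel s).density_pos true y
  have density_le_two : gaussianDensity s true y ≤ 2 := (gaussianChannel s).density_le_two true y
  rw [Real.norm_of_nonneg (Real.binEntropy_nonneg (by linarith) (by linarith))]
  exact Real.binEntropy_le_log_two

theorem continuous_binEntropy_gaussianDensity :
    Continuous fun p : ℝ × ℝ ↦ Real.binEntropy (gaussianDensity p.1 true p.2 / 2) :=
  Real.binEntropy_continuous.comp ((continuous_gaussianDensity true).div_const 2)

theorem continuous_symmetricInfo_gaussianChannel :
    Continuous fun s ↦ (gaussianChannel s).symmetricInfo := by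
  simp only [gaussianChannel.symmetricInfo_eq]
  have jointly : Continuous fun p : ℝ × ℝ ↦
      Real.binEntropy (gaussianDensity p.1 true (p.1 + p.2) / 2) :=
    continuous_binEntropy_gaussianDensity.comp (f := fun p : ℝ × ℝ ↦ (p.1, p.1 + p.2))
      (by fun_prop)
  exact continuous_const.sub <| continuous_of_dominated
    (fun s ↦ (jointly.comp (Continuous.prodMk_right s)).aestronglyMeasurable)
    (fun s ↦ ae_of_all _ fun z ↦ binEntropy_gaussianDensity_le s (s + z)) (integrable_const _)
    (ae_of_all _ fun z ↦ jointly.comp (Continuous.prodMk_left z))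

theorem tendsto_symmetricInfo_gaussianChannel :
    Tendsto (fun s ↦ (gaussianChannel s).symmetricInfo) atTop (𝓝 (Real.log 2)) := by
  have pointwise (z : ℝ) : Tendsto
      (fun s ↦ Real.binEntropy (gaussianDensity s true (s + z) / 2)) atTop (𝓝 0) := by
    have exponent : Tendsto (fun s : ℝ ↦ 2 * s * bpsk true * (s + z)) atTop atTop := by
      simp only [bpsk, if_true, mul_one]
      exact (tendsto_id.const_mul_atTop two_pos).atTop_mul_atTop₀
        (tendsto_atTop_add_const_right _ z tendsto_id)
    rw [← Real.binEntropy_one]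
    simp only [gaussianDensity, mul_div_cancel_left₀ _ (two_ne_zero (α := ℝ))]
    exact (Real.binEntropy_continuous.tendsto 1).comp (Real.tendsto_sigmoid_atTop.comp exponent)
  have entropy := tendsto_integral_filter_of_dominated_convergence (μ := gaussianReal 0 1) _
    (Eventually.of_forall fun s ↦ ((continuous_binEntropy_gaussianDensity.comp
      (f := fun z ↦ (s, s + z)) (by fun_prop)).aestronglyMeasurable))
    (Eventually.of_forall fun s ↦ ae_of_all _ fun z ↦ binEntropy_gaussianDensity_le s (s + z))
    (integrable_const _) (ae_of_all _ pointwise)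
  simpa [gaussianChannel.symmetricInfo_eq] using entropy.const_sub (Real.log 2)

end GaussianContinuity

section BitEntropy

/-- The probability of the bit `b` under the law on `Bool` for which the symbol has mean `m`. -/
noncomputable def bitProb (m : ℝ) (b : Bool) : ℝ := (1 + bpsk b * m) / 2

/-- The entropy, in nats, of a bit whose symbol has mean `m`. -/
noncomputable def bitEntropy (m : ℝ) : ℝ := Real.binEntropy ((1 + m) / 2)

theorem bitProb_bpsk (b c : Bool) : bitProb (bpsk c) b = if c = b then 1 else 0 := by
  cases b <;> cases c <;> norm_num [bitProb, bpsk]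

theorem bitProb_nonneg {m : ℝ} (hm : |m| ≤ 1) (b : Bool) : 0 ≤ bitProb m b := by
  have := abs_le.1 hm
  cases b <;> norm_num [bitProb, bpsk] <;> linarith

theorem bitProb_le_one {m : ℝ} (hm : |m| ≤ 1) (b : Bool) : bitProb m b ≤ 1 := by
  have := abs_le.1 hm
  cases b <;> norm_num [bitProb, bpsk] <;> linarith

theorem abs_bitProb_le_one {m : ℝ} (hm : |m| ≤ 1) (b : Bool) : |bitProb m b| ≤ 1 :=
  (abs_of_nonneg (bitProb_nonneg hm b)).trans_le (bitProb_le_one hm b)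

theorem continuous_bitProb (b : Bool) : Continuous fun m ↦ bitProb m b := by
  unfold bitProb
  fun_prop

theorem continuous_bitEntropy : Continuous bitEntropy :=
  Real.binEntropy_continuous.comp (by fun_prop)

theorem bitEntropy_eq_sum_negMulLog (m : ℝ) :
    bitEntropy m = ∑ b, Real.negMulLog (bitProb m b) := by
  rw [bitEntropy, Real.binEntropy_eq_negMulLog_add_negMulLog_one_sub, Fintype.sum_bool]
  congr 2 <;> simp only [bitProb, bpsk, if_true, Bool.false_eq_true, if_false] <;> ring

theorem bitEntropy_nonneg {m : ℝ} (hm : |m| ≤ 1) : 0 ≤ bitEntropy m := by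
  have := abs_le.1 hm
  exact Real.binEntropy_nonneg (by linarith) (by linarith)

theorem bitEntropy_le_log_two (m : ℝ) : bitEntropy m ≤ Real.log 2 := Real.binEntropy_le_log_two

theorem abs_bitEntropy_le {m : ℝ} (hm : |m| ≤ 1) : |bitEntropy m| ≤ Real.log 2 :=
  (abs_of_nonneg (bitEntropy_nonneg hm)).trans_le (bitEntropy_le_log_two m)

theorem negMulLog_half_add_ge {t : ℝ} (ht : -1 ≤ t) :
    (1 + t) / 2 * (Real.log 2 - t) ≤ Real.negMulLog ((1 + t) / 2) := by
  rcases ht.eq_or_lt with rfl | ht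
  · norm_num
  · rw [Real.negMulLog, neg_mul, ← mul_neg, Real.log_div (by linarith) two_ne_zero]
    have := Real.log_le_sub_one_of_pos (x := 1 + t) (by linarith)
    exact mul_le_mul_of_nonneg_left (by linarith) (by linarith)

theorem log_two_sub_sq_le_bitEntropy {m : ℝ} (hm : |m| ≤ 1) :
    Real.log 2 - m ^ 2 ≤ bitEntropy m := by
  obtain ⟨neg_one_le, le_one⟩ := abs_le.1 hm
  have true_ge := negMulLog_half_add_ge neg_one_le
  have false_ge := negMulLog_half_add_ge (neg_le_neg le_one)
  rw [bitEntropy_eq_sum_negMulLog, Fintype.sum_bool]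
  simp only [bitProb, bpsk, if_true, Bool.false_eq_true, if_false, one_mul, neg_one_mul]
  linarith

theorem negMulLog_le_two_mul_sqrt {p : ℝ} (hp : 0 ≤ p) :
    Real.negMulLog p ≤ 2 * (√p - p) := by
  rcases hp.eq_or_lt with rfl | hp
  · simp
  · have log_ge := Real.one_sub_inv_le_log_of_pos (Real.sqrt_pos.2 hp)
    rw [Real.log_sqrt hp.le] at log_ge
    have : p * (√p)⁻¹ = √p := by
      rw [← div_eq_mul_inv, Real.div_sqrt]
    rw [Real.negMulLog]
    nlinarith [mul_le_mul_of_nonneg_left log_ge hp.le]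

theorem bitEntropy_le_two_mul_sqrt {m : ℝ} (hm : |m| ≤ 1) :
    bitEntropy m ≤ 2 * √(1 - m ^ 2) := by
  have true_nonneg := bitProb_nonneg hm true
  have false_nonneg := bitProb_nonneg hm false
  have sum_eq_one : bitProb m true + bitProb m false = 1 := by
    simp only [bitProb, bpsk, if_true, Bool.false_eq_true, if_false]
    ring
  have sum_sqrt_le : √(bitProb m true) + √(bitProb m false) ≤ 1 + √(1 - m ^ 2) := by
    have root_eq : √(1 - m ^ 2) = 2 * (√(bitProb m true) * √(bitProb m false)) := by
      rw [← Real.sqrt_mul true_nonneg, show 1 - m ^ 2 = 2 ^ 2 * (bitProb m true * bitProb m false)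
        by simp only [bitProb, bpsk, if_true, Bool.false_eq_true, if_false]; ring,
        Real.sqrt_mul (by norm_num), Real.sqrt_sq two_pos.le]
    refine abs_le_of_sq_le_sq' ?_ (by positivity) |>.2
    nlinarith [Real.sq_sqrt true_nonneg, Real.sq_sqrt false_nonneg, Real.sqrt_nonneg (1 - m ^ 2)]
  calc bitEntropy m
      ≤ 2 * (√(bitProb m true) - bitProb m true) + 2 * (√(bitProb m false) - bitProb m false) := by
        rw [bitEntropy_eq_sum_negMulLog, Fintype.sum_bool]
        exact add_le_add (negMulLog_le_two_mul_sqrt true_nonneg)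
          (negMulLog_le_two_mul_sqrt false_nonneg)
    _ ≤ 2 * √(1 - m ^ 2) := by linarith

end BitEntropy

section PosteriorMean

open InformationTheory

variable {Ω β : Type*} [MeasurableSpace Ω] [MeasurableSpace β]

theorem integrable_continuous_comp_of_abs_le {μ : Measure Ω} [IsFiniteMeasure μ] {g : ℝ → ℝ}
    (hg : Continuous g) {f : Ω → ℝ} (hf : Measurable f) {K : ℝ} (hK : ∀ ω, |f ω| ≤ K) :
    Integrable (fun ω ↦ g (f ω)) μ := by
  obtain ⟨L, hL⟩ := (isCompact_Icc (a := -K) (b := K)).exists_bound_of_continuousOn hg.continuousOn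
  exact integrable_of_abs_le (hg.measurable.comp hf) fun ω ↦ hL _ (abs_le.1 (hK ω))

theorem measure_ext_of_singleton_prod {α : Type*} [MeasurableSpace α] [Countable α]
    [MeasurableSingletonClass α] {μ ν : Measure (α × β)}
    (h : ∀ a, ∀ B, MeasurableSet B → μ ({a} ×ˢ B) = ν ({a} ×ˢ B)) : μ = ν := by
  ext S hS
  have slices : S = ⋃ a, {a} ×ˢ (Prod.mk a ⁻¹' S) := by ext ⟨a, y⟩; simp
  have slices_disjoint : Pairwise fun a a' : α ↦
      Disjoint ({a} ×ˢ (Prod.mk a ⁻¹' S)) ({a'} ×ˢ (Prod.mk a' ⁻¹' S)) := fun a a' haa' ↦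
    Set.disjoint_prod.2 (Or.inl (Set.disjoint_singleton.2 haa'))
  have slices_measurable (a : α) : MeasurableSet (Prod.mk a ⁻¹' S) := measurable_prodMk_left hS
  rw [slices, measure_iUnion slices_disjoint fun a ↦
      (measurableSet_singleton a).prod (slices_measurable a),
    measure_iUnion slices_disjoint fun a ↦ (measurableSet_singleton a).prod (slices_measurable a)]
  exact tsum_congr fun a ↦ h a _ (slices_measurable a)

theorem integral_bitProb {μ : Measure Ω} [IsFiniteMeasure μ] {f : Ω → ℝ} (hf : Integrable f μ)
    (b : Bool) : ∫ ω, bitProb (f ω) b ∂μ = (μ.real Set.univ + bpsk b * ∫ ω, f ω ∂μ) / 2 := by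
  simp only [bitProb]
  rw [integral_div, integral_add (integrable_const _) (hf.const_mul _), integral_const,
    integral_const_mul, smul_eq_mul, mul_one]

theorem mul_klFun_div {p q : ℝ} (hpq : q = 0 → p = 0) :
    q * klFun (p / q) = q - (1 + Real.log q) * p - Real.negMulLog p := by
  rw [klFun_apply, Real.negMulLog]
  by_cases hp : p = 0
  · simp [hp]
  · have hq : q ≠ 0 := fun hq ↦ hp (hpq hq)
    rw [Real.log_div hp hq]
    field_simp
    ring

/-- `e (Y)` is the conditional mean, given the observation `Y`, of the symbol of the bit `X`.
The bound on `e` is required everywhere, not only almost everywhere. -/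
structure IsPosteriorMean (μ : Measure Ω) (X : Ω → Bool) (Y : Ω → β) (e : β → ℝ) : Prop where
  measurable_bit : Measurable X
  measurable_observation : Measurable Y
  measurable_mean : Measurable e
  abs_le_one : ∀ y, |e y| ≤ 1
  setIntegral_bpsk : ∀ B, MeasurableSet B →
    ∫ ω in Y ⁻¹' B, bpsk (X ω) ∂μ = ∫ ω in Y ⁻¹' B, e (Y ω) ∂μ

namespace IsPosteriorMean

variable {μ : Measure Ω} {X : Ω → Bool} {Y : Ω → β} {e : β → ℝ}

theorem measurable_comp (h : IsPosteriorMean μ X Y e) : Measurable fun ω ↦ e (Y ω) :=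
  h.measurable_mean.comp h.measurable_observation

theorem measurable_bpsk (h : IsPosteriorMean μ X Y e) : Measurable fun ω ↦ bpsk (X ω) :=
  (measurable_of_countable bpsk).comp h.measurable_bit

theorem integrable_continuous_comp [IsFiniteMeasure μ] (h : IsPosteriorMean μ X Y e) {g : ℝ → ℝ}
    (hg : Continuous g) : Integrable (fun ω ↦ g (e (Y ω))) μ :=
  integrable_continuous_comp_of_abs_le hg h.measurable_comp fun ω ↦ h.abs_le_one (Y ω)

theorem integrable_comp [IsFiniteMeasure μ] (h : IsPosteriorMean μ X Y e) :
    Integrable (fun ω ↦ e (Y ω)) μ :=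
  h.integrable_continuous_comp continuous_id

theorem integrable_negMulLog_bitProb [IsFiniteMeasure μ] (h : IsPosteriorMean μ X Y e) (b : Bool) :
    Integrable (fun ω ↦ Real.negMulLog (bitProb (e (Y ω)) b)) μ :=
  h.integrable_continuous_comp (Real.continuous_negMulLog.comp (continuous_bitProb b))

theorem integrable_bpsk [IsFiniteMeasure μ] (h : IsPosteriorMean μ X Y e) :
    Integrable (fun ω ↦ bpsk (X ω)) μ :=
  integrable_of_abs_le h.measurable_bpsk fun ω ↦ (abs_bpsk (X ω)).le

theorem of_ae_eq {γ : Type*} [MeasurableSpace γ] (h : IsPosteriorMean μ X Y e) {T : β → γ}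
    (hT : Measurable T) {Z : Ω → γ} (hZ : Measurable Z) (hZT : Z =ᵐ[μ] T ∘ Y) {m : γ → ℝ}
    (hm : Measurable m) (hm1 : ∀ z, |m z| ≤ 1) (hmT : ∀ y, m (T y) = e y) :
    IsPosteriorMean μ X Z m where
  measurable_bit := h.measurable_bit
  measurable_observation := hZ
  measurable_mean := hm
  abs_le_one := hm1
  setIntegral_bpsk B hB := by
    have same_event : Z ⁻¹' B =ᵐ[μ] Y ⁻¹' (T ⁻¹' B) := hZT.mono fun ω hω ↦
      congrArg (· ∈ B) hω |>.trans rfl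
    rw [setIntegral_congr_set same_event, setIntegral_congr_set same_event,
      h.setIntegral_bpsk _ (hT hB)]
    refine integral_congr_ae (ae_restrict_of_ae ?_)
    filter_upwards [hZT] with ω hω
    rw [hω, Function.comp_apply, hmT]

/-- The density of the joint law of a bit and an observation with respect to the product of the
marginal laws, if `m` is the mean of the symbol and `e` its conditional mean. -/
noncomputable def jointDensity (m : ℝ) (e : β → ℝ) (z : Bool × β) : ℝ :=
  bitProb (e z.2) z.1 / bitProb m z.1

theorem measurable_jointDensity (h : IsPosteriorMean μ X Y e) (m : ℝ) :
    Measurable (jointDensity m e) :=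
  measurable_from_prod_countable_right fun b ↦ by
    change Measurable fun y ↦ bitProb (e y) b / bitProb m b
    exact ((continuous_bitProb b).measurable.comp h.measurable_mean).div_const _

theorem integrable_klFun_jointDensity (h : IsPosteriorMean μ X Y e) (m : ℝ)
    (ν : Measure (Bool × β)) [IsFiniteMeasure ν] :
    Integrable (fun z ↦ klFun (jointDensity m e z)) ν := by
  refine integrable_continuous_comp_of_abs_le continuous_klFun (h.measurable_jointDensity m)
    (K := ∑ b, |(bitProb m b)⁻¹|) fun z ↦ ?_
  rw [jointDensity, div_eq_mul_inv, abs_mul]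
  exact (mul_le_of_le_one_left (abs_nonneg _) (abs_bitProb_le_one (h.abs_le_one _) _)).trans
    (Finset.single_le_sum (f := fun b ↦ |(bitProb m b)⁻¹|) (fun b _ ↦ abs_nonneg _)
      (Finset.mem_univ z.1))

variable [IsProbabilityMeasure μ]

theorem setIntegral_bitProb (h : IsPosteriorMean μ X Y e) (b : Bool) {B : Set β}
    (hB : MeasurableSet B) :
    ∫ ω in Y ⁻¹' B, bitProb (e (Y ω)) b ∂μ = μ.real (X ⁻¹' {b} ∩ Y ⁻¹' B) := by
  have bit_measurable : MeasurableSet (X ⁻¹' {b}) := h.measurable_bit (measurableSet_singleton b)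
  rw [integral_bitProb h.integrable_comp.integrableOn,
    ← h.setIntegral_bpsk B hB, ← integral_bitProb h.integrable_bpsk.integrableOn,
    ← measureReal_restrict_apply bit_measurable, ← integral_indicator_one bit_measurable]
  refine integral_congr_ae (ae_of_all _ fun ω ↦ ?_)
  by_cases hω : X ω = b <;> simp [bitProb_bpsk, hω]

theorem integral_bitProb_comp (h : IsPosteriorMean μ X Y e) (b : Bool) :
    ∫ ω, bitProb (e (Y ω)) b ∂μ = bitProb (∫ ω, e (Y ω) ∂μ) b := by
  rw [integral_bitProb h.integrable_comp, probReal_univ, bitProb]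

theorem real_preimage (h : IsPosteriorMean μ X Y e) (b : Bool) :
    μ.real (X ⁻¹' {b}) = bitProb (∫ ω, e (Y ω) ∂μ) b := by
  rw [← h.integral_bitProb_comp]
  simpa using (h.setIntegral_bitProb b MeasurableSet.univ).symm

theorem abs_integral_le_one (h : IsPosteriorMean μ X Y e) : |∫ ω, e (Y ω) ∂μ| ≤ 1 := by
  simpa using norm_integral_le_of_norm_le_const (μ := μ) (f := fun ω ↦ e (Y ω))
    (ae_of_all μ fun ω ↦ h.abs_le_one (Y ω))

theorem condExp_bit_ae_eq (h : IsPosteriorMean μ X Y e) (b : Bool) :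
    μ⟦X ⁻¹' {b}|MeasurableSpace.comap Y inferInstance⟧ =ᵐ[μ] fun ω ↦ bitProb (e (Y ω)) b := by
  have bit_measurable : MeasurableSet (X ⁻¹' {b}) := h.measurable_bit (measurableSet_singleton b)
  have prob_integrable : Integrable (fun ω ↦ bitProb (e (Y ω)) b) μ :=
    h.integrable_continuous_comp (continuous_bitProb b)
  refine (ae_eq_condExp_of_forall_setIntegral_eq h.measurable_observation.comap_le
    ((integrable_const _).indicator bit_measurable) (fun _ _ _ ↦ prob_integrable.integrableOn)
    ?_ ?_).symm
  · rintro _ ⟨B, hB, rfl⟩ -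
    rw [h.setIntegral_bitProb b hB, integral_indicator_const _ bit_measurable, smul_eq_mul,
      mul_one, measureReal_restrict_apply bit_measurable]
  · exact (((continuous_bitProb b).measurable.comp h.measurable_mean).comp
      (comap_measurable Y)).stronglyMeasurable.aestronglyMeasurable

theorem jointDensity_nonneg (h : IsPosteriorMean μ X Y e) (z : Bool × β) :
    0 ≤ jointDensity (∫ ω, e (Y ω) ∂μ) e z :=
  div_nonneg (bitProb_nonneg (h.abs_le_one _) _) (bitProb_nonneg h.abs_integral_le_one _)

theorem bitProb_eq_zero_of_prior_eq_zero (h : IsPosteriorMean μ X Y e) {b : Bool}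
    (hb : bitProb (∫ ω, e (Y ω) ∂μ) b = 0) : ∀ᵐ ω ∂μ, bitProb (e (Y ω)) b = 0 :=
  (integral_eq_zero_iff_of_nonneg (fun ω ↦ bitProb_nonneg (h.abs_le_one (Y ω)) b)
    (h.integrable_continuous_comp (continuous_bitProb b))).1 (h.integral_bitProb_comp b ▸ hb)

theorem prior_mul_jointDensity (h : IsPosteriorMean μ X Y e) (b : Bool) : ∀ᵐ ω ∂μ,
    bitProb (∫ ω', e (Y ω') ∂μ) b * jointDensity (∫ ω', e (Y ω') ∂μ) e (b, Y ω)
      = bitProb (e (Y ω)) b := by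
  by_cases hb : bitProb (∫ ω', e (Y ω') ∂μ) b = 0
  · filter_upwards [h.bitProb_eq_zero_of_prior_eq_zero hb] with ω hω
    rw [hb, hω, zero_mul]
  · exact ae_of_all _ fun ω ↦ mul_div_cancel₀ _ hb

theorem map_prodMk_eq_withDensity (h : IsPosteriorMean μ X Y e) :
    μ.map (fun ω ↦ (X ω, Y ω)) = ((μ.map X).prod (μ.map Y)).withDensity
      fun z ↦ ENNReal.ofReal (jointDensity (∫ ω, e (Y ω) ∂μ) e z) := by
  have hX := h.measurable_bit
  have hY := h.measurable_observation
  have density_measurable := h.measurable_jointDensity (∫ ω, e (Y ω) ∂μ)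
  have slice_measurable (b : Bool) : Measurable fun y ↦
      ENNReal.ofReal (jointDensity (∫ ω, e (Y ω) ∂μ) e (b, y)) :=
    (density_measurable.comp measurable_prodMk_left).ennreal_ofReal
  have := Measure.isProbabilityMeasure_map (μ := μ) hX.aemeasurable
  have := Measure.isProbabilityMeasure_map (μ := μ) hY.aemeasurable
  refine measure_ext_of_singleton_prod fun b B hB ↦ ?_
  have rectangle := (measurableSet_singleton b).prod hB
  have prior : (μ.map X) {b} = ENNReal.ofReal (bitProb (∫ ω, e (Y ω) ∂μ) b) := by
    rw [Measure.map_apply hX (measurableSet_singleton b), ← h.real_preimage, ofReal_measureReal]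
  rw [Measure.map_apply (hX.prodMk hY) rectangle, withDensity_apply _ rectangle,
    setLIntegral_prod _ density_measurable.ennreal_ofReal.aemeasurable, Measure.restrict_singleton,
    lintegral_smul_measure, lintegral_dirac, prior, smul_eq_mul,
    setLIntegral_map hB (slice_measurable b) hY,
    ← lintegral_const_mul' _ _ ENNReal.ofReal_ne_top, Set.mk_preimage_prod, ← ofReal_measureReal,
    ← h.setIntegral_bitProb b hB, ofReal_integral_eq_lintegral_ofReal
      (h.integrable_continuous_comp (continuous_bitProb b)).integrableOn
      (ae_of_all _ fun ω ↦ bitProb_nonneg (h.abs_le_one (Y ω)) b)]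
  refine lintegral_congr_ae (ae_restrict_of_ae ?_)
  filter_upwards [h.prior_mul_jointDensity b] with ω hω
  rw [← ENNReal.ofReal_mul (bitProb_nonneg h.abs_integral_le_one b), hω]

theorem toReal_klDiv_eq_integral_klFun_jointDensity (h : IsPosteriorMean μ X Y e) :
    (klDiv (μ.map fun ω ↦ (X ω, Y ω)) ((μ.map X).prod (μ.map Y))).toReal
      = ∫ z, klFun (jointDensity (∫ ω, e (Y ω) ∂μ) e z) ∂(μ.map X).prod (μ.map Y) := by
  have hX := h.measurable_bit
  have hY := h.measurable_observation
  have := Measure.isProbabilityMeasure_map (μ := μ) hX.aemeasurable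
  have := Measure.isProbabilityMeasure_map (μ := μ) hY.aemeasurable
  have := Measure.isProbabilityMeasure_map (μ := μ) (hX.prodMk hY).aemeasurable
  rw [toReal_klDiv_eq_integral_klFun
    (h.map_prodMk_eq_withDensity ▸ withDensity_absolutelyContinuous _ _),
    h.map_prodMk_eq_withDensity]
  refine integral_congr_ae ?_
  filter_upwards [Measure.rnDeriv_withDensity ((μ.map X).prod (μ.map Y))
    (h.measurable_jointDensity _).ennreal_ofReal] with z hz
  rw [hz, ENNReal.toReal_ofReal (h.jointDensity_nonneg z)]

theorem prior_mul_integral_klFun_jointDensity (h : IsPosteriorMean μ X Y e) (b : Bool) :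
    bitProb (∫ ω, e (Y ω) ∂μ) b
        * ∫ ω, klFun (jointDensity (∫ ω', e (Y ω') ∂μ) e (b, Y ω)) ∂μ
      = Real.negMulLog (bitProb (∫ ω, e (Y ω) ∂μ) b)
        - ∫ ω, Real.negMulLog (bitProb (e (Y ω)) b) ∂μ := by
  have linear_integrable : Integrable
      (fun ω ↦ (1 + Real.log (bitProb (∫ ω', e (Y ω') ∂μ) b)) * bitProb (e (Y ω)) b) μ :=
    (h.integrable_continuous_comp (continuous_bitProb b)).const_mul _
  have pointwise : ∀ᵐ ω ∂μ, bitProb (∫ ω', e (Y ω') ∂μ) b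
        * klFun (jointDensity (∫ ω', e (Y ω') ∂μ) e (b, Y ω))
      = bitProb (∫ ω', e (Y ω') ∂μ) b
        - (1 + Real.log (bitProb (∫ ω', e (Y ω') ∂μ) b)) * bitProb (e (Y ω)) b
        - Real.negMulLog (bitProb (e (Y ω)) b) := by
    filter_upwards [h.prior_mul_jointDensity b] with ω hω
    exact mul_klFun_div fun prior_eq_zero ↦ by rw [← hω, prior_eq_zero, zero_mul]
  rw [← integral_const_mul, integral_congr_ae pointwise,
    integral_sub ((integrable_const _).sub' linear_integrable) (h.integrable_negMulLog_bitProb b),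
    integral_sub (integrable_const _) linear_integrable, integral_const, probReal_univ, one_smul,
    integral_const_mul, h.integral_bitProb_comp, Real.negMulLog]
  ring

theorem mutualInfoBits_eq (h : IsPosteriorMean μ X Y e) : mutualInfoBits μ X Y
    = (bitEntropy (∫ ω, e (Y ω) ∂μ) - ∫ ω, bitEntropy (e (Y ω)) ∂μ) / Real.log 2 := by
  have hX := h.measurable_bit
  have hY := h.measurable_observation
  have := Measure.isProbabilityMeasure_map (μ := μ) hX.aemeasurable
  have := Measure.isProbabilityMeasure_map (μ := μ) hY.aemeasurable
  have slice_measurable (b : Bool) : Measurable fun y ↦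
      klFun (jointDensity (∫ ω, e (Y ω) ∂μ) e (b, y)) :=
    measurable_klFun.comp ((h.measurable_jointDensity _).comp measurable_prodMk_left)
  have slice (b : Bool) : (μ.map X).real {b}
        • ∫ y, klFun (jointDensity (∫ ω, e (Y ω) ∂μ) e (b, y)) ∂μ.map Y
      = Real.negMulLog (bitProb (∫ ω, e (Y ω) ∂μ) b)
        - ∫ ω, Real.negMulLog (bitProb (e (Y ω)) b) ∂μ := by
    rw [map_measureReal_apply hX (measurableSet_singleton b), h.real_preimage, smul_eq_mul,
      integral_map hY.aemeasurable (slice_measurable b).aestronglyMeasurable,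
      h.prior_mul_integral_klFun_jointDensity]
  rw [mutualInfoBits, h.toReal_klDiv_eq_integral_klFun_jointDensity,
    integral_prod _ (h.integrable_klFun_jointDensity _ _), integral_fintype Integrable.of_finite,
    Finset.sum_congr rfl fun b _ ↦ slice b, Finset.sum_sub_distrib,
    ← bitEntropy_eq_sum_negMulLog, ← integral_finsetSum _ fun b _ ↦
      h.integrable_negMulLog_bitProb b]
  simp only [bitEntropy_eq_sum_negMulLog]

end IsPosteriorMean

end PosteriorMean

section UniformInput

variable {α β Ω : Type*} [MeasurableSpace α] [MeasurableSingletonClass α] [Finite α]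
  [MeasurableSpace β] [MeasurableSpace Ω]

theorem integral_uniformOn (C : Finset α) (f : α → ℝ) :
    ∫ x, f x ∂uniformOn (C : Set α) = 𝔼 x ∈ C, f x := by
  classical
  have := Fintype.ofFinite α
  have weight (x : α) :
      (uniformOn (C : Set α)).real {x} = if x ∈ C then (C.card : ℝ)⁻¹ else 0 := by
    have h := uniformOn_apply_finset (Ω := α) (s := C) (t := {x})
    rw [Finset.coe_singleton] at h
    rw [measureReal_def, h]
    split_ifs with hx
    · simp [Finset.inter_singleton_of_mem hx]
    · simp [Finset.inter_singleton_of_notMem hx]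
  simp only [integral_fintype Integrable.of_finite, weight, smul_eq_mul, ite_mul, zero_mul]
  rw [Finset.sum_ite_mem, Finset.univ_inter, ← Finset.mul_sum, Finset.expect_eq_sum_div_card,
    div_eq_inv_mul]

variable {ν : Measure Ω} [IsProbabilityMeasure ν] {P : α → Measure β} {φ : α → Ω → β}

theorem measurable_comp_fst_snd (hφ : ∀ x, Measurable (φ x)) :
    Measurable fun ω : α × Ω ↦ φ ω.1 ω.2 :=
  measurable_from_prod_countable_right hφ

theorem integral_uniformOn_prod_comp (C : Finset α) (hφ : ∀ x, MeasurePreserving (φ x) ν (P x))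
    {F : α → β → ℝ} (hF : ∀ x, Measurable (F x)) {K : ℝ} (hK : ∀ x y, |F x y| ≤ K) :
    ∫ ω, F ω.1 (φ ω.1 ω.2) ∂(uniformOn (C : Set α)).prod ν = 𝔼 x ∈ C, ∫ y, F x y ∂P x := by
  have integrable : Integrable (fun ω ↦ F ω.1 (φ ω.1 ω.2)) ((uniformOn (C : Set α)).prod ν) :=
    integrable_of_abs_le (measurable_comp_fst_snd fun x ↦ (hF x).comp (hφ x).measurable)
      fun ω ↦ hK _ _
  rw [integral_prod _ integrable, integral_uniformOn]
  exact Finset.expect_congr rfl fun x _ ↦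
    integral_comp_of_measurePreserving (hφ x) (hF x).aestronglyMeasurable

theorem isPosteriorMean_uniformOn_prod {γ : Type*} [MeasurableSpace γ] {C : Finset α}
    (hφ : ∀ x, MeasurePreserving (φ x) ν (P x)) (X : α → Bool) {T : β → γ} (hT : Measurable T)
    {e : γ → ℝ} (he : Measurable e) (he1 : ∀ z, |e z| ≤ 1)
    (orthogonal : ∀ f : γ → ℝ, Measurable f → (∀ z, |f z| ≤ 1) →
      𝔼 x ∈ C, bpsk (X x) * ∫ y, f (T y) ∂P x = 𝔼 x ∈ C, ∫ y, e (T y) * f (T y) ∂P x) :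
    IsPosteriorMean ((uniformOn (C : Set α)).prod ν) (fun ω ↦ X ω.1)
      (fun ω ↦ T (φ ω.1 ω.2)) e where
  measurable_bit := (measurable_of_countable X).comp measurable_fst
  measurable_observation := hT.comp (measurable_comp_fst_snd fun x ↦ (hφ x).measurable)
  measurable_mean := he
  abs_le_one := he1
  setIntegral_bpsk B hB := by
    have indicator_measurable : Measurable (B.indicator (1 : γ → ℝ)) :=
      measurable_one.indicator hB
    have indicator_bound (z : γ) : |B.indicator (1 : γ → ℝ) z| ≤ 1 := by
      by_cases hz : z ∈ B <;> simp [hz]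
    have event_measurable : MeasurableSet ((fun ω : α × Ω ↦ T (φ ω.1 ω.2)) ⁻¹' B) :=
      hT.comp (measurable_comp_fst_snd fun x ↦ (hφ x).measurable) hB
    have setIntegral_eq (g : α × Ω → ℝ) :
        ∫ ω in (fun ω ↦ T (φ ω.1 ω.2)) ⁻¹' B, g ω ∂(uniformOn (C : Set α)).prod ν
          = ∫ ω, g ω * B.indicator 1 (T (φ ω.1 ω.2)) ∂(uniformOn (C : Set α)).prod ν := by
      rw [← integral_indicator event_measurable]
      refine integral_congr_ae (ae_of_all _ fun ω ↦ ?_)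
      by_cases hω : T (φ ω.1 ω.2) ∈ B <;> simp [hω]
    rw [setIntegral_eq, setIntegral_eq, integral_uniformOn_prod_comp C hφ
      (F := fun x y ↦ bpsk (X x) * B.indicator 1 (T y))
      (fun x ↦ (indicator_measurable.comp hT).const_mul _) (K := 1) fun x y ↦ by
        rw [abs_mul, abs_bpsk, one_mul]; exact indicator_bound _,
      integral_uniformOn_prod_comp C hφ (F := fun _ y ↦ e (T y) * B.indicator 1 (T y))
      (fun _ ↦ (he.comp hT).mul (indicator_measurable.comp hT)) (K := 1) fun _ y ↦ by
        rw [abs_mul]; exact mul_le_one₀ (he1 _) (abs_nonneg _) (indicator_bound _)]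
    simp only [integral_const_mul]
    exact orthogonal _ indicator_measurable indicator_bound

end UniformInput

section ChannelInformation

variable {U Ω : Type*} [MeasurableSpace U] [MeasurableSpace Ω] {ν : Measure Ω}
  [IsProbabilityMeasure ν]

namespace BinaryInputChannel

variable (W : BinaryInputChannel U)

theorem expect_integral_law {f : U → ℝ} (hf : Integrable f W.mix) :
    𝔼 b, ∫ u, f u ∂W.law b = ∫ u, f u ∂W.mix := by
  rw [Fintype.expect_eq_sum_div_card, Fintype.sum_bool,
    W.integral_law_true_add_integral_law_false hf, Fintype.card_bool, Nat.cast_two,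
    mul_div_cancel_left₀ _ two_ne_zero]

theorem isPosteriorMean {φ : Bool → Ω → U} (hφ : ∀ b, MeasurePreserving (φ b) ν (W.law b)) :
    IsPosteriorMean ((uniformOn (Finset.univ : Finset Bool)).prod ν) (fun ω ↦ ω.1)
      (fun ω ↦ φ ω.1 ω.2) W.posteriorMean := by
  refine isPosteriorMean_uniformOn_prod hφ id measurable_id W.measurable_posteriorMean
    W.abs_posteriorMean_le_one fun f hf hf1 ↦ ?_
  have mean_mul_integrable : Integrable (fun u ↦ W.posteriorMean u * f u) W.mix :=
    integrable_of_abs_le (W.measurable_posteriorMean.mul hf) (K := 1) fun u ↦ by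
      rw [abs_mul]; exact mul_le_one₀ (W.abs_posteriorMean_le_one u) (abs_nonneg _) (hf1 u)
  simp only [id]
  rw [W.expect_integral_law mean_mul_integrable, Fintype.expect_eq_sum_div_card,
    Fintype.sum_bool, Fintype.card_bool, Nat.cast_two, bpsk, bpsk, if_pos rfl,
    if_neg Bool.false_ne_true, one_mul, neg_one_mul, ← sub_eq_add_neg,
    W.integral_law_true_sub_integral_law_false (integrable_of_abs_le hf hf1),
    mul_div_cancel_left₀ _ two_ne_zero]

theorem integral_uniformOn_prod_comp_eq_integral_mix {φ : Bool → Ω → U}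
    (hφ : ∀ b, MeasurePreserving (φ b) ν (W.law b)) {f : U → ℝ} (hf : Measurable f) {K : ℝ}
    (hK : ∀ u, |f u| ≤ K) :
    ∫ ω, f (φ ω.1 ω.2) ∂(uniformOn (Finset.univ : Finset Bool)).prod ν = ∫ u, f u ∂W.mix := by
  rw [← W.expect_integral_law (integrable_of_abs_le hf hK)]
  exact integral_uniformOn_prod_comp Finset.univ hφ (F := fun _ ↦ f) (fun _ ↦ hf) fun _ ↦ hK

theorem mutualInfoBits_uniformOn_prod {φ : Bool → Ω → U}
    (hφ : ∀ b, MeasurePreserving (φ b) ν (W.law b)) :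
    mutualInfoBits ((uniformOn (Finset.univ : Finset Bool)).prod ν) (fun ω ↦ ω.1)
      (fun ω ↦ φ ω.1 ω.2) = W.symmetricInfo / Real.log 2 := by
  have := isProbabilityMeasure_uniformOn (Finset.univ : Finset Bool).finite_toSet
    Finset.univ_nonempty
  have density_integrable : Integrable (W.density true) W.mix :=
    integrable_of_abs_le (W.measurable_density true) fun u ↦
      (abs_of_pos (W.density_pos true u)).trans_le (W.density_le_two true u)
  have prior_mean : ∫ u, W.posteriorMean u ∂W.mix = 0 := by
    simp only [posteriorMean]
    rw [integral_sub density_integrable (integrable_const (1 : ℝ)), W.integral_density]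
    simp
  have entropy_posterior (u : U) :
      bitEntropy (W.posteriorMean u) = Real.binEntropy (W.density true u / 2) := by
    rw [bitEntropy, posteriorMean, add_sub_cancel]
  rw [(W.isPosteriorMean hφ).mutualInfoBits_eq,
    W.integral_uniformOn_prod_comp_eq_integral_mix hφ W.measurable_posteriorMean
      W.abs_posteriorMean_le_one,
    W.integral_uniformOn_prod_comp_eq_integral_mix hφ
      (f := fun u ↦ bitEntropy (W.posteriorMean u))
      (continuous_bitEntropy.measurable.comp W.measurable_posteriorMean)
      (fun u ↦ abs_bitEntropy_le (W.abs_posteriorMean_le_one u)), prior_mean, symmetricInfo]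
  simp only [entropy_posterior]
  simp [bitEntropy]

end BinaryInputChannel

end ChannelInformation

section BiAwgnInfo

theorem biAwgnInfo_eq (γ : ℝ) :
    biAwgnInfo γ = (gaussianChannel (Real.sqrt γ)).symmetricInfo / Real.log 2 := by
  rw [biAwgnInfo, ← Finset.coe_univ]
  exact (gaussianChannel _).mutualInfoBits_uniformOn_prod
    (gaussianChannel.measurePreserving_signal_add (Real.sqrt γ))

theorem continuous_biAwgnInfo : Continuous biAwgnInfo := by
  rw [funext biAwgnInfo_eq]
  exact (continuous_symmetricInfo_gaussianChannel.comp Real.continuous_sqrt).div_const _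

theorem monotone_biAwgnInfo : Monotone biAwgnInfo := fun γ γ' h ↦ by
  rw [biAwgnInfo_eq, biAwgnInfo_eq]
  refine div_le_div_of_nonneg_right ?_ (Real.log_nonneg one_le_two)
  rcases (Real.sqrt_le_sqrt h).eq_or_lt with heq | hlt
  · rw [heq]
  · exact symmetricInfo_gaussianChannel_le (Real.sqrt_nonneg _) hlt

theorem biAwgnInfo_pos {γ : ℝ} (hγ : 0 < γ) : 0 < biAwgnInfo γ := by
  rw [biAwgnInfo_eq]
  exact div_pos (BinaryInputChannel.symmetricInfo_pos
    ((BinaryInputChannel.power_nonneg _).trans_lt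
      (power_gaussianChannel_lt le_rfl (Real.sqrt_pos.2 hγ)))) (Real.log_pos one_lt_two)

theorem biAwgnInfo_le_one (γ : ℝ) : biAwgnInfo γ ≤ 1 := by
  rw [biAwgnInfo_eq, div_le_one (Real.log_pos one_lt_two)]
  exact BinaryInputChannel.symmetricInfo_le_log_two _

theorem exists_le_biAwgnInfo {a : ℝ} (ha : a < 1) : ∃ γ, 0 ≤ γ ∧ a ≤ biAwgnInfo γ := by
  have info_tendsto : Tendsto biAwgnInfo atTop (𝓝 1) := by
    rw [funext biAwgnInfo_eq, ← div_self (Real.log_pos one_lt_two).ne']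
    exact (tendsto_symmetricInfo_gaussianChannel.comp Real.tendsto_sqrt_atTop).div_const _
  obtain ⟨γ, hγ, h0⟩ :=
    ((info_tendsto.eventually (lt_mem_nhds ha)).and (eventually_ge_atTop 0)).exists
  exact ⟨γ, h0, hγ.le⟩

theorem snrOfInfo_nonneg (a : ℝ) : 0 ≤ snrOfInfo a := Real.sInf_nonneg fun _ h ↦ h.1

theorem snrOfInfo_lt {a γ : ℝ} (hγ : 0 < γ) (ha : a < biAwgnInfo γ) : snrOfInfo a < γ := by
  have info_gt : ∀ᶠ γ' in 𝓝[<] γ, a < biAwgnInfo γ' :=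
    (continuous_biAwgnInfo.continuousAt.eventually (lt_mem_nhds ha)).filter_mono nhdsWithin_le_nhds
  have pos : ∀ᶠ γ' in 𝓝[<] γ, 0 < γ' := (lt_mem_nhds hγ).filter_mono nhdsWithin_le_nhds
  obtain ⟨γ', ⟨ha', h0⟩, hlt⟩ := ((info_gt.and pos).and self_mem_nhdsWithin).exists
  have bounded_below : BddBelow {γ : ℝ | 0 ≤ γ ∧ a ≤ biAwgnInfo γ} := ⟨0, fun _ h ↦ h.1⟩
  exact (csInf_le bounded_below ⟨h0.le, ha'.le⟩).trans_lt hlt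

theorem lt_snrOfInfo {a γ : ℝ} (ha : biAwgnInfo γ < a) (ha1 : a < 1) : γ < snrOfInfo a := by
  have info_lt : ∀ᶠ γ' in 𝓝[>] γ, biAwgnInfo γ' < a :=
    (continuous_biAwgnInfo.continuousAt.eventually (gt_mem_nhds ha)).filter_mono nhdsWithin_le_nhds
  obtain ⟨γ', ha', hlt⟩ := (info_lt.and self_mem_nhdsWithin).exists
  refine hlt.trans_le (le_csInf (exists_le_biAwgnInfo ha1) fun γ'' hγ'' ↦ ?_)
  by_contra! hc
  exact (hγ''.2.trans (monotone_biAwgnInfo hc.le)).not_gt ha'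

theorem monotoneOn_snrOfInfo : MonotoneOn snrOfInfo (Set.Iio 1) := fun _ _ _ hb hab ↦
  csInf_le_csInf ⟨0, fun _ h ↦ h.1⟩ (exists_le_biAwgnInfo hb) fun _ h ↦ ⟨h.1, hab.trans h.2⟩

end BiAwgnInfo

section LogLikelihoodRatio

/-- The log-likelihood ratio of a bit whose symbol has mean `m`. -/
noncomputable def llrOfMean (m : ℝ) : EReal :=
  ENNReal.log (ENNReal.ofReal (bitProb m true) / ENNReal.ofReal (bitProb m false))

/-- The mean of the symbol of a bit of log-likelihood ratio `l`; this is `tanh (l / 2)` for real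
`l` and `±1` for `l = ±∞`. -/
noncomputable def meanOfLLR (l : EReal) : ℝ := 1 - 2 * ((1 + EReal.exp l)⁻¹).toReal

theorem measurable_llrOfMean : Measurable llrOfMean :=
  ENNReal.measurable_log.comp ((continuous_bitProb true).measurable.ennreal_ofReal.div
    (continuous_bitProb false).measurable.ennreal_ofReal)

theorem measurable_meanOfLLR : Measurable meanOfLLR :=
  (((EReal.measurable_exp.const_add 1).inv.ennreal_toReal).const_mul 2).const_sub 1

theorem abs_meanOfLLR_le_one (l : EReal) : |meanOfLLR l| ≤ 1 := by
  have nonneg : 0 ≤ ((1 + EReal.exp l)⁻¹).toReal := ENNReal.toReal_nonneg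
  have le_one : ((1 + EReal.exp l)⁻¹).toReal ≤ 1 :=
    ENNReal.toReal_mono ENNReal.one_ne_top (ENNReal.inv_le_one.2 le_self_add)
  rw [meanOfLLR, abs_le]
  constructor <;> linarith

theorem meanOfLLR_llrOfMean {m : ℝ} (hm : |m| ≤ 1) : meanOfLLR (llrOfMean m) = m := by
  have sum_eq_one : ENNReal.ofReal (bitProb m false) + ENNReal.ofReal (bitProb m true) = 1 := by
    rw [← ENNReal.ofReal_add (bitProb_nonneg hm _) (bitProb_nonneg hm _), bitProb, bitProb]
    norm_num [bpsk]
    ring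
  have false_eq : bitProb m false = (1 - m) / 2 := by norm_num [bitProb, bpsk, sub_eq_add_neg]
  rw [meanOfLLR, llrOfMean, ENNReal.exp_log]
  rcases (bitProb_nonneg hm false).eq_or_lt with certain | pos
  · obtain rfl : m = 1 := by linarith
    simp [bitProb, bpsk]
  · have odds : 1 + ENNReal.ofReal (bitProb m true) / ENNReal.ofReal (bitProb m false)
        = (ENNReal.ofReal (bitProb m false))⁻¹ := by
      conv_lhs => rw [← ENNReal.div_self (ENNReal.ofReal_pos.2 pos).ne' ENNReal.ofReal_ne_top,
        ← ENNReal.add_div, sum_eq_one]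
      rw [one_div]
    rw [odds, inv_inv, ENNReal.toReal_ofReal pos.le, false_eq]
    ring

theorem strictMono_meanOfLLR : StrictMono meanOfLLR := by
  intro l l' hl
  have inv_lt : (1 + EReal.exp l')⁻¹ < (1 + EReal.exp l)⁻¹ := ENNReal.inv_lt_inv.2
    (ENNReal.add_lt_add_left ENNReal.one_ne_top (EReal.exp_strictMono hl))
  have toReal_lt := ENNReal.toReal_strict_mono (by simp) inv_lt
  rw [meanOfLLR, meanOfLLR]
  linarith

theorem meanOfLLR_coe (r : ℝ) : meanOfLLR r = 1 - 2 * (1 + Real.exp r)⁻¹ := by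
  rw [meanOfLLR, EReal.exp_coe, ← ENNReal.ofReal_one, ← ENNReal.ofReal_add zero_le_one
    (Real.exp_pos r).le, ENNReal.toReal_inv, ENNReal.toReal_ofReal (by positivity)]

theorem meanOfLLR_neg (l : EReal) : meanOfLLR (-l) = -meanOfLLR l := by
  induction l with
  | bot => norm_num [meanOfLLR]
  | top => norm_num [meanOfLLR]
  | coe r =>
    rw [← EReal.coe_neg, meanOfLLR_coe, meanOfLLR_coe, Real.exp_neg]
    field_simp
    ring

theorem meanOfLLR_bpsk_mul (b : Bool) (l : EReal) :
    meanOfLLR (bpsk b * l) = bpsk b * meanOfLLR l := by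
  cases b <;> simp [bpsk, meanOfLLR_neg]

theorem meanOfLLR_pos {ε : ℝ} (hε : 0 < ε) : 0 < meanOfLLR ε := by
  have zero_eq : meanOfLLR (0 : ℝ) = 0 := by norm_num [meanOfLLR_coe, -EReal.coe_zero]
  exact zero_eq ▸ strictMono_meanOfLLR (EReal.coe_lt_coe hε)

theorem meanOfLLR_coe_lt_one (r : ℝ) : meanOfLLR r < 1 := by
  rw [meanOfLLR_coe]
  exact sub_lt_self _ (by positivity)

theorem sq_meanOfLLR_le_of_notMem_Icc {ε : ℝ} (hε : 0 < ε) {l : EReal}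
    (hl : l ∉ Set.Icc ((-ε : ℝ) : EReal) ε) : meanOfLLR ε ^ 2 ≤ meanOfLLR l ^ 2 := by
  rw [sq_le_sq, abs_of_pos (meanOfLLR_pos hε), le_abs, ← meanOfLLR_neg]
  rcases not_and_or.1 hl with below | above
  · right
    rw [← neg_neg (ε : EReal), ← EReal.coe_neg]
    exact strictMono_meanOfLLR.monotone (EReal.neg_le_neg_iff.2 (not_le.1 below).le)
  · exact Or.inl (strictMono_meanOfLLR.monotone (not_le.1 above).le)

end LogLikelihoodRatio

section PosteriorPower

variable {Ω β : Type*} [MeasurableSpace Ω] [MeasurableSpace β]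

theorem integral_const_sub {μ : Measure Ω} [IsProbabilityMeasure μ] {f : Ω → ℝ}
    (hf : Integrable f μ) (c : ℝ) : ∫ ω, (c - f ω) ∂μ = c - ∫ ω, f ω ∂μ := by
  rw [integral_sub (integrable_const c) hf, integral_const, probReal_univ, one_smul]

theorem sq_integral_le_integral_sq {μ : Measure Ω} [IsProbabilityMeasure μ] {f : Ω → ℝ}
    (hf : Measurable f) {K : ℝ} (hK : ∀ ω, |f ω| ≤ K) :
    (∫ ω, f ω ∂μ) ^ 2 ≤ ∫ ω, f ω ^ 2 ∂μ := by
  have memLp : MemLp f 2 μ := MemLp.of_bound hf.aestronglyMeasurable K (ae_of_all _ hK)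
  have := variance_nonneg f μ
  rw [variance_eq_sub memLp] at this
  simpa using this

theorem integral_sqrt_le_sqrt_integral {μ : Measure Ω} [IsProbabilityMeasure μ] {f : Ω → ℝ}
    (hf : Measurable f) (hf0 : ∀ ω, 0 ≤ f ω) (hf1 : ∀ ω, f ω ≤ 1) :
    ∫ ω, √(f ω) ∂μ ≤ √(∫ ω, f ω ∂μ) := by
  refine Real.le_sqrt_of_sq_le
    ((sq_integral_le_integral_sq hf.sqrt (K := 1) fun ω ↦ ?_).trans_eq ?_)
  · exact (abs_of_nonneg (Real.sqrt_nonneg _)).trans_le (Real.sqrt_le_one.2 (hf1 ω))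
  · simp only [Real.sq_sqrt (hf0 _)]

theorem expect_sqrt_le_sqrt_expect {ι : Type*} (s : Finset ι) {f : ι → ℝ} (hf : ∀ i, 0 ≤ f i) :
    𝔼 i ∈ s, √(f i) ≤ √(𝔼 i ∈ s, f i) := by
  refine Real.le_sqrt_of_sq_le ?_
  have cauchy_schwarz := Finset.expect_mul_sq_le_sq_mul_sq s (fun i ↦ √(f i)) fun _ ↦ 1
  simp only [mul_one, one_pow, Real.sq_sqrt (hf _)] at cauchy_schwarz
  rcases s.eq_empty_or_nonempty with rfl | hs
  · simp
  · rwa [Finset.expect_const hs, mul_one] at cauchy_schwarz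

namespace IsPosteriorMean

variable {μ : Measure Ω} {X : Ω → Bool} {Y : Ω → β} {e : β → ℝ}

theorem sq_comp_le_one (h : IsPosteriorMean μ X Y e) (ω : Ω) : e (Y ω) ^ 2 ≤ 1 :=
  (sq_le_one_iff_abs_le_one _).2 (h.abs_le_one _)

theorem integral_bpsk (h : IsPosteriorMean μ X Y e) :
    ∫ ω, bpsk (X ω) ∂μ = ∫ ω, e (Y ω) ∂μ := by
  simpa using h.setIntegral_bpsk Set.univ MeasurableSet.univ

variable [IsProbabilityMeasure μ]

theorem integrable_sq_comp (h : IsPosteriorMean μ X Y e) :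
    Integrable (fun ω ↦ e (Y ω) ^ 2) μ :=
  h.integrable_continuous_comp (continuous_pow 2)

theorem integral_sq_comp_le_one (h : IsPosteriorMean μ X Y e) : ∫ ω, e (Y ω) ^ 2 ∂μ ≤ 1 := by
  simpa using integral_mono h.integrable_sq_comp (integrable_const (1 : ℝ)) h.sq_comp_le_one

theorem condExp_bpsk_ae_eq (h : IsPosteriorMean μ X Y e) :
    μ[fun ω ↦ bpsk (X ω)|MeasurableSpace.comap Y inferInstance] =ᵐ[μ] fun ω ↦ e (Y ω) := by
  refine (ae_eq_condExp_of_forall_setIntegral_eq h.measurable_observation.comap_le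
    h.integrable_bpsk (fun _ _ _ ↦ h.integrable_comp.integrableOn) ?_ ?_).symm
  · rintro _ ⟨B, hB, rfl⟩ -
    exact (h.setIntegral_bpsk B hB).symm
  · exact (h.measurable_mean.comp (comap_measurable Y)).stronglyMeasurable.aestronglyMeasurable

theorem integral_bpsk_mul_comp (h : IsPosteriorMean μ X Y e) :
    ∫ ω, bpsk (X ω) * e (Y ω) ∂μ = ∫ ω, e (Y ω) ^ 2 ∂μ := by
  have product_integrable : Integrable (fun ω ↦ bpsk (X ω) * e (Y ω)) μ :=
    integrable_of_abs_le (h.measurable_bpsk.mul h.measurable_comp) (K := 1) fun ω ↦ by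
      rw [abs_mul, abs_bpsk, one_mul]
      exact h.abs_le_one _
  have pull_out := condExp_mul_of_stronglyMeasurable_right (μ := μ)
    (h.measurable_mean.comp (comap_measurable Y)).stronglyMeasurable product_integrable
    h.integrable_bpsk
  rw [← integral_condExp h.measurable_observation.comap_le]
  refine integral_congr_ae ?_
  filter_upwards [pull_out, h.condExp_bpsk_ae_eq] with ω hω hω'
  refine hω.trans ?_
  rw [Pi.mul_apply, hω', Function.comp_apply, sq]

theorem sq_integral_bpsk_le (h : IsPosteriorMean μ X Y e) :
    (∫ ω, bpsk (X ω) ∂μ) ^ 2 ≤ ∫ ω, e (Y ω) ^ 2 ∂μ := by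
  rw [h.integral_bpsk]
  exact sq_integral_le_integral_sq h.measurable_comp fun ω ↦ h.abs_le_one (Y ω)

theorem abs_real_sub_half_le (h : IsPosteriorMean μ X Y e) :
    |μ.real (X ⁻¹' {true}) - 1 / 2| ≤ √(∫ ω, e (Y ω) ^ 2 ∂μ) := by
  have half_bias : μ.real (X ⁻¹' {true}) - 1 / 2 = (∫ ω, bpsk (X ω) ∂μ) / 2 := by
    rw [h.real_preimage, h.integral_bpsk, bitProb, bpsk, if_pos rfl]
    ring
  rw [half_bias, abs_div, abs_two]
  exact (half_le_self (abs_nonneg _)).trans (Real.abs_le_sqrt h.sq_integral_bpsk_le)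

theorem mutualInfoBits_le_one (h : IsPosteriorMean μ X Y e) : mutualInfoBits μ X Y ≤ 1 := by
  rw [h.mutualInfoBits_eq, div_le_one (Real.log_pos one_lt_two)]
  exact (sub_le_self _ (integral_nonneg fun ω ↦ bitEntropy_nonneg (h.abs_le_one _))).trans
    (bitEntropy_le_log_two _)

theorem mutualInfoBits_le (h : IsPosteriorMean μ X Y e) :
    mutualInfoBits μ X Y ≤ (∫ ω, e (Y ω) ^ 2 ∂μ) / Real.log 2 := by
  have entropy_ge : Real.log 2 - ∫ ω, e (Y ω) ^ 2 ∂μ ≤ ∫ ω, bitEntropy (e (Y ω)) ∂μ := by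
    rw [← integral_const_sub h.integrable_sq_comp]
    exact integral_mono ((integrable_const _).sub h.integrable_sq_comp)
      (h.integrable_continuous_comp continuous_bitEntropy)
      fun ω ↦ log_two_sub_sq_le_bitEntropy (h.abs_le_one _)
  rw [h.mutualInfoBits_eq]
  have := bitEntropy_le_log_two (∫ ω, e (Y ω) ∂μ)
  exact div_le_div_of_nonneg_right (by linarith) (Real.log_pos one_lt_two).le

theorem le_mutualInfoBits (h : IsPosteriorMean μ X Y e) :
    1 - ((∫ ω, bpsk (X ω) ∂μ) ^ 2 + 2 * √(1 - ∫ ω, e (Y ω) ^ 2 ∂μ)) / Real.log 2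
      ≤ mutualInfoBits μ X Y := by
  have defect_bounds (ω : Ω) : 0 ≤ 1 - e (Y ω) ^ 2 ∧ 1 - e (Y ω) ^ 2 ≤ 1 :=
    ⟨sub_nonneg.2 (h.sq_comp_le_one ω), sub_le_self _ (sq_nonneg _)⟩
  have entropy_le : ∫ ω, bitEntropy (e (Y ω)) ∂μ ≤ 2 * √(1 - ∫ ω, e (Y ω) ^ 2 ∂μ) :=
    calc ∫ ω, bitEntropy (e (Y ω)) ∂μ
        ≤ ∫ ω, 2 * √(1 - e (Y ω) ^ 2) ∂μ :=
          integral_mono (h.integrable_continuous_comp continuous_bitEntropy)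
            (h.integrable_continuous_comp (g := fun t ↦ 2 * √(1 - t ^ 2)) (by fun_prop))
            fun ω ↦ bitEntropy_le_two_mul_sqrt (h.abs_le_one _)
      _ = 2 * ∫ ω, √(1 - e (Y ω) ^ 2) ∂μ := integral_const_mul _ _
      _ ≤ 2 * √(∫ ω, (1 - e (Y ω) ^ 2) ∂μ) := mul_le_mul_of_nonneg_left
          (integral_sqrt_le_sqrt_integral ((h.measurable_comp.pow_const 2).const_sub 1)
            (fun ω ↦ (defect_bounds ω).1) fun ω ↦ (defect_bounds ω).2) zero_le_two
      _ = 2 * √(1 - ∫ ω, e (Y ω) ^ 2 ∂μ) := by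
          rw [integral_const_sub h.integrable_sq_comp]
  have prior_entropy := log_two_sub_sq_le_bitEntropy h.abs_integral_le_one
  rw [h.mutualInfoBits_eq, h.integral_bpsk, one_sub_div (Real.log_pos one_lt_two).ne']
  exact div_le_div_of_nonneg_right (by linarith) (Real.log_pos one_lt_two).le

variable {Λ : Ω → EReal}

theorem real_llr_notMem_Icc_le (h : IsPosteriorMean μ X Λ meanOfLLR) {ε : ℝ} (hε : 0 < ε) :
    μ.real {ω | Λ ω ∉ Set.Icc ((-ε : ℝ) : EReal) ε}
      ≤ (∫ ω, meanOfLLR (Λ ω) ^ 2 ∂μ) / meanOfLLR ε ^ 2 := by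
  have markov := mul_meas_ge_le_integral_of_nonneg (ae_of_all μ fun ω ↦ sq_nonneg (meanOfLLR (Λ ω)))
    h.integrable_sq_comp (meanOfLLR ε ^ 2)
  rw [le_div_iff₀ (pow_pos (meanOfLLR_pos hε) 2), mul_comm]
  exact (mul_le_mul_of_nonneg_left (measureReal_mono fun ω hω ↦
    sq_meanOfLLR_le_of_notMem_Icc hε hω) (sq_nonneg _)).trans markov

theorem real_bpsk_mul_llr_le (h : IsPosteriorMean μ X Λ meanOfLLR) (M : ℝ) :
    μ.real {ω | (bpsk (X ω) : EReal) * Λ ω ≤ M}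
      ≤ (1 - ∫ ω, meanOfLLR (Λ ω) ^ 2 ∂μ) / (1 - meanOfLLR M) := by
  have agreement_le_one (ω : Ω) : bpsk (X ω) * meanOfLLR (Λ ω) ≤ 1 := by
    rw [← meanOfLLR_bpsk_mul]
    exact (abs_le.1 (abs_meanOfLLR_le_one _)).2
  have agreement_integrable : Integrable (fun ω ↦ bpsk (X ω) * meanOfLLR (Λ ω)) μ :=
    h.integrable_comp.bdd_mul h.measurable_bpsk.aestronglyMeasurable
      (ae_of_all _ fun ω ↦ (abs_bpsk (X ω)).le)
  have markov := mul_meas_ge_le_integral_of_nonneg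
    (ae_of_all μ fun ω ↦ sub_nonneg.2 (agreement_le_one ω))
    ((integrable_const 1).sub agreement_integrable) (1 - meanOfLLR M)
  rw [le_div_iff₀ (sub_pos.2 (meanOfLLR_coe_lt_one M)), mul_comm, ← h.integral_bpsk_mul_comp,
    ← integral_const_sub agreement_integrable]
  refine (mul_le_mul_of_nonneg_left (measureReal_mono fun ω hω ↦ ?_)
    (sub_pos.2 (meanOfLLR_coe_lt_one M)).le).trans markov
  rw [Set.mem_ofPred_eq, ← meanOfLLR_bpsk_mul]
  exact sub_le_sub_left (strictMono_meanOfLLR.monotone hω) 1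

end IsPosteriorMean

end PosteriorPower

namespace BinaryCode

variable {n : ℕ}

section ReceivedWord

theorem measurable_bit (i : Fin n) : Measurable (bit i) :=
  (measurable_pi_apply i).comp measurable_fst

theorem measurable_received (γ : ℝ) :
    Measurable fun (ω : (Fin n → Bool) × (Fin n → ℝ)) j ↦ received γ j ω :=
  measurable_pi_lambda _ fun j ↦ ((measurable_of_countable fun b ↦ √γ * bpsk b).comp
    (measurable_bit j)).add ((measurable_pi_apply j).comp measurable_snd)

theorem measurePreserving_signal_add (γ : ℝ) (x : Fin n → Bool) :
    MeasurePreserving (fun (z : Fin n → ℝ) j ↦ √γ * bpsk (x j) + z j)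
      (Measure.pi fun _ ↦ gaussianReal 0 1) ((gaussianChannel √γ).wordLaw x) :=
  measurePreserving_pi _ _ fun j ↦ gaussianChannel.measurePreserving_signal_add √γ (x j)

theorem integral_law_received (C : Finset (Fin n → Bool)) (γ : ℝ)
    {F : (Fin n → Bool) → (Fin n → ℝ) → ℝ} (hF : ∀ x, Measurable (F x)) {K : ℝ}
    (hK : ∀ x y, |F x y| ≤ K) :
    ∫ ω, F ω.1 (fun j ↦ received γ j ω) ∂law C
      = 𝔼 x ∈ C, ∫ y, F x y ∂(gaussianChannel √γ).wordLaw x :=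
  integral_uniformOn_prod_comp C (measurePreserving_signal_add γ) hF hK

theorem isProbabilityMeasure_law {C : Finset (Fin n → Bool)} (hC : C.Nonempty) :
    IsProbabilityMeasure (law C) := by
  have := isProbabilityMeasure_uniformOn C.finite_toSet hC
  unfold law
  infer_instance

theorem errorProb_eq_expect (C : Finset (Fin n → Bool)) (γ : ℝ)
    {dec : (Fin n → ℝ) → (Fin n → Bool)} (hdec : Measurable dec) :
    errorProb C γ dec = 𝔼 x ∈ C, ((gaussianChannel √γ).wordLaw x).real {y | dec y ≠ x} := by
  have error_measurable (x : Fin n → Bool) : MeasurableSet {y | dec y ≠ x} :=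
    (hdec (measurableSet_singleton x)).compl
  have event_measurable : MeasurableSet {ω | dec (fun j ↦ received γ j ω) ≠ ω.1} :=
    (measurableSet_eq_fun (hdec.comp (measurable_received γ)) measurable_fst).compl
  have fibers := integral_law_received C γ
    (F := fun x ↦ {y | dec y ≠ x}.indicator 1) (K := 1)
    (fun x ↦ measurable_one.indicator (error_measurable x)) fun x y ↦ by
      by_cases hy : dec y = x <;> simp [hy]
  simp only [integral_indicator_one (error_measurable _)] at fibers
  rw [← fibers, errorProb, ← integral_indicator_one event_measurable]
  rfl

end ReceivedWord

section ExtrinsicEstimate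

/-- The word with the values `z` outside position `i` and the value `0` at position `i`. -/
noncomputable def fillIn (i : Fin n) (z : {j : Fin n // j ≠ i} → ℝ) (j : Fin n) : ℝ :=
  if h : j ≠ i then z ⟨j, h⟩ else 0

/-- The conditional mean of the `i`-th symbol given the values received at the other positions. -/
noncomputable def extrinsicEstimate (C : Finset (Fin n → Bool)) (γ : ℝ) (i : Fin n)
    (ω : (Fin n → Bool) × (Fin n → ℝ)) : ℝ :=
  (gaussianChannel √γ).extrinsicMean C i fun j ↦ received γ j ω

variable (C : Finset (Fin n → Bool)) (γ : ℝ) (i : Fin n)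

theorem measurable_fillIn : Measurable (fillIn i) := by
  refine measurable_pi_lambda _ fun j ↦ ?_
  by_cases h : j = i
  · simp only [fillIn, h, ne_eq, not_true_eq_false, dite_false]
    exact measurable_const
  · simp only [fillIn, ne_eq, h, not_false_eq_true, dite_true]
    exact measurable_pi_apply _

theorem fillIn_restrict (y : Fin n → ℝ) : fillIn i (fun j ↦ y j) = Function.update y i 0 := by
  ext j
  by_cases h : j = i
  · subst h
    simp [fillIn]
  · simp [fillIn, h]

theorem extrinsicMean_fillIn (W : BinaryInputChannel ℝ) (y : Fin n → ℝ) :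
    W.extrinsicMean C i (fillIn i fun j ↦ y j) = W.extrinsicMean C i y := by
  rw [fillIn_restrict, W.extrinsicMean_update]

theorem measurable_extrinsicEstimate : Measurable (extrinsicEstimate C γ i) :=
  ((gaussianChannel √γ).measurable_extrinsicMean C i).comp (measurable_received γ)

theorem abs_extrinsicEstimate_le_one (ω : (Fin n → Bool) × (Fin n → ℝ)) :
    |extrinsicEstimate C γ i ω| ≤ 1 :=
  (gaussianChannel √γ).abs_extrinsicMean_le_one C i _

theorem continuous_extrinsicEstimate (ω : (Fin n → Bool) × (Fin n → ℝ)) :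
    Continuous fun γ ↦ extrinsicEstimate C γ i ω := by
  rcases C.eq_empty_or_nonempty with rfl | hC
  · simp only [extrinsicEstimate, BinaryInputChannel.extrinsicMean, Finset.sum_empty, zero_div]
    exact continuous_const
  have received_continuous (j : Fin n) : Continuous fun γ ↦ (√γ, received γ j ω) :=
    Real.continuous_sqrt.prodMk ((Real.continuous_sqrt.mul_const _).add_const _)
  have density_continuous (x : Fin n → Bool) : Continuous fun γ ↦
      (gaussianChannel √γ).extrinsicDensity i x fun j ↦ received γ j ω :=
    continuous_finsetProd _ fun j _ ↦
      (continuous_gaussianDensity (x j)).comp (received_continuous j)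
  exact (continuous_finsetSum _ fun x _ ↦ (density_continuous x).const_mul _).div₀
    (continuous_finsetSum _ fun x _ ↦ density_continuous x) fun γ ↦
      (Finset.sum_pos (fun x _ ↦ (gaussianChannel √γ).extrinsicDensity_pos i x _) hC).ne'

theorem isPosteriorMean_others : IsPosteriorMean (law C) (bit i)
    (fun ω (j : {j : Fin n // j ≠ i}) ↦ received γ j ω)
    (fun z ↦ (gaussianChannel √γ).extrinsicMean C i (fillIn i z)) := by
  have restrict_measurable :
      Measurable fun (y : Fin n → ℝ) (j : {j : Fin n // j ≠ i}) ↦ y j :=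
    measurable_pi_lambda _ fun j ↦ measurable_pi_apply j.1
  refine isPosteriorMean_uniformOn_prod (T := fun y (j : {j : Fin n // j ≠ i}) ↦ y j)
    (measurePreserving_signal_add γ) (fun x ↦ x i) restrict_measurable
    (((gaussianChannel √γ).measurable_extrinsicMean C i).comp (measurable_fillIn i))
    (fun z ↦ (gaussianChannel √γ).abs_extrinsicMean_le_one C i _) fun f hf hf1 ↦ ?_
  have ignores_position (y : Fin n → ℝ) (v : ℝ) :
      f (fun j : {j : Fin n // j ≠ i} ↦ Function.update y i v j) = f fun j ↦ y j := by
    congr 1 with j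
    exact Function.update_of_ne j.2 _ _
  simp only [extrinsicMean_fillIn]
  exact (gaussianChannel √γ).expect_bpsk_mul_integral_wordLaw C
    (hf.comp restrict_measurable) (fun y ↦ hf1 _) ignores_position

end ExtrinsicEstimate

section ExtrinsicLLR

variable {C : Finset (Fin n → Bool)}

theorem measurable_extrinsicLLR (C : Finset (Fin n → Bool)) (γ : ℝ) (i : Fin n) :
    Measurable (extrinsicLLR C γ i) := by
  have prob_measurable (b : Bool) : Measurable (extrinsicProb C γ i b) :=
    stronglyMeasurable_condExp.measurable.mono
      (isPosteriorMean_others C γ i).measurable_observation.comap_le le_rfl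
  exact ENNReal.measurable_log.comp
    ((prob_measurable true).ennreal_ofReal.div (prob_measurable false).ennreal_ofReal)

theorem extrinsicLLR_ae_eq (hC : C.Nonempty) (γ : ℝ) (i : Fin n) :
    extrinsicLLR C γ i =ᵐ[law C] fun ω ↦ llrOfMean (extrinsicEstimate C γ i ω) := by
  have := isProbabilityMeasure_law hC
  filter_upwards [(isPosteriorMean_others C γ i).condExp_bit_ae_eq true,
    (isPosteriorMean_others C γ i).condExp_bit_ae_eq false] with ω true_eq false_eq
  rw [extrinsicMean_fillIn C i _ fun j ↦ received γ j ω] at true_eq false_eq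
  exact congrArg ENNReal.log
    (congrArg₂ (fun p q ↦ ENNReal.ofReal p / ENNReal.ofReal q) true_eq false_eq)

theorem isPosteriorMean_extrinsicLLR (hC : C.Nonempty) (γ : ℝ) (i : Fin n) :
    IsPosteriorMean (law C) (bit i) (extrinsicLLR C γ i) meanOfLLR := by
  refine (isPosteriorMean_others C γ i).of_ae_eq
    (measurable_llrOfMean.comp (isPosteriorMean_others C γ i).measurable_mean)
    (measurable_extrinsicLLR C γ i) ?_ measurable_meanOfLLR abs_meanOfLLR_le_one
    fun z ↦ meanOfLLR_llrOfMean ((isPosteriorMean_others C γ i).abs_le_one z)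
  filter_upwards [extrinsicLLR_ae_eq hC γ i] with ω hω
  rw [hω, Function.comp_apply, Function.comp_apply,
    extrinsicMean_fillIn C i _ fun j ↦ received γ j ω, extrinsicEstimate]

theorem integral_comp_meanOfLLR_extrinsicLLR (hC : C.Nonempty) (γ : ℝ) (i : Fin n) (g : ℝ → ℝ) :
    ∫ ω, g (meanOfLLR (extrinsicLLR C γ i ω)) ∂law C
      = ∫ ω, g (extrinsicEstimate C γ i ω) ∂law C := by
  refine integral_congr_ae ?_
  filter_upwards [extrinsicLLR_ae_eq hC γ i] with ω hω
  rw [hω, meanOfLLR_llrOfMean (abs_extrinsicEstimate_le_one C γ i ω)]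

theorem integral_sq_meanOfLLR_extrinsicLLR (hC : C.Nonempty) (γ : ℝ) (i : Fin n) :
    ∫ ω, meanOfLLR (extrinsicLLR C γ i ω) ^ 2 ∂law C = 𝔼 x ∈ C,
      ∫ y, (gaussianChannel √γ).extrinsicMean C i y ^ 2 ∂(gaussianChannel √γ).wordLaw x := by
  rw [integral_comp_meanOfLLR_extrinsicLLR hC γ i (· ^ 2)]
  exact integral_law_received C γ
    (F := fun _ y ↦ (gaussianChannel √γ).extrinsicMean C i y ^ 2)
    (fun _ ↦ ((gaussianChannel √γ).measurable_extrinsicMean C i).pow_const 2) (K := 1)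
    fun _ y ↦ (abs_of_nonneg (sq_nonneg _)).trans_le
      ((gaussianChannel √γ).extrinsicMean_sq_le_one C i y)

theorem mutualInfoBits_extrinsicLLR_eq (hC : C.Nonempty) (γ : ℝ) (i : Fin n) :
    mutualInfoBits (law C) (bit i) (extrinsicLLR C γ i)
      = (bitEntropy (∫ ω, bpsk (bit i ω) ∂law C)
        - ∫ ω, bitEntropy (extrinsicEstimate C γ i ω) ∂law C) / Real.log 2 := by
  have := isProbabilityMeasure_law hC
  rw [(isPosteriorMean_extrinsicLLR hC γ i).mutualInfoBits_eq,
    ← (isPosteriorMean_extrinsicLLR hC γ i).integral_bpsk,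
    integral_comp_meanOfLLR_extrinsicLLR hC γ i bitEntropy]

theorem continuous_extrinsicInfo (hC : C.Nonempty) : Continuous (extrinsicInfo C) := by
  have := isProbabilityMeasure_law hC
  unfold extrinsicInfo
  simp only [mutualInfoBits_extrinsicLLR_eq hC]
  refine (continuous_finsetSum _ fun i _ ↦ (continuous_const.sub ?_).div_const _).div_const _
  exact continuous_of_dominated (bound := fun _ ↦ Real.log 2)
    (fun γ ↦ (continuous_bitEntropy.measurable.comp
      (measurable_extrinsicEstimate C γ i)).aestronglyMeasurable)
    (fun γ ↦ ae_of_all _ fun ω ↦ abs_bitEntropy_le (abs_extrinsicEstimate_le_one C γ i ω))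
    (integrable_const _)
    (ae_of_all _ fun ω ↦ continuous_bitEntropy.comp (continuous_extrinsicEstimate C i ω))

end ExtrinsicLLR

end BinaryCode

namespace BinaryCode

variable {n : ℕ}

section CodeBounds

theorem sum_div_eq_expect (f : Fin n → ℝ) : (∑ i, f i) / n = 𝔼 i, f i := by
  rw [Fintype.expect_eq_sum_div_card, Fintype.card_fin]

theorem expect_const_sub (hn : 0 < n) (c : ℝ) (f : Fin n → ℝ) :
    𝔼 i, (c - f i) = c - 𝔼 i, f i := by
  have := Fin.pos_iff_nonempty.1 hn
  rw [Finset.expect_sub_distrib, Fintype.expect_const]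

/-- The mean square of the conditional means of the bits given the extrinsic LLRs, averaged over the
positions: it is `0` when the LLRs are useless and `1` when they determine the bits. -/
noncomputable def extrinsicPower (C : Finset (Fin n → Bool)) (γ : ℝ) : ℝ :=
  𝔼 i, ∫ ω, meanOfLLR (extrinsicLLR C γ i ω) ^ 2 ∂law C

theorem extrinsicPower_nonneg (C : Finset (Fin n → Bool)) (γ : ℝ) : 0 ≤ extrinsicPower C γ :=
  Finset.expect_nonneg fun _ _ ↦ integral_nonneg fun _ ↦ sq_nonneg _

theorem log_card_le (C : Finset (Fin n → Bool)) : Real.log C.card ≤ n * Real.log 2 := by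
  rcases C.eq_empty_or_nonempty with rfl | hC
  · simpa using mul_nonneg n.cast_nonneg (Real.log_pos one_lt_two).le
  rw [← Real.log_pow]
  refine Real.log_le_log (Nat.cast_pos.2 hC.card_pos) ?_
  have card_le := C.card_le_univ
  rw [Fintype.card_fun, Fintype.card_bool, Fintype.card_fin] at card_le
  exact_mod_cast card_le

theorem extrinsicInfo_nonneg (C : Finset (Fin n → Bool)) (γ : ℝ) : 0 ≤ extrinsicInfo C γ :=
  div_nonneg (Finset.sum_nonneg fun _ _ ↦
    div_nonneg ENNReal.toReal_nonneg (Real.log_pos one_lt_two).le) n.cast_nonneg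

variable {C : Finset (Fin n → Bool)} (hC : C.Nonempty) (γ : ℝ)
include hC

theorem extrinsicPower_le_one : extrinsicPower C γ ≤ 1 := by
  have := isProbabilityMeasure_law hC
  rw [extrinsicPower, ← sum_div_eq_expect]
  refine div_le_one_of_le₀ ?_ n.cast_nonneg
  simpa using Finset.sum_le_card_nsmul Finset.univ _ 1 fun i _ ↦
    (isPosteriorMean_extrinsicLLR hC γ i).integral_sq_comp_le_one

theorem avg_abs_bit_sub_half_le :
    (∑ i, |(law C).real {ω | bit i ω = true} - 1 / 2|) / n ≤ √(extrinsicPower C γ) := by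
  have := isProbabilityMeasure_law hC
  rw [sum_div_eq_expect]
  exact (Finset.expect_le_expect fun i _ ↦
      (isPosteriorMean_extrinsicLLR hC γ i).abs_real_sub_half_le).trans
    (expect_sqrt_le_sqrt_expect _ fun _ ↦ integral_nonneg fun _ ↦ sq_nonneg _)

theorem avg_extrinsicLLR_notMem_le {ε : ℝ} (hε : 0 < ε) :
    (∑ i, (law C).real {ω | extrinsicLLR C γ i ω ∉ Set.Icc ((-ε : ℝ) : EReal) ε}) / n
      ≤ extrinsicPower C γ / meanOfLLR ε ^ 2 := by
  have := isProbabilityMeasure_law hC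
  rw [sum_div_eq_expect, extrinsicPower, Finset.expect_div]
  exact Finset.expect_le_expect fun i _ ↦
    (isPosteriorMean_extrinsicLLR hC γ i).real_llr_notMem_Icc_le hε

theorem avg_bpsk_mul_extrinsicLLR_le (hn : 0 < n) (M : ℝ) :
    (∑ i, (law C).real {ω | (bpsk (bit i ω) : EReal) * extrinsicLLR C γ i ω ≤ M}) / n
      ≤ (1 - extrinsicPower C γ) / (1 - meanOfLLR M) := by
  have := isProbabilityMeasure_law hC
  rw [sum_div_eq_expect, extrinsicPower, ← expect_const_sub hn, Finset.expect_div]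
  exact Finset.expect_le_expect fun i _ ↦
    (isPosteriorMean_extrinsicLLR hC γ i).real_bpsk_mul_llr_le M

theorem extrinsicInfo_le_one : extrinsicInfo C γ ≤ 1 := by
  have := isProbabilityMeasure_law hC
  refine div_le_one_of_le₀ ?_ n.cast_nonneg
  simpa using Finset.sum_le_card_nsmul Finset.univ _ 1 fun i _ ↦
    (isPosteriorMean_extrinsicLLR hC γ i).mutualInfoBits_le_one

theorem extrinsicInfo_le : extrinsicInfo C γ ≤ extrinsicPower C γ / Real.log 2 := by
  have := isProbabilityMeasure_law hC
  rw [extrinsicInfo, sum_div_eq_expect, extrinsicPower, Finset.expect_div]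
  exact Finset.expect_le_expect fun i _ ↦
    (isPosteriorMean_extrinsicLLR hC γ i).mutualInfoBits_le

theorem le_extrinsicInfo (hn : 0 < n) (γ₀ : ℝ) :
    1 - (extrinsicPower C γ₀ + 2 * √(1 - extrinsicPower C γ)) / Real.log 2
      ≤ extrinsicInfo C γ := by
  have := isProbabilityMeasure_law hC
  have posterior := isPosteriorMean_extrinsicLLR hC
  have avg_sqrt_le : 𝔼 i, √(1 - ∫ ω, meanOfLLR (extrinsicLLR C γ i ω) ^ 2 ∂law C)
      ≤ √(1 - extrinsicPower C γ) := by
    rw [extrinsicPower, ← expect_const_sub hn]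
    exact expect_sqrt_le_sqrt_expect _ fun i ↦ sub_nonneg.2 (posterior γ i).integral_sq_comp_le_one
  have avg_bias_le : 𝔼 i, (∫ ω, bpsk (bit i ω) ∂law C) ^ 2 ≤ extrinsicPower C γ₀ :=
    Finset.expect_le_expect fun i _ ↦ (posterior γ₀ i).sq_integral_bpsk_le
  calc 1 - (extrinsicPower C γ₀ + 2 * √(1 - extrinsicPower C γ)) / Real.log 2
      ≤ 1 - (𝔼 i, (∫ ω, bpsk (bit i ω) ∂law C) ^ 2
          + 2 * 𝔼 i, √(1 - ∫ ω, meanOfLLR (extrinsicLLR C γ i ω) ^ 2 ∂law C)) / Real.log 2 := by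
        gcongr
    _ = 𝔼 i, (1 - ((∫ ω, bpsk (bit i ω) ∂law C) ^ 2
          + 2 * √(1 - ∫ ω, meanOfLLR (extrinsicLLR C γ i ω) ^ 2 ∂law C)) / Real.log 2) := by
        rw [expect_const_sub hn, ← Finset.expect_div, Finset.expect_add_distrib, Finset.mul_expect]
    _ ≤ extrinsicInfo C γ := by
        rw [extrinsicInfo, sum_div_eq_expect]
        exact Finset.expect_le_expect fun i _ ↦ (posterior γ i).le_mutualInfoBits

theorem overlap_mul_one_sub_extrinsicPower_le (hn : 0 < n) {dec : (Fin n → ℝ) → (Fin n → Bool)}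
    (hdec : Measurable dec) :
    (gaussianChannel √γ).overlap / 4 * (1 - extrinsicPower C γ) ≤ errorProb C γ dec := by
  have := Fin.pos_iff_nonempty.1 hn
  rw [extrinsicPower, ← expect_const_sub hn, Finset.mul_expect,
    ← Fintype.expect_const (ι := Fin n) (errorProb C γ dec), errorProb_eq_expect C γ hdec]
  simp only [integral_sq_meanOfLLR_extrinsicLLR hC]
  exact Finset.expect_le_expect fun i _ ↦
    (gaussianChannel √γ).overlap_mul_one_sub_expect_extrinsicMean_sq_le hC i hdec

variable {γ} in
theorem mul_extrinsicPower_le (hn : 0 < n) {γ' : ℝ} (hγ : 0 ≤ γ) (hγγ' : γ < γ')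
    {dec : (Fin n → ℝ) → (Fin n → Bool)} (hdec : Measurable dec) :
    (((gaussianChannel √γ').power - (gaussianChannel √γ).power) / 4) ^ 2 * extrinsicPower C γ
      ≤ (gaussianChannel √γ').symmetricInfo - rate C * Real.log 2
        + Real.binEntropy (errorProb C γ' dec) + errorProb C γ' dec * Real.log 2 := by
  have := isProbabilityMeasure_law hC
  have hn' : (1 : ℝ) ≤ n := Nat.one_le_cast.2 hn
  have n_pos : (0 : ℝ) < n := zero_lt_one.trans_le hn'
  have converse := BinaryInputChannel.sum_expect_extrinsicMean_sq_add_log_card_le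
    (isDegradation_degrade (Real.sqrt_nonneg γ) (Real.sqrt_lt_sqrt hγ hγγ')) hC hdec
    (gaussianChannel.integral_log_density √γ') (errorProb_eq_expect C γ' hdec).symm
  simp only [← integral_sq_meanOfLLR_extrinsicLLR hC, Fintype.card_fin] at converse
  set err := errorProb C γ' dec
  have err_nonneg : 0 ≤ err := measureReal_nonneg
  have log_card_eq : Real.log C.card = rate C * Real.log 2 * n := by
    have := (Real.log_pos one_lt_two).ne'
    rw [rate, Real.logb]
    field_simp
  have entropy_le : Real.binEntropy err ≤ n * Real.binEntropy err :=
    le_mul_of_one_le_left (Real.binEntropy_nonneg err_nonneg measureReal_le_one) hn'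
  have error_term_le : err * Real.log C.card ≤ err * (n * Real.log 2) :=
    mul_le_mul_of_nonneg_left (log_card_le C) err_nonneg
  rw [extrinsicPower, ← sum_div_eq_expect, ← mul_div_assoc, div_le_iff₀ n_pos]
  linarith

end CodeBounds

section CapacityAchieving

variable {SNR : ℝ} {n : ℕ → ℕ} {C : (k : ℕ) → Finset (Fin (n k) → Bool)}

theorem eventually_length_pos (hSNR : 0 < SNR) (hC : CapacityAchieving SNR n C) :
    ∀ᶠ k in atTop, 0 < n k := by
  filter_upwards [hC.1.eventually (lt_mem_nhds (biAwgnInfo_pos hSNR))] with k hk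
  refine Nat.pos_of_ne_zero fun h ↦ hk.ne' ?_
  rw [rate, (Nat.cast_eq_zero (R := ℝ)).2 h, div_zero]

theorem exists_symmetricInfo_lt {δ : ℝ} (hδ : 0 < δ) : ∃ γ, SNR < γ ∧
    (gaussianChannel √γ).symmetricInfo < (gaussianChannel √SNR).symmetricInfo + δ := by
  have close : ∀ᶠ γ in 𝓝[>] SNR,
      (gaussianChannel √γ).symmetricInfo < (gaussianChannel √SNR).symmetricInfo + δ :=
    ((continuous_symmetricInfo_gaussianChannel.comp Real.continuous_sqrt).continuousAt.eventually
      (gt_mem_nhds (lt_add_of_pos_right _ hδ))).filter_mono nhdsWithin_le_nhds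
  exact (eventually_mem_nhdsWithin.and close).exists

theorem tendsto_rate_deficit (hC : CapacityAchieving SNR n C) {err : ℕ → ℝ}
    (herr : Tendsto err atTop (𝓝 0)) :
    Tendsto (fun k ↦ (gaussianChannel √SNR).symmetricInfo - rate (C k) * Real.log 2
      + Real.binEntropy (err k) + err k * Real.log 2) atTop (𝓝 0) := by
  have capacity : biAwgnInfo SNR * Real.log 2 = (gaussianChannel √SNR).symmetricInfo := by
    rw [biAwgnInfo_eq, div_mul_cancel₀ _ (Real.log_pos one_lt_two).ne']
  have limit := ((tendsto_const_nhds (x := (gaussianChannel √SNR).symmetricInfo)).sub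
    (hC.1.mul_const (Real.log 2))).add
      ((Real.binEntropy_continuous.tendsto 0).comp herr) |>.add (herr.mul_const (Real.log 2))
  simpa [capacity] using limit

theorem tendsto_extrinsicPower_zero (hSNR : 0 < SNR) (hne : ∀ k, (C k).Nonempty)
    (hC : CapacityAchieving SNR n C) {γ : ℝ} (hγ : 0 ≤ γ) (hγS : γ < SNR) :
    Tendsto (fun k ↦ extrinsicPower (C k) γ) atTop (𝓝 0) := by
  rw [tendsto_order]
  refine ⟨fun a ha ↦ Eventually.of_forall fun k ↦ ha.trans_le (extrinsicPower_nonneg (C k) γ),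
    fun η hη ↦ ?_⟩
  set P : ℝ → ℝ := fun γ ↦ (gaussianChannel √γ).power
  have gap_pos : 0 < (P SNR - P γ) / 4 := div_pos (sub_pos.2
    (power_gaussianChannel_lt (Real.sqrt_nonneg γ) (Real.sqrt_lt_sqrt hγ hγS))) four_pos
  have gain_pos : 0 < ((P SNR - P γ) / 4) ^ 2 * η := mul_pos (pow_pos gap_pos 2) hη
  obtain ⟨γ', hSγ', info_lt⟩ := exists_symmetricInfo_lt (SNR := SNR) (half_pos gain_pos)
  obtain ⟨dec, hdec, herr⟩ := hC.2 γ' hSγ'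
  filter_upwards [eventually_length_pos hSNR hC,
    (tendsto_rate_deficit hC herr).eventually (gt_mem_nhds (half_pos gain_pos))] with k hn deficit
  have power_lt : P SNR < P γ' :=
    power_gaussianChannel_lt (Real.sqrt_nonneg SNR) (Real.sqrt_lt_sqrt hSNR.le hSγ')
  refine lt_of_mul_lt_mul_left ?_ (sq_nonneg ((P SNR - P γ) / 4))
  calc ((P SNR - P γ) / 4) ^ 2 * extrinsicPower (C k) γ
      ≤ ((P γ' - P γ) / 4) ^ 2 * extrinsicPower (C k) γ := mul_le_mul_of_nonneg_right
        (pow_le_pow_left₀ gap_pos.le (by linarith) 2) (extrinsicPower_nonneg _ _)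
    _ ≤ _ := mul_extrinsicPower_le (hne k) hn hγ (hγS.trans hSγ') (hdec k)
    _ < ((P SNR - P γ) / 4) ^ 2 * η := by linarith

theorem tendsto_extrinsicPower_one (hSNR : 0 < SNR) (hne : ∀ k, (C k).Nonempty)
    (hC : CapacityAchieving SNR n C) {γ : ℝ} (hγ : SNR < γ) :
    Tendsto (fun k ↦ extrinsicPower (C k) γ) atTop (𝓝 1) := by
  obtain ⟨dec, hdec, herr⟩ := hC.2 γ hγ
  have overlap_pos : 0 < (gaussianChannel √γ).overlap / 4 :=
    div_pos (gaussianChannel √γ).overlap_pos four_pos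
  have lower := (herr.div_const ((gaussianChannel √γ).overlap / 4)).const_sub 1
  rw [zero_div, sub_zero] at lower
  refine tendsto_of_tendsto_of_tendsto_of_le_of_le' lower tendsto_const_nhds ?_
    (Eventually.of_forall fun k ↦ extrinsicPower_le_one (hne k) γ)
  filter_upwards [eventually_length_pos hSNR hC] with k hn
  rw [sub_le_comm, le_div_iff₀' overlap_pos]
  exact overlap_mul_one_sub_extrinsicPower_le (hne k) γ hn (hdec k)

theorem tendsto_avg_abs_bit_sub_half (hSNR : 0 < SNR) (hne : ∀ k, (C k).Nonempty)
    (hC : CapacityAchieving SNR n C) :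
    Tendsto (fun k ↦ (∑ i : Fin (n k), |(law (C k)).real {ω | bit i ω = true} - 1 / 2|) / (n k : ℝ))
      atTop (𝓝 0) := by
  have bound := (tendsto_extrinsicPower_zero hSNR hne hC le_rfl hSNR).sqrt
  rw [Real.sqrt_zero] at bound
  exact squeeze_zero (fun k ↦ div_nonneg (Finset.sum_nonneg fun _ _ ↦ abs_nonneg _)
    (Nat.cast_nonneg _)) (fun k ↦ avg_abs_bit_sub_half_le (hne k) 0) bound

theorem tendsto_avg_extrinsicLLR_notMem (hSNR : 0 < SNR) (hne : ∀ k, (C k).Nonempty)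
    (hC : CapacityAchieving SNR n C) {γ : ℝ} (hγ : 0 ≤ γ) (hγS : γ < SNR) {ε : ℝ} (hε : 0 < ε) :
    Tendsto (fun k ↦ (∑ i : Fin (n k), (law (C k)).real
      {ω | extrinsicLLR (C k) γ i ω ∉ Set.Icc ((-ε : ℝ) : EReal) (ε : EReal)}) / (n k : ℝ))
      atTop (𝓝 0) := by
  have bound := (tendsto_extrinsicPower_zero hSNR hne hC hγ hγS).div_const (meanOfLLR ε ^ 2)
  rw [zero_div] at bound
  exact squeeze_zero (fun k ↦ div_nonneg (Finset.sum_nonneg fun _ _ ↦ measureReal_nonneg)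
    (Nat.cast_nonneg _)) (fun k ↦ avg_extrinsicLLR_notMem_le (hne k) γ hε) bound

theorem tendsto_avg_bpsk_mul_extrinsicLLR_le (hSNR : 0 < SNR) (hne : ∀ k, (C k).Nonempty)
    (hC : CapacityAchieving SNR n C) {γ : ℝ} (hγ : SNR < γ) (M : ℝ) :
    Tendsto (fun k ↦ (∑ i : Fin (n k), (law (C k)).real
      {ω | (bpsk (bit i ω) : EReal) * extrinsicLLR (C k) γ i ω ≤ (M : EReal)}) / (n k : ℝ))
      atTop (𝓝 0) := by
  have bound := ((tendsto_extrinsicPower_one hSNR hne hC hγ).const_sub 1).div_const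
    (1 - meanOfLLR M)
  rw [sub_self, zero_div] at bound
  refine tendsto_of_tendsto_of_tendsto_of_le_of_le' tendsto_const_nhds bound
    (Eventually.of_forall fun k ↦ div_nonneg (Finset.sum_nonneg fun _ _ ↦ measureReal_nonneg)
      (Nat.cast_nonneg _)) ?_
  filter_upwards [eventually_length_pos hSNR hC] with k hn
  exact avg_bpsk_mul_extrinsicLLR_le (hne k) γ hn M

theorem tendsto_extrinsicInfo_zero (hSNR : 0 < SNR) (hne : ∀ k, (C k).Nonempty)
    (hC : CapacityAchieving SNR n C) {γ : ℝ} (hγ : 0 ≤ γ) (hγS : γ < SNR) :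
    Tendsto (fun k ↦ extrinsicInfo (C k) γ) atTop (𝓝 0) := by
  have bound := (tendsto_extrinsicPower_zero hSNR hne hC hγ hγS).div_const (Real.log 2)
  rw [zero_div] at bound
  exact squeeze_zero (fun k ↦ extrinsicInfo_nonneg (C k) γ)
    (fun k ↦ extrinsicInfo_le (hne k) γ) bound

theorem tendsto_extrinsicInfo_one (hSNR : 0 < SNR) (hne : ∀ k, (C k).Nonempty)
    (hC : CapacityAchieving SNR n C) {γ : ℝ} (hγ : SNR < γ) :
    Tendsto (fun k ↦ extrinsicInfo (C k) γ) atTop (𝓝 1) := by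
  have defect := (((tendsto_extrinsicPower_one hSNR hne hC hγ).const_sub 1).sqrt).const_mul 2
  have lower := (((tendsto_extrinsicPower_zero hSNR hne hC le_rfl hSNR).add defect).div_const
    (Real.log 2)).const_sub 1
  rw [sub_self, Real.sqrt_zero, mul_zero, add_zero, zero_div, sub_zero] at lower
  refine tendsto_of_tendsto_of_tendsto_of_le_of_le' lower tendsto_const_nhds ?_
    (Eventually.of_forall fun k ↦ extrinsicInfo_le_one (hne k) γ)
  filter_upwards [eventually_length_pos hSNR hC] with k hn
  exact le_extrinsicInfo (hne k) γ hn 0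

end CapacityAchieving

section ExitCurve

theorem abs_exitCurve_le_one {C : Finset (Fin n → Bool)} (hC : C.Nonempty) (a : ℝ) :
    |exitCurve C a| ≤ 1 :=
  (abs_of_nonneg (extrinsicInfo_nonneg C _)).trans_le (extrinsicInfo_le_one hC _)

theorem intervalIntegrable_exitCurve {C : Finset (Fin n → Bool)} (hC : C.Nonempty) :
    IntervalIntegrable (exitCurve C) volume 0 1 := by
  rw [intervalIntegrable_iff_integrableOn_Ioo_of_le zero_le_one]
  have snr_aemeasurable : AEMeasurable snrOfInfo (volume.restrict (Set.Ioo (0 : ℝ) 1)) :=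
    aemeasurable_restrict_of_monotoneOn measurableSet_Ioo
      (monotoneOn_snrOfInfo.mono Set.Ioo_subset_Iio_self)
  exact (integrable_const (1 : ℝ)).mono'
    ((continuous_extrinsicInfo hC).measurable.comp_aemeasurable
      snr_aemeasurable).aestronglyMeasurable
    (ae_of_all _ (abs_exitCurve_le_one hC))

variable {SNR : ℝ} {n : ℕ → ℕ} {C : (k : ℕ) → Finset (Fin (n k) → Bool)}

theorem tendsto_exitCurve_zero (hSNR : 0 < SNR) (hne : ∀ k, (C k).Nonempty)
    (hC : CapacityAchieving SNR n C) {a : ℝ} (ha : a < biAwgnInfo SNR) :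
    Tendsto (fun k ↦ exitCurve (C k) a) atTop (𝓝 0) :=
  tendsto_extrinsicInfo_zero hSNR hne hC (snrOfInfo_nonneg a) (snrOfInfo_lt hSNR ha)

theorem tendsto_exitCurve_one (hSNR : 0 < SNR) (hne : ∀ k, (C k).Nonempty)
    (hC : CapacityAchieving SNR n C) {a : ℝ} (ha : biAwgnInfo SNR < a) (ha1 : a < 1) :
    Tendsto (fun k ↦ exitCurve (C k) a) atTop (𝓝 1) :=
  tendsto_extrinsicInfo_one hSNR hne hC (lt_snrOfInfo ha ha1)

theorem tendsto_integral_exitCurve (hSNR : 0 < SNR) (hne : ∀ k, (C k).Nonempty)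
    (hC : CapacityAchieving SNR n C) :
    Tendsto (fun k ↦ ∫ a in (0 : ℝ)..1, exitCurve (C k) a) atTop (𝓝 (1 - biAwgnInfo SNR)) := by
  set R := biAwgnInfo SNR
  have step_area : ∫ a in (0 : ℝ)..1, (Set.Ioc R 1).indicator (fun _ ↦ (1 : ℝ)) a = 1 - R := by
    rw [intervalIntegral.integral_of_le zero_le_one, setIntegral_indicator measurableSet_Ioc,
      Set.inter_eq_right.2 (Set.Ioc_subset_Ioc_left (biAwgnInfo_pos hSNR).le), setIntegral_const]
    simp [R, biAwgnInfo_le_one SNR]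
  rw [← step_area]
  refine intervalIntegral.tendsto_integral_filter_of_dominated_convergence (fun _ ↦ (1 : ℝ))
    (Eventually.of_forall fun k ↦
      (intervalIntegrable_exitCurve (hne k)).def'.aestronglyMeasurable)
    (Eventually.of_forall fun k ↦ ae_of_all _ fun a _ ↦ abs_exitCurve_le_one (hne k) a)
    intervalIntegrable_const ?_
  filter_upwards [volume.ae_ne R, volume.ae_ne 1] with a a_ne_R a_ne_one ha
  rw [Set.uIoc_of_le zero_le_one] at ha
  rcases lt_or_gt_of_ne a_ne_R with below | above
  · rw [Set.indicator_of_notMem fun hm ↦ below.not_gt hm.1]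
    exact tendsto_exitCurve_zero hSNR hne hC below
  · rw [Set.indicator_of_mem (show a ∈ Set.Ioc R 1 from ⟨above, ha.2⟩)]
    exact tendsto_exitCurve_one hSNR hne hC above (ha.2.lt_of_ne a_ne_one)

end ExitCurve

end BinaryCode

theorem mainTheorem7 (SNR : ℝ) (hSNR : 0 < SNR) (n : ℕ → ℕ)
    (C : (k : ℕ) → Finset (Fin (n k) → Bool)) (hne : ∀ k, (C k).Nonempty)
    (hC : BinaryCode.CapacityAchieving SNR n C) :
    -- the bits are equiprobable
    Tendsto (fun k => (∑ i : Fin (n k),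
        |(BinaryCode.law (C k)).real {ω | BinaryCode.bit i ω = true} - 1 / 2|) / (n k : ℝ))
      atTop (𝓝 0) ∧
    -- below the threshold the extrinsic LLRs are zero and carry no information
    (∀ γ : ℝ, 0 ≤ γ → γ < SNR →
      (∀ ε : ℝ, 0 < ε → Tendsto (fun k => (∑ i : Fin (n k),
          (BinaryCode.law (C k)).real
            {ω | BinaryCode.extrinsicLLR (C k) γ i ω ∉ Set.Icc (((-ε : ℝ) : EReal)) (ε : EReal)})
          / (n k : ℝ)) atTop (𝓝 0)) ∧
      Tendsto (fun k => BinaryCode.extrinsicInfo (C k) γ) atTop (𝓝 0)) ∧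
    -- above the threshold they are infinite, with the sign of the bit, and carry one bit
    (∀ γ : ℝ, SNR < γ →
      (∀ M : ℝ, Tendsto (fun k => (∑ i : Fin (n k),
          (BinaryCode.law (C k)).real
            {ω | (bpsk (BinaryCode.bit i ω) : EReal) * BinaryCode.extrinsicLLR (C k) γ i ω
              ≤ (M : EReal)})
          / (n k : ℝ)) atTop (𝓝 0)) ∧
      Tendsto (fun k => BinaryCode.extrinsicInfo (C k) γ) atTop (𝓝 1)) ∧
    -- the EXIT curve is flat, jumps at the channel information, and has area one minus the rate
    (∀ a : ℝ, 0 ≤ a → a < biAwgnInfo SNR →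
      Tendsto (fun k => BinaryCode.exitCurve (C k) a) atTop (𝓝 0)) ∧
    (∀ a : ℝ, biAwgnInfo SNR < a → a < 1 →
      Tendsto (fun k => BinaryCode.exitCurve (C k) a) atTop (𝓝 1)) ∧
    (∀ k, IntervalIntegrable (BinaryCode.exitCurve (C k)) volume 0 1) ∧
    Tendsto (fun k => ∫ a in (0 : ℝ)..1, BinaryCode.exitCurve (C k) a) atTop
      (𝓝 (1 - biAwgnInfo SNR)) := by
  exact ⟨BinaryCode.tendsto_avg_abs_bit_sub_half hSNR hne hC,
    fun _ h0 h => ⟨fun _ hε => BinaryCode.tendsto_avg_extrinsicLLR_notMem hSNR hne hC h0 h hε,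
      BinaryCode.tendsto_extrinsicInfo_zero hSNR hne hC h0 h⟩,
    fun _ h => ⟨fun M => BinaryCode.tendsto_avg_bpsk_mul_extrinsicLLR_le hSNR hne hC h M,
      BinaryCode.tendsto_extrinsicInfo_one hSNR hne hC h⟩,
    fun _ _ h => BinaryCode.tendsto_exitCurve_zero hSNR hne hC h,
    fun _ h h1 => BinaryCode.tendsto_exitCurve_one hSNR hne hC h h1,
    fun k => BinaryCode.intervalIntegrable_exitCurve (hne k),
    BinaryCode.tendsto_integral_exitCurve hSNR hne hC⟩
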